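/- \textbf{Theorem} (Existence of minimizers). Let $M$ be a compact smooth $n$-dimensional Riemannian manifold without boundary, $\mathcal P(M)$ the set of Borel probability measures on $M$ with the narrow topology, and let $K:M\times M\to\mathbb R$ be continuous with $K(x,y)\ge C$ for all $x,y\in M$ and some constant $C>0$. For $\mu\in\mathcal P(M)$ put $m_\mu(x)=\int_M K(x,y)\,d\mu(y)$. For $T>0$ and $\nu,\eta\in\mathcal P(M)$ let $CE(0,T;\nu\to\eta)$ be the set of pairs $(\mu,v)$ where $t\mapsto\mu_t\in\mathcal P(M)$ is narrowly continuous on $[0,T]$ with $\mu_0=\nu$, $\mu_T=\eta$, where $(x,t)\mapsto v_t(x)\in T_xM$ is a Borel velocity field on $M\times(0,T)$ with $\int_0^T\int_M|v_t(x)|\,d\mu_t(x)\,dt<\infty$, and where $$\int_0^T\int_M \partial_t\varphi(x,t)+\langle \mathcal D_x\varphi(x,t),v_t(x)\rangle\,d\mu_t(x)\,dt=0\qquad\text{for all }\varphi\in C^1_c(M\times(0,T)).$$ Write $s_{\mu,v}(t)=\bigl(\int_M m_{\mu_t}(x)|v_t(x)|^2\,d\mu_t(x)\bigr)^{1/2}\in[0,\infty]$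 and define $W_{m,2}(\nu,\eta)\in[0,\infty]$ by $$W_{m,2}^2(\nu,\eta)=\inf\Bigl\{\int_0^1 s_{\mu,v}(t)^2\,dt:\ (\mu,v)\in CE(0,1;\nu\to\eta)\Bigr\},\qquad \inf\emptyset=+\infty .$$ Then: \begin{enumerate} \item If $W_{m,2}(\mu_0,\mu_1)<\infty$, there is $(\mu,v)\in CE(0,1;\mu_0\to\mu_1)$ with $W_{m,2}^2(\mu_0,\mu_1)=\int_0^1\int_M m_{\mu_t}|v_t|^2\,d\mu_t\,dt$ (a \emph{minimizer of the action}). \item For all $\mu_0,\mu_1\in\mathcal P(M)$ and all $T>0$, $$W_{m,2}(\mu_0,\mu_1)=\inf\Bigl\{\int_0^T s_{\mu,v}(t)\,dt:\ (\mu,v)\in CE(0,T;\mu_0\to\mu_1)\Bigr\}.$$ \item If $W_{m,2}(\mu_0,\mu_1)<\infty$, then a pair in $CE(0,1;\mu_0\to\mu_1)$ is a minimizer of the action if and only if it attains the infimum in (2) with $T=1$ and $s_{\mu,v}$ is a.e. equal to a constant on $(0,1)$. Moreover, if $(\mu,v)$ attains the infimum in (2) for some $T>0$, then $\mu$ is a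 reparametrization of a minimizer of the action: there are a minimizer $(\hat\mu,\hat v)\in CE(0,1;\mu_0\to\mu_1)$ of the action and a continuous nondecreasing $\tau:[0,T]\to[0,1]$ with $\tau(0)=0$, $\tau(T)=1$ and $\mu_t=\hat\mu_{\tau(t)}$ for all $t\in[0,T]$. \item If $W_{m,2}(\mu_0,\mu_1)<\infty$, every minimizer $(\mu,v)\in CE(0,1;\mu_0\to\mu_1)$ of the action has constant speed: $s_{\mu,v}(t)=W_{m,2}(\mu_0,\mu_1)$ for a.e. $t\in(0,1)$, and $W_{m,2}(\mu_s,\mu_t)=|t-s|\,W_{m,2}(\mu_0,\mu_1)$ for all $0\le s\le t\le1$. \end{enumerate} -/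

import Mathlib

open MeasureTheory Set Bundle
open scoped Manifold ContDiff ENNReal Topology

noncomputable section

namespace NonlocalTransport

/-- A time-dependent family of probability measures `μ t` on `M` together with a time-dependent
velocity field `v t x ∈ T_x M`.  Only the restriction to the time interval at hand matters. -/
abbrev Pair (n : ℕ) (M : Type*) [TopologicalSpace M] [ChartedSpace (EuclideanSpace ℝ (Fin n)) M]
    [MeasurableSpace M] : Type _ :=
  (ℝ → ProbabilityMeasure M) × (ℝ → ∀ x : M, TangentSpace (𝓡 n) x)

section

variable {n : ℕ} {M : Type*} [TopologicalSpace M] [ChartedSpace (EuclideanSpace ℝ (Fin n)) M]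

/-- Test functions in `C¹_c(M × (0,T))`, extended by zero to `M × ℝ`. -/
structure IsTestFunction (n : ℕ) {M : Type*} [TopologicalSpace M]
    [ChartedSpace (EuclideanSpace ℝ (Fin n)) M] (T : ℝ) (φ : M × ℝ → ℝ) : Prop where
  contMDiff : ContMDiff ((𝓡 n).prod 𝓘(ℝ, ℝ)) 𝓘(ℝ, ℝ) 1 φ
  hasCompactSupport : HasCompactSupport φ
  tsupport_subset : tsupport φ ⊆ univ ×ˢ Ioo 0 T

/-- The differential in space of `φ` at `(x, t)`, applied to the tangent vector `w ∈ T_x M`. -/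
def spaceDeriv (φ : M × ℝ → ℝ) (t : ℝ) (x : M) (w : TangentSpace (𝓡 n) x) : ℝ :=
  mfderiv (𝓡 n) 𝓘(ℝ, ℝ) (fun y : M ↦ φ (y, t)) x w

variable [MeasurableSpace M]

/-- The continuity equation `∂ₜ μ + div (v μ) = 0` on `(0,T) × M` in the sense of distributions. -/
def SatisfiesContinuityEquation (T : ℝ) (p : Pair n M) : Prop :=
  ∀ φ : M × ℝ → ℝ, IsTestFunction n T φ →
    ∫ t in Ioo 0 T, ∫ x, (deriv (fun s : ℝ ↦ φ (x, s)) t + spaceDeriv φ t x (p.2 t x))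
      ∂(p.1 t : Measure M) = 0

/-- `v` is a Borel map from `(0,T) × M` to the tangent bundle (with its Borel σ-algebra). -/
def IsBorelField [IsManifold (𝓡 n) 1 M] (T : ℝ) (v : ℝ → ∀ x : M, TangentSpace (𝓡 n) x) : Prop :=
  @Measurable (Ioo (0 : ℝ) T × M) (TangentBundle (𝓡 n) M) _ (borel _)
    (fun q ↦ ⟨q.2, v q.1 q.2⟩)

/-- The mobility `m_μ(x) = ∫ K(x,y) dμ(y)`. -/
def mobility (K : M → M → ℝ) (μ : ProbabilityMeasure M) (x : M) : ℝ :=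
  ∫ y, K x y ∂(μ : Measure M)

variable [IsManifold (𝓡 n) 1 M] [RiemannianBundle (fun x : M ↦ TangentSpace (𝓡 n) x)]

/-- The set `CE(0,T)` of solutions of the continuity equation.  The narrowly continuous curve `μ`
is taken with its values at the end points `0` and `T`. -/
structure IsCE [OpensMeasurableSpace M] (T : ℝ) (p : Pair n M) : Prop where
  continuousOn : ContinuousOn p.1 (Icc 0 T)
  borel : IsBorelField T p.2
  lintegral_lt_top : ∫⁻ t in Ioo 0 T, ∫⁻ x, ‖p.2 t x‖ₑ ∂(p.1 t : Measure M) < (⊤ : ℝ≥0∞)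
  continuityEquation : SatisfiesContinuityEquation T p

/-- The set `CE(0,T; ν → η)`. -/
def CE (n : ℕ) {M : Type*} [TopologicalSpace M] [ChartedSpace (EuclideanSpace ℝ (Fin n)) M]
    [MeasurableSpace M] [OpensMeasurableSpace M] [IsManifold (𝓡 n) 1 M]
    [RiemannianBundle (fun x : M ↦ TangentSpace (𝓡 n) x)]
    (T : ℝ) (ν η : ProbabilityMeasure M) : Set (Pair n M) :=
  {p | IsCE T p ∧ p.1 0 = ν ∧ p.1 T = η}

/-- `∫ m_{μ_t}(x) |v_t(x)|² dμ_t(x)`. -/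
def energy (K : M → M → ℝ) (p : Pair n M) (t : ℝ) : ℝ≥0∞ :=
  ∫⁻ x, ENNReal.ofReal (mobility K (p.1 t) x) * ‖p.2 t x‖ₑ ^ 2 ∂(p.1 t : Measure M)

/-- The speed `(∫ m_{μ_t}(x) |v_t(x)|² dμ_t(x))^{1/2}`. -/
def speed (K : M → M → ℝ) (p : Pair n M) (t : ℝ) : ℝ≥0∞ :=
  energy K p t ^ (1 / 2 : ℝ)

/-- The action `∫₀¹ ∫ m_{μ_t}(x) |v_t(x)|² dμ_t(x) dt`. -/
def action (K : M → M → ℝ) (p : Pair n M) : ℝ≥0∞ :=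
  ∫⁻ t in Ioo (0 : ℝ) 1, energy K p t

/-- The length `∫₀ᵀ (∫ m_{μ_t}(x) |v_t(x)|² dμ_t(x))^{1/2} dt`. -/
def length (K : M → M → ℝ) (T : ℝ) (p : Pair n M) : ℝ≥0∞ :=
  ∫⁻ t in Ioo (0 : ℝ) T, speed K p t

/-- The transport distance `W_{m,2}`; it is `∞` if no admissible pair has finite action. -/
def W (n : ℕ) {M : Type*} [TopologicalSpace M] [ChartedSpace (EuclideanSpace ℝ (Fin n)) M]
    [MeasurableSpace M] [OpensMeasurableSpace M] [IsManifold (𝓡 n) 1 M]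
    [RiemannianBundle (fun x : M ↦ TangentSpace (𝓡 n) x)]
    (K : M → M → ℝ) (ν η : ProbabilityMeasure M) : ℝ≥0∞ :=
  (sInf (action K '' CE n 1 ν η)) ^ (1 / 2 : ℝ)

/-- The infimum of the length over `CE(0,T; ν → η)`. -/
def lengthInf (n : ℕ) {M : Type*} [TopologicalSpace M] [ChartedSpace (EuclideanSpace ℝ (Fin n)) M]
    [MeasurableSpace M] [OpensMeasurableSpace M] [IsManifold (𝓡 n) 1 M]
    [RiemannianBundle (fun x : M ↦ TangentSpace (𝓡 n) x)]
    (K : M → M → ℝ) (T : ℝ) (ν η : ProbabilityMeasure M) : ℝ≥0∞ :=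
  sInf (length K T '' CE n T ν η)

end

end NonlocalTransport

end

set_option linter.unusedSectionVars false

noncomputable section

namespace NonlocalTransport

open ProbabilityTheory Filter Function
open scoped NNReal

section Narrow

variable {X : Type*} [TopologicalSpace X] [CompactSpace X] [MeasurableSpace X] [BorelSpace X]

/-- Integration of continuous functions is jointly continuous in the function and the measure. -/
theorem continuous_integral_pairing :
    Continuous fun q : C(X, ℝ) × ProbabilityMeasure X ↦ ∫ x, q.1 x ∂(q.2 : Measure X) := by
  rw [continuous_iff_continuousAt]
  rintro ⟨f, μ⟩
  have h1 : Tendsto (fun q : C(X, ℝ) × ProbabilityMeasure X ↦ ∫ x, f x ∂(q.2 : Measure X))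
      (𝓝 (f, μ)) (𝓝 (∫ x, f x ∂(μ : Measure X))) :=
    ((ProbabilityMeasure.continuous_integral_continuousMap f).comp continuous_snd).tendsto (f, μ)
  have h2 : Tendsto (fun q : C(X, ℝ) × ProbabilityMeasure X ↦ ∫ x, (q.1 - f) x ∂(q.2 : Measure X))
      (𝓝 (f, μ)) (𝓝 0) := by
    have h3 : Tendsto (fun q : C(X, ℝ) × ProbabilityMeasure X ↦ ‖q.1 - f‖) (𝓝 (f, μ)) (𝓝 0) := by
      have : Continuous (fun q : C(X, ℝ) × ProbabilityMeasure X ↦ ‖q.1 - f‖) := by fun_prop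
      simpa using this.tendsto (f, μ)
    refine squeeze_zero_norm (fun q ↦ ?_) h3
    refine (norm_integral_le_of_norm_le_const
      (Eventually.of_forall fun x ↦ (q.1 - f).norm_coe_le_norm x)).trans (by simp)
  have h4 := h1.add h2
  rw [add_zero] at h4
  refine h4.congr fun q ↦ ?_
  rw [← integral_add]
  · simp
  · exact f.continuous.integrable_of_hasCompactSupport (HasCompactSupport.of_compactSpace _)
  · exact (q.1 - f).continuous.integrable_of_hasCompactSupport (HasCompactSupport.of_compactSpace _)

/-- If `F` is jointly continuous then `(a, μ) ↦ ∫ F (a, x) dμ(x)` is continuous. -/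
theorem Continuous.integral_probabilityMeasure {A : Type*} [TopologicalSpace A] {F : A → X → ℝ}
    (hF : Continuous (uncurry F)) {μ : A → ProbabilityMeasure X} (hμ : Continuous μ) :
    Continuous fun a ↦ ∫ x, F a x ∂(μ a : Measure X) := by
  let F' : C(A × X, ℝ) := ⟨uncurry F, hF⟩
  exact continuous_integral_pairing.comp (F'.curry.continuous.prodMk hμ)

theorem continuous_mobility {K : X → X → ℝ} (hK : Continuous (uncurry K)) :
    Continuous fun q : ProbabilityMeasure X × X ↦ mobility K q.1 q.2 := by
  refine Continuous.integral_probabilityMeasure (F := fun q : ProbabilityMeasure X × X ↦ K q.2) ?_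
    continuous_fst
  exact hK.comp (by fun_prop : Continuous fun z : (ProbabilityMeasure X × X) × X ↦ (z.1.2, z.2))

theorem le_mobility {K : X → X → ℝ} (hK : Continuous (uncurry K)) {C : ℝ}
    (hC : ∀ x y, C ≤ K x y) (μ : ProbabilityMeasure X) (x : X) : C ≤ mobility K μ x := by
  have h : Continuous (K x) := hK.comp (by fun_prop : Continuous fun y : X ↦ (x, y))
  calc C = ∫ _, C ∂(μ : Measure X) := by simp
    _ ≤ _ := integral_mono (by simp) (h.integrable_of_hasCompactSupport
      (HasCompactSupport.of_compactSpace _)) (hC x)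

variable [TopologicalSpace.MetrizableSpace X]

/-- A narrowly continuous curve of probability measures is a Markov kernel. -/
theorem measurable_toMeasure_of_continuous {A : Type*} [TopologicalSpace A] [MeasurableSpace A]
    [OpensMeasurableSpace A] {μ : A → ProbabilityMeasure X} (hμ : Continuous μ) :
    Measurable fun a ↦ (μ a : Measure X) := by
  refine Measurable.measure_of_isPiSystem_of_isProbabilityMeasure
    (borel_eq_generateFrom_isClosed (α := X) ▸ BorelSpace.measurable_eq) isPiSystem_isClosed
    fun F hF ↦ ?_
  refine measurable_of_tendsto_metrizable
    (f := fun k a ↦ ∫⁻ x, (hF.apprSeq k x : ℝ≥0∞) ∂(μ a : Measure X)) (fun k ↦ ?_) ?_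
  · have h : Continuous fun a ↦ (μ a).toFiniteMeasure.testAgainstNN (hF.apprSeq k) :=
      (FiniteMeasure.continuous_testAgainstNN_eval _).comp
        ((ProbabilityMeasure.toFiniteMeasure_continuous).comp hμ)
    have h' := (ENNReal.continuous_coe.comp h).measurable
    simpa [Function.comp_def, FiniteMeasure.testAgainstNN_coe_eq] using h'
  · rw [tendsto_pi_nhds]
    intro a
    exact HasOuterApproxClosed.tendsto_lintegral_apprSeq hF (μ a : Measure X)

/-- The kernel `t ↦ μ t` of a narrowly continuous curve. -/
def curveKernel (μ : ℝ → ProbabilityMeasure X) (hμ : Continuous μ) : Kernel ℝ X :=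
  ⟨fun t ↦ (μ t : Measure X), measurable_toMeasure_of_continuous hμ⟩

instance (μ : ℝ → ProbabilityMeasure X) (hμ : Continuous μ) :
    IsMarkovKernel (curveKernel μ hμ) :=
  ⟨fun t ↦ inferInstanceAs (IsProbabilityMeasure (μ t : Measure X))⟩

/-- The space-time measure `dt ⊗ μ_t`. -/
def spaceTime (μ : ℝ → ProbabilityMeasure X) (hμ : Continuous μ) : Measure (ℝ × X) :=
  volume.compProd (curveKernel μ hμ)

theorem lintegral_spaceTime {μ : ℝ → ProbabilityMeasure X} (hμ : Continuous μ)
    {f : ℝ × X → ℝ≥0∞} (hf : Measurable f) :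
    ∫⁻ z, f z ∂spaceTime μ hμ = ∫⁻ t, ∫⁻ x, f (t, x) ∂(μ t : Measure X) := by
  rw [spaceTime, Measure.lintegral_compProd hf]; rfl

theorem measurable_lintegral_curve {μ : ℝ → ProbabilityMeasure X} (hμ : Continuous μ)
    {f : ℝ → X → ℝ≥0∞} (hf : Measurable (uncurry f)) :
    Measurable fun t ↦ ∫⁻ x, f t x ∂(μ t : Measure X) :=
  Measurable.lintegral_kernel_prod_right (κ := curveKernel μ hμ) hf

theorem measurable_integral_curve {μ : ℝ → ProbabilityMeasure X} (hμ : Continuous μ)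
    {f : ℝ → X → ℝ} (hf : Measurable (uncurry f)) :
    Measurable fun t ↦ ∫ x, f t x ∂(μ t : Measure X) :=
  (StronglyMeasurable.integral_kernel_prod_right (κ := curveKernel μ hμ)
    hf.stronglyMeasurable).measurable

theorem integral_spaceTime {μ : ℝ → ProbabilityMeasure X} (hμ : Continuous μ)
    {f : ℝ × X → ℝ} (hf : Integrable f (spaceTime μ hμ)) :
    ∫ z, f z ∂spaceTime μ hμ = ∫ t, ∫ x, f (t, x) ∂(μ t : Measure X) := by
  rw [spaceTime, Measure.integral_compProd hf]; rfl

theorem integrable_integral_curve {μ : ℝ → ProbabilityMeasure X} (hμ : Continuous μ)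
    {f : ℝ × X → ℝ} (hf : Integrable f (spaceTime μ hμ)) :
    Integrable fun t ↦ ∫ x, f (t, x) ∂(μ t : Measure X) :=
  ((Measure.integrable_compProd_iff hf.1).1 hf).2.mono'
    (hf.1.integral_kernel_compProd)
    (Eventually.of_forall fun _ ↦ norm_integral_le_integral_norm _)

end Narrow

section Flow

variable {ι X E : Type*} [TopologicalSpace X]
  [NormedAddCommGroup E] [InnerProductSpace ℝ E] [MeasurableSpace E]

/-- A dense family of continuous functions together with measurable gradients (in a fixed
orthonormal frame) whose mutual inner products are continuous. -/
structure GradientFamily (ι X E : Type*) [TopologicalSpace X] [MeasurableSpace X]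
    [NormedAddCommGroup E] [InnerProductSpace ℝ E] [MeasurableSpace E] where
  /-- The functions of the family. -/
  toFun : ι → C(X, ℝ)
  /-- Their gradients. -/
  grad : ι → X → E
  measurable_grad : ∀ i, Measurable (grad i)
  continuous_inner : ∀ i j, Continuous fun x ↦ inner ℝ (grad i x) (grad j x)
  denseRange : DenseRange toFun

variable [MeasurableSpace X]

/-- The rate of change `∫ ⟨∇ f_i, c_t⟩ dμ_t` of `∫ f_i dμ_t`. -/
def flux (G : GradientFamily ι X E) (μ : ℝ → ProbabilityMeasure X) (c : ℝ → X → E) (i : ι)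
    (t : ℝ) : ℝ :=
  ∫ x, inner ℝ (G.grad i x) (c t x) ∂(μ t : Measure X)

variable [CompactSpace X] [BorelSpace X]

/-- A curve of measures, defined for all times, that is transported by the velocity `c`. -/
structure IsFlow (G : GradientFamily ι X E) (μ : ℝ → ProbabilityMeasure X) (c : ℝ → X → E) :
    Prop where
  continuous : Continuous μ
  measurable : Measurable (uncurry c)
  lintegral_lt_top : ∫⁻ t, ∫⁻ x, ‖c t x‖ₑ ∂(μ t : Measure X) < ⊤
  balance : ∀ i s t, s ≤ t → ∫ x, G.toFun i x ∂(μ t : Measure X) -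
    ∫ x, G.toFun i x ∂(μ s : Measure X) = ∫ r in s..t, flux G μ c i r

theorem GradientFamily.exists_norm_grad_le (G : GradientFamily ι X E) (i : ι) :
    ∃ B : ℝ, 0 < B ∧ ∀ x, ‖G.grad i x‖ ≤ B := by
  obtain ⟨B, hB⟩ := (isCompact_range (G.continuous_inner i i)).bddAbove
  refine ⟨|B| + 1, by positivity, fun x ↦ ?_⟩
  have h := hB ⟨x, rfl⟩
  simp only [real_inner_self_eq_norm_sq] at h
  nlinarith [le_abs_self B, norm_nonneg (G.grad i x), abs_nonneg B]

variable [TopologicalSpace.MetrizableSpace X] [FiniteDimensional ℝ E] [BorelSpace E]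
  {G : GradientFamily ι X E} {μ : ℝ → ProbabilityMeasure X} {c : ℝ → X → E}

theorem GradientFamily.measurable_inner (G : GradientFamily ι X E) (hc : Measurable (uncurry c))
    (i : ι) : Measurable (uncurry fun t x ↦ inner ℝ (G.grad i x) (c t x)) := by
  exact ((G.measurable_grad i).comp measurable_snd).inner hc

theorem integrable_inner_spaceTime (hμ : Continuous μ) (hc : Measurable (uncurry c))
    (hL : ∫⁻ t, ∫⁻ x, ‖c t x‖ₑ ∂(μ t : Measure X) < ⊤) (i : ι) :
    Integrable (fun z : ℝ × X ↦ inner ℝ (G.grad i z.2) (c z.1 z.2)) (spaceTime μ hμ) := by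
  obtain ⟨B, hB0, hB⟩ := G.exists_norm_grad_le i
  have h1 : Integrable (fun z : ℝ × X ↦ ‖c z.1 z.2‖) (spaceTime μ hμ) := by
    refine ⟨hc.norm.aestronglyMeasurable, ?_⟩
    rw [hasFiniteIntegral_iff_enorm,
      lintegral_spaceTime (f := fun z ↦ ‖‖c z.1 z.2‖‖ₑ) hμ hc.norm.enorm]
    simpa using hL
  refine (h1.const_mul B).mono' (G.measurable_inner hc i).aestronglyMeasurable
    (Eventually.of_forall fun z ↦ (norm_inner_le_norm _ _).trans ?_)
  gcongr
  exact hB _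

theorem IsFlow.integrable_flux (h : IsFlow G μ c) (i : ι) : Integrable (flux G μ c i) :=
  integrable_integral_curve h.continuous
    (integrable_inner_spaceTime h.continuous h.measurable h.lintegral_lt_top i)

/-- Two measures agree if they agree on a dense family. -/
theorem GradientFamily.ext_of_integral (G : GradientFamily ι X E) {μ ν : ProbabilityMeasure X}
    (h : ∀ i, ∫ x, G.toFun i x ∂(μ : Measure X) = ∫ x, G.toFun i x ∂(ν : Measure X)) : μ = ν := by
  have h1 : ∀ f : C(X, ℝ), ∫ x, f x ∂(μ : Measure X) = ∫ x, f x ∂(ν : Measure X) := by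
    intro f
    have hc (ρ : ProbabilityMeasure X) : Continuous fun f : C(X, ℝ) ↦ ∫ x, f x ∂(ρ : Measure X) :=
      continuous_integral_pairing.comp (continuous_id.prodMk (continuous_const (y := ρ)))
    have := G.denseRange.equalizer (hc μ) (hc ν) (funext h)
    exact congrFun this f
  apply Subtype.ext
  have := μ.2
  have := ν.2
  exact ext_of_forall_integral_eq_of_IsFiniteMeasure (μ := (μ : Measure X)) fun f ↦ h1 f.toContinuousMap

/-- Narrow convergence can be tested on a dense family. -/
theorem GradientFamily.tendsto_of_integral (G : GradientFamily ι X E) {α : Type*} {l : Filter α}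
    {μ : α → ProbabilityMeasure X} {ν : ProbabilityMeasure X}
    (h : ∀ i, Tendsto (fun a ↦ ∫ x, G.toFun i x ∂(μ a : Measure X)) l
      (𝓝 (∫ x, G.toFun i x ∂(ν : Measure X)))) : Tendsto μ l (𝓝 ν) := by
  rcases l.eq_or_neBot with rfl | hl
  · exact tendsto_bot
  refine tendsto_iff_ultrafilter _ _ _ |>.2 fun g hg ↦ ?_
  obtain ⟨ρ, -, hρ⟩ := isCompact_univ.ultrafilter_le_nhds (g.map μ) (by simp)
  have : ρ = ν := G.ext_of_integral fun i ↦ tendsto_nhds_unique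
    (((ProbabilityMeasure.continuous_integral_continuousMap (G.toFun i)).tendsto ρ).comp hρ)
    ((h i).mono_left hg)
  exact this ▸ hρ

/-- The energy `∫ m_{μ_t} |c_t|² dμ_t`. -/
def flowEnergy (K : X → X → ℝ) (μ : ℝ → ProbabilityMeasure X) (c : ℝ → X → E) (t : ℝ) : ℝ≥0∞ :=
  ∫⁻ x, ENNReal.ofReal (mobility K (μ t) x) * ‖c t x‖ₑ ^ 2 ∂(μ t : Measure X)

theorem measurable_energy_density {K : X → X → ℝ} (hK : Continuous (uncurry K))
    (hμ : Continuous μ) (hc : Measurable (uncurry c)) :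
    Measurable fun z : ℝ × X ↦ ENNReal.ofReal (mobility K (μ z.1) z.2) * ‖c z.1 z.2‖ₑ ^ 2 := by
  refine Measurable.mul ?_ (hc.enorm.pow_const 2)
  have h : Continuous fun z : ℝ × X ↦ mobility K (μ z.1) z.2 :=
    (continuous_mobility hK).comp
      ((hμ.comp continuous_fst).prodMk continuous_snd)
  exact h.measurable.ennreal_ofReal

theorem measurable_flowEnergy {K : X → X → ℝ} (hK : Continuous (uncurry K))
    (hμ : Continuous μ) (hc : Measurable (uncurry c)) : Measurable (flowEnergy K μ c) :=
  measurable_lintegral_curve hμ (measurable_energy_density hK hμ hc)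

end Flow

section TimeChange

/-- `S` is the primitive of the density `w`, supported in `(0, T)` and of total mass `T'`, and `σ`
is a monotone right inverse of `S`. -/
structure IsTimeChange (w : ℝ → ℝ≥0) (T T' : ℝ) (S σ : ℝ → ℝ) : Prop where
  continuous : Continuous S
  monotone : Monotone S
  map_zero : S 0 = 0
  map_end : S T = T'
  mem_Icc : ∀ t, S t ∈ Icc 0 T'
  monotone_inv : Monotone σ
  inv_mem_Icc : ∀ u, σ u ∈ Icc 0 T
  apply_inv : ∀ u, S (σ u) = max 0 (min u T')
  inv_clamp : ∀ u, σ (max 0 (min u T')) = σ u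
  ae_eq_zero : ∀ s t, s ≤ t → S s = S t → ∀ᵐ r, r ∈ Ioc s t → w r = 0
  map_eq : (volume.withDensity fun t ↦ (w t : ℝ≥0∞)).map S = volume.restrict (Ioo 0 T')
  ae_inv_apply : ∀ᵐ t ∂volume.withDensity fun t ↦ (w t : ℝ≥0∞),
    σ (S t) = t ∧ S t ∈ Ioo 0 T' ∧ w t ≠ 0

theorem exists_isTimeChange {w : ℝ → ℝ≥0} (hw : Measurable w) {T T' : ℝ} (hT : 0 < T)
    (hT' : 0 < T') (hsupp : ∀ t ∉ Ioo 0 T, w t = 0)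
    (hint : ∫⁻ t, (w t : ℝ≥0∞) = ENNReal.ofReal T') :
    ∃ S σ : ℝ → ℝ, IsTimeChange w T T' S σ := by
  have hwi : Integrable fun t ↦ (w t : ℝ) := by
    refine ⟨hw.coe_nnreal_real.aestronglyMeasurable, ?_⟩
    rw [hasFiniteIntegral_iff_enorm]
    simp [hint]
  have hii : ∀ a b : ℝ, IntervalIntegrable (fun t ↦ (w t : ℝ)) volume a b :=
    fun a b ↦ hwi.intervalIntegrable
  set m : Measure ℝ := volume.withDensity fun t ↦ (w t : ℝ≥0∞) with hm
  have hm_univ : m univ = ENNReal.ofReal T' := by simp [hm, hint]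
  have : IsFiniteMeasure m := ⟨by simp [hm_univ]⟩
  set S : ℝ → ℝ := fun t ↦ ∫ r in (0 : ℝ)..t, (w r : ℝ) with hS
  have hSc : Continuous S := intervalIntegral.continuous_primitive hii 0
  have hSsub : ∀ s t, S t - S s = ∫ r in s..t, (w r : ℝ) := fun s t ↦
    intervalIntegral.integral_interval_sub_left (hii 0 t) (hii 0 s)
  have hSm : Monotone S := fun s t hst ↦ by
    have := hSsub s t
    have h2 : 0 ≤ ∫ r in s..t, (w r : ℝ) :=
      intervalIntegral.integral_nonneg hst fun r _ ↦ (w r).2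
    linarith
  have hS0 : S 0 = 0 := by simp [hS]
  have hmIoc : ∀ s t, s ≤ t → m (Ioc s t) = ENNReal.ofReal (S t - S s) := fun s t hst ↦ by
    rw [hSsub, intervalIntegral.integral_of_le hst, ofReal_integral_eq_lintegral_ofReal
      hwi.integrableOn (Eventually.of_forall fun r ↦ (w r).2), hm,
      withDensity_apply _ measurableSet_Ioc]
    simp
  have hmout : m (Ioo 0 T)ᶜ = 0 := by
    rw [hm, withDensity_apply _ measurableSet_Ioo.compl,
      setLIntegral_congr_fun (g := fun _ ↦ 0) measurableSet_Ioo.compl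
        (fun t ht ↦ by simp [hsupp t ht])]
    simp
  have hmIic : ∀ t, 0 ≤ t → m (Iic t) = ENNReal.ofReal (S t) := fun t ht ↦ by
    have := hmIoc 0 t ht
    rw [hS0, sub_zero] at this
    rw [← this, ← Iic_union_Ioc_eq_Iic ht]
    refine le_antisymm ((measure_union_le _ _).trans ?_) (measure_mono subset_union_right)
    rw [measure_mono_null _ hmout, zero_add]
    intro r hr
    simp only [mem_Iic] at hr
    simp only [mem_compl_iff, mem_Ioo, not_and_or]
    exact Or.inl (not_lt.2 hr)
  have hST : S T = T' := by
    have h1 := hmIic T hT.le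
    have h2 : m (Iic T) = m univ := by
      refine le_antisymm (measure_mono (subset_univ _)) ?_
      rw [← union_compl_self (Iic T)]
      have h0 : m (Iic T)ᶜ = 0 := by
        refine measure_mono_null (fun r hr ↦ ?_) hmout
        simp only [mem_compl_iff, mem_Iic, not_le] at hr
        simp only [mem_compl_iff, mem_Ioo, not_and_or]
        exact Or.inr (not_lt.2 hr.le)
      calc _ ≤ m (Iic T) + m (Iic T)ᶜ := measure_union_le _ _
        _ = m (Iic T) := by rw [h0, add_zero]
    rw [h2, hm_univ] at h1
    exact ((ENNReal.ofReal_eq_ofReal_iff hT'.le (hS0 ▸ hSm hT.le)).1 h1).symm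
  have hSzero : ∀ t ≤ 0, S t = 0 := fun t ht ↦ by
    have : S 0 - S t = 0 := by
      rw [hSsub, intervalIntegral.integral_of_le ht, setIntegral_eq_zero_of_forall_eq_zero]
      intro r hr
      simp [hsupp r fun h ↦ absurd h.1 (not_lt.2 hr.2)]
    linarith
  have hSend : ∀ t, T ≤ t → S t = T' := fun t ht ↦ by
    have : S t - S T = 0 := by
      rw [hSsub, intervalIntegral.integral_of_le ht, setIntegral_eq_zero_of_forall_eq_zero]
      intro r hr
      simp [hsupp r fun h ↦ absurd h.2 (not_lt.2 hr.1.le)]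
    linarith
  have hSI : ∀ t, S t ∈ Icc 0 T' := fun t ↦ by
    constructor
    · rcases le_total t 0 with h | h
      · exact (hSzero t h).ge
      · exact hS0 ▸ hSm h
    · rcases le_total t T with h | h
      · exact hST ▸ hSm h
      · exact (hSend t h).le
  have hivt : ∀ a ∈ Icc 0 T', ∃ t ∈ Icc 0 T, S t = a := fun a ha ↦ by
    have := intermediate_value_Icc hT.le hSc.continuousOn
    rw [hS0, hST] at this
    exact this ha
  have hmap : m.map S = volume.restrict (Ioo 0 T') := by
    have : IsFiniteMeasure (m.map S) := Measure.isFiniteMeasure_map m S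
    refine Measure.ext_of_Iic _ _ fun a ↦ ?_
    rw [Measure.map_apply hSc.measurable measurableSet_Iic,
      Measure.restrict_apply measurableSet_Iic]
    rcases lt_or_ge a 0 with ha | ha
    · rw [show S ⁻¹' Iic a = ∅ from eq_empty_of_forall_notMem fun t ht ↦
        absurd ((hSI t).1.trans ht) (not_le.2 ha),
        show Iic a ∩ Ioo 0 T' = ∅ from eq_empty_of_forall_notMem fun t ht ↦
        absurd (ht.2.1.le.trans ht.1) (not_le.2 ha)]
      simp
    rcases le_or_gt T' a with ha' | ha'
    · rw [show S ⁻¹' Iic a = univ from eq_univ_of_forall fun t ↦ (hSI t).2.trans ha', hm_univ,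
        show Iic a ∩ Ioo 0 T' = Ioo 0 T' from inter_eq_right.2 fun t ht ↦ ht.2.le.trans ha']
      simp
    · obtain ⟨t0, ht0, ht0a⟩ := hivt a ⟨ha, ha'.le⟩
      have hcomp : IsCompact (Icc 0 T ∩ S ⁻¹' Iic a) :=
        isCompact_Icc.inter_right (isClosed_Iic.preimage hSc)
      obtain ⟨t1, ht1, hmax⟩ := hcomp.exists_isGreatest ⟨t0, ht0, ht0a.le⟩
      have ht1a : S t1 = a := le_antisymm ht1.2 (ht0a ▸ hSm (hmax ⟨ht0, ht0a.le⟩))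
      have hpre : S ⁻¹' Iic a = Iic t1 := by
        ext t
        constructor
        · intro ht
          by_contra hlt
          rw [mem_Iic, not_le] at hlt
          rcases le_or_gt t T with htT | htT
          · exact absurd (hmax ⟨⟨ht1.1.1.trans hlt.le, htT⟩, ht⟩) (not_le.2 hlt)
          · have : S t ≤ a := ht
            rw [hSend t htT.le] at this
            linarith
        · intro ht
          exact (hSm ht).trans ht1a.le
      rw [hpre, hmIic t1 ht1.1.1, ht1a, show Iic a ∩ Ioo 0 T' = Ioc 0 a from by
        ext t; simp only [mem_inter_iff, mem_Iic, mem_Ioo, mem_Ioc]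
        exact ⟨fun h ↦ ⟨h.2.1, h.1⟩, fun h ↦ ⟨h.2, h.1, h.2.trans_lt ha'⟩⟩]
      simp
  have hnull : ∀ a, ∀ᵐ t ∂m, S t ≠ a := fun a ↦ by
    refine (measure_eq_zero_iff_ae_notMem (s := S ⁻¹' {a})).1 ?_
    rw [← Measure.map_apply hSc.measurable (measurableSet_singleton a), hmap]
    exact measure_mono_null (fun _ h ↦ h) (by simp)
  let P : ℝ → ℝ := fun u ↦ max 0 (min u T')
  have hPI : ∀ u, P u ∈ Icc 0 T' := fun u ↦
    ⟨le_max_left _ _, max_le hT'.le (min_le_right _ _)⟩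
  have hPm : Monotone P := fun u v huv ↦ max_le_max le_rfl (min_le_min huv le_rfl)
  have hPid : ∀ u ∈ Icc 0 T', P u = u := fun u hu ↦ by
    simp [P, hu.1, hu.2]
  have hex : ∀ u, ∃ t, IsLeast (Icc 0 T ∩ S ⁻¹' Ici (P u)) t := fun u ↦
    (isCompact_Icc.inter_right (isClosed_Ici.preimage hSc)).exists_isLeast
      ⟨T, ⟨hT.le, le_rfl⟩, by simpa [hST] using (hPI u).2⟩
  choose σ hσ using hex
  have hSσ : ∀ u, S (σ u) = P u := fun u ↦ by
    obtain ⟨t0, ht0, ht0a⟩ := hivt _ (hPI u)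
    exact le_antisymm (ht0a ▸ hSm ((hσ u).2 ⟨ht0, ht0a.ge⟩)) (hσ u).1.2
  refine ⟨S, σ, hSc, hSm, hS0, hST, hSI, fun u v huv ↦ ?_, fun u ↦ (hσ u).1.1, hSσ, fun u ↦ ?_,
    fun s t hst h ↦ ?_, hmap, ?_⟩
  · exact (hσ u).2 ⟨(hσ v).1.1, (hPm huv).trans (hσ v).1.2⟩
  · refine IsLeast.unique (hσ (P u)) ?_
    rw [hPid _ (hPI u)]
    exact hσ u
  · have h0 : m (Ioc s t) = 0 := by rw [hmIoc s t hst, h]; simp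
    have h0' : ∀ᵐ r ∂m, r ∉ Ioc s t := measure_eq_zero_iff_ae_notMem.1 h0
    rw [hm, ae_withDensity_iff hw.coe_nnreal_ennreal] at h0'
    filter_upwards [h0'] with r hr hrI
    by_contra hne
    exact hr (by simpa using hne) hrI
  · have h1 : ∀ᵐ t ∂m, ∀ q : ℚ, S t ≠ S q := by
      rw [ae_all_iff]
      exact fun q ↦ hnull (S q)
    have h4 : ∀ᵐ t ∂m, w t ≠ 0 := by
      rw [hm, ae_withDensity_iff hw.coe_nnreal_ennreal]
      exact Eventually.of_forall fun t ht ↦ by simpa using ht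
    filter_upwards [h1, hnull 0, hnull T', h4] with t h1 h2 h3 h4
    have htI : t ∈ Ioo 0 T := by
      by_contra h
      exact h4 (hsupp t h)
    refine ⟨?_, ⟨(hSI t).1.lt_of_ne' h2, (hSI t).2.lt_of_ne h3⟩, h4⟩
    have hle : σ (S t) ≤ t := (hσ (S t)).2 ⟨⟨htI.1.le, htI.2.le⟩, (hPid _ (hSI t)).le⟩
    by_contra hne
    obtain ⟨q, hq1, hq2⟩ := exists_rat_btwn (lt_of_le_of_ne hle hne)
    refine h1 q (le_antisymm ?_ (hSm hq2.le))
    calc S t = S (σ (S t)) := by rw [hSσ, hPid _ (hSI t)]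
      _ ≤ S q := hSm hq1.le

end TimeChange

section TimeChange

theorem IsTimeChange.continuous_of_comp {Y : Type*} [TopologicalSpace Y] {w : ℝ → ℝ≥0} {T T' : ℝ}
    {S σ : ℝ → ℝ} (h : IsTimeChange w T T' S σ) (hT' : 0 < T') {μ : ℝ → Y}
    (hμ : Continuous μ) (hS : ∀ t, μ (σ (S t)) = μ t) : Continuous fun u ↦ μ (σ u) := by
  let S' : Icc 0 T → Icc 0 T' := fun t ↦ ⟨S t, h.mem_Icc t⟩
  have hS'c : Continuous S' := (h.continuous.comp continuous_subtype_val).subtype_mk _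
  have hS's : Surjective S' := fun u ↦ ⟨⟨σ u, h.inv_mem_Icc u⟩, Subtype.ext (by
    simp [S', h.apply_inv, u.2.1, u.2.2])⟩
  have hq : Topology.IsQuotientMap S' := hS'c.isClosedMap.isQuotientMap hS'c hS's
  have h1 : Continuous fun u : Icc 0 T' ↦ μ (σ u) := by
    rw [hq.continuous_iff]
    refine (hμ.comp continuous_subtype_val).congr fun t ↦ ?_
    simp [S', hS]
  have h2 := h1.comp (continuous_projIcc (h := hT'.le))
  refine h2.congr fun u ↦ ?_
  simp only [comp_apply, coe_projIcc]
  rw [min_comm, h.inv_clamp]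

/-- Change of variables for integrands supported in `(0, T')`. -/
theorem IsTimeChange.lintegral_eq {w : ℝ → ℝ≥0} {T T' : ℝ} {S σ : ℝ → ℝ} (hw : Measurable w)
    (h : IsTimeChange w T T' S σ) {g : ℝ → ℝ≥0∞} (hg : Measurable g)
    (h0 : ∀ u ∉ Ioo 0 T', g u = 0) : ∫⁻ u, g u = ∫⁻ t, w t * g (S t) := by
  rw [← setLIntegral_eq_of_support_subset (s := Ioo 0 T'), ← h.map_eq,
    lintegral_map hg h.continuous.measurable,
    lintegral_withDensity_eq_lintegral_mul (g := fun t ↦ g (S t)) _ hw.coe_nnreal_ennreal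
      (hg.comp h.continuous.measurable)]
  · rfl
  · intro u hu
    by_contra hne
    exact hu (h0 u hne)

theorem IsTimeChange.integral_eq {w : ℝ → ℝ≥0} {T T' : ℝ} {S σ : ℝ → ℝ} (hw : Measurable w)
    (h : IsTimeChange w T T' S σ) {g : ℝ → ℝ} (hg : Measurable g)
    (h0 : ∀ u ∉ Ioo 0 T', g u = 0) : ∫ u, g u = ∫ t, w t * g (S t) := by
  rw [← setIntegral_eq_integral_of_forall_compl_eq_zero (s := Ioo 0 T') h0, ← h.map_eq,
    integral_map h.continuous.aemeasurable hg.aestronglyMeasurable,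
    integral_withDensity_eq_integral_smul hw]
  rfl

end TimeChange

section Reparametrize

variable {ι X E : Type*} [TopologicalSpace X] [CompactSpace X] [MeasurableSpace X] [BorelSpace X]
  [TopologicalSpace.MetrizableSpace X]
  [NormedAddCommGroup E] [InnerProductSpace ℝ E] [FiniteDimensional ℝ E] [MeasurableSpace E]
  [BorelSpace E] {G : GradientFamily ι X E} {μ : ℝ → ProbabilityMeasure X} {c : ℝ → X → E}

theorem enorm_coe_nnreal (r : ℝ≥0) : ‖(r : ℝ)‖ₑ = r := by
  rw [Real.enorm_of_nonneg r.coe_nonneg, ENNReal.ofReal_coe_nnreal]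

theorem IsFlow.measurable_apply (h : IsFlow G μ c) (t : ℝ) : Measurable (c t) :=
  h.measurable.comp measurable_prodMk_left

theorem flux_eq_zero {i : ι} {t : ℝ} (h : ∀ᵐ x ∂(μ t : Measure X), c t x = 0) :
    flux G μ c i t = 0 := by
  refine integral_eq_zero_of_ae ?_
  filter_upwards [h] with x hx
  simp [hx]

theorem IsFlow.eq_of_ae_eq_zero (h : IsFlow G μ c) {s t : ℝ} (hst : s ≤ t)
    (h0 : ∀ᵐ r, r ∈ Ioc s t → ∀ᵐ x ∂(μ r : Measure X), c r x = 0) : μ s = μ t := by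
  refine G.ext_of_integral fun i ↦ ?_
  have h1 := h.balance i s t hst
  have h2 : ∫ r in s..t, flux G μ c i r = 0 := by
    refine intervalIntegral.integral_zero_ae ?_
    filter_upwards [h0] with r hr hrI
    rw [uIoc_of_le hst] at hrI
    exact flux_eq_zero (hr hrI)
  rw [h2] at h1
  linarith

/-- The reparametrization of the velocity `c` by the time change with density `w`. -/
def reparamVelocity (w : ℝ → ℝ≥0) (T' : ℝ) (σ : ℝ → ℝ) (c : ℝ → X → E) (u : ℝ) (x : X) : E :=
  (Ioo 0 T').indicator (fun u ↦ ((w (σ u))⁻¹ : ℝ≥0) • c (σ u) x) u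

theorem IsFlow.reparametrize {w : ℝ → ℝ≥0} {T T' : ℝ} {S σ : ℝ → ℝ} (h : IsFlow G μ c)
    (hw : Measurable w) (hT' : 0 < T') (hS : IsTimeChange w T T' S σ)
    (hwc : ∀ᵐ t, w t = 0 → ∀ᵐ x ∂(μ t : Measure X), c t x = 0) :
    IsFlow G (fun u ↦ μ (σ u)) (reparamVelocity w T' σ c) ∧
      (∀ t, μ (σ (S t)) = μ t) ∧
      ∀ K : X → X → ℝ, Continuous (uncurry K) → ∀ Φ : ℝ≥0∞ → ℝ≥0∞, Measurable Φ → Φ 0 = 0 →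
        ∫⁻ u, Φ (flowEnergy K (fun u ↦ μ (σ u)) (reparamVelocity w T' σ c) u) =
          ∫⁻ t, w t * Φ (((w t)⁻¹ : ℝ≥0) ^ 2 * flowEnergy K μ c t) := by
  set c' := reparamVelocity w T' σ c with hc'
  have hμ : ∀ t, μ (σ (S t)) = μ t := by
    have key : ∀ s t, s ≤ t → S s = S t → μ s = μ t := fun s t hst hSst ↦ by
      refine h.eq_of_ae_eq_zero hst ?_
      filter_upwards [hwc, hS.ae_eq_zero s t hst hSst] with r h1 h2 hr using h1 (h2 hr)
    intro t
    have hSS : S (σ (S t)) = S t := by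
      rw [hS.apply_inv, min_eq_left (hS.mem_Icc t).2, max_eq_right (hS.mem_Icc t).1]
    rcases le_total (σ (S t)) t with hle | hle
    · exact key _ _ hle hSS
    · exact (key _ _ hle hSS.symm).symm
  have hcont : Continuous fun u ↦ μ (σ u) := hS.continuous_of_comp hT' h.continuous hμ
  have hσm : Measurable σ := hS.monotone_inv.measurable
  have hc'm : Measurable (uncurry c') := by
    have h1 : Measurable fun z : ℝ × X ↦ ((w (σ z.1))⁻¹ : ℝ≥0) • c (σ z.1) z.2 :=
      ((hw.comp (hσm.comp measurable_fst)).inv).smul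
        (h.measurable.comp ((hσm.comp measurable_fst).prodMk measurable_snd))
    exact h1.indicator (s := Prod.fst ⁻¹' Ioo 0 T') (measurable_fst measurableSet_Ioo)
  have hgood : ∀ᵐ t, w t ≠ 0 → σ (S t) = t ∧ S t ∈ Ioo 0 T' ∧
      ∀ x, c' (S t) x = ((w t)⁻¹ : ℝ≥0) • c t x := by
    have := hS.ae_inv_apply
    rw [ae_withDensity_iff hw.coe_nnreal_ennreal] at this
    filter_upwards [this] with t ht hwt
    obtain ⟨h1, h2, -⟩ := ht (by simpa using hwt)
    refine ⟨h1, h2, fun x ↦ ?_⟩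
    simp [hc', reparamVelocity, h2, h1]
  have hc'0 : ∀ u ∉ Ioo 0 T', ∀ x, c' u x = 0 := fun u hu x ↦ by
    simp only [hc', reparamVelocity]
    exact indicator_of_notMem hu _
  have hflux : ∀ i, ∀ᵐ t, w t * flux G (fun u ↦ μ (σ u)) c' i (S t) = flux G μ c i t := by
    intro i
    filter_upwards [hgood, hwc] with t h1 h2
    rcases eq_or_ne (w t) 0 with h0 | h0
    · rw [h0, flux_eq_zero (h2 h0)]; simp
    · simp only [flux, hμ, (h1 h0).2.2, NNReal.smul_def, inner_smul_right, integral_const_mul]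
      rw [← mul_assoc, NNReal.coe_inv, mul_inv_cancel₀ (by simpa using h0), one_mul]
  have hfluxm : ∀ i, Measurable (flux G (fun u ↦ μ (σ u)) c' i) := fun i ↦
    measurable_integral_curve hcont (G.measurable_inner hc'm i)
  refine ⟨⟨hcont, hc'm, ?_, fun i a b hab ↦ ?_⟩, hμ, fun K hK Φ hΦ hΦ0 ↦ ?_⟩
  · refine lt_of_le_of_lt ?_ h.lintegral_lt_top
    rw [hS.lintegral_eq hw (measurable_lintegral_curve (f := fun u x ↦ ‖c' u x‖ₑ) hcont
      hc'm.enorm) (fun u hu ↦ by simp [hc'0 u hu])]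
    refine lintegral_mono_ae ?_
    filter_upwards [hgood] with t h1
    rcases eq_or_ne (w t) 0 with h0 | h0
    · simp [h0]
    · simp only [hμ, (h1 h0).2.2, NNReal.smul_def, enorm_smul]
      rw [lintegral_const_mul _ (h.measurable_apply t).enorm, ← mul_assoc]
      rw [enorm_coe_nnreal, ← ENNReal.coe_mul, mul_inv_cancel₀ h0, ENNReal.coe_one, one_mul]
  · have hσab : σ a ≤ σ b := hS.monotone_inv hab
    rw [h.balance i _ _ hσab, intervalIntegral.integral_of_le hσab,
      intervalIntegral.integral_of_le hab, ← integral_indicator measurableSet_Ioc,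
      ← integral_indicator measurableSet_Ioc,
      hS.integral_eq hw ((hfluxm i).indicator measurableSet_Ioc) (fun u hu ↦ by
        simp only [indicator_apply_eq_zero]
        exact fun _ ↦ flux_eq_zero (Eventually.of_forall fun x ↦ hc'0 u hu x))]
    refine integral_congr_ae ?_
    filter_upwards [hflux i, hgood, hwc] with t h1 h2 h3
    rcases eq_or_ne (w t) 0 with h0 | h0
    · rw [h0]
      simp only [indicator_apply_eq_zero, NNReal.coe_zero, zero_mul]
      exact fun _ ↦ flux_eq_zero (h3 h0)
    obtain ⟨h4, h5, -⟩ := h2 h0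
    have hiff : S t ∈ Ioc a b ↔ t ∈ Ioc (σ a) (σ b) := by
      constructor
      · rintro ⟨h6, h7⟩
        refine ⟨lt_of_le_of_ne (h4 ▸ hS.monotone_inv h6.le) fun heq ↦ ?_,
          h4 ▸ hS.monotone_inv h7⟩
        have := hS.apply_inv a
        rw [heq] at this
        exact absurd this (ne_of_gt (max_lt h5.1 ((min_le_left _ _).trans_lt h6)))
      · rintro ⟨h6, h7⟩
        refine ⟨lt_of_not_ge fun h8 ↦ ?_, ?_⟩
        · exact absurd (h4 ▸ hS.monotone_inv h8) (not_le.2 h6)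
        · have := hS.monotone h7
          rw [hS.apply_inv] at this
          rcases le_max_iff.1 this with h8 | h8
          · exact absurd h5.1 (not_lt.2 h8)
          · exact h8.trans (min_le_left _ _)
    by_cases hm : t ∈ Ioc (σ a) (σ b)
    · rw [indicator_of_mem hm, indicator_of_mem (hiff.2 hm), h1]
    · rw [indicator_of_notMem hm, indicator_of_notMem (mt hiff.1 hm), mul_zero]
  · rw [hS.lintegral_eq (g := fun u ↦ Φ (flowEnergy K (fun u ↦ μ (σ u)) c' u)) hw
      (hΦ.comp (measurable_flowEnergy hK hcont hc'm))
      (fun u hu ↦ by simp [flowEnergy, hc'0 u hu, hΦ0])]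
    refine lintegral_congr_ae ?_
    filter_upwards [hgood] with t h1
    rcases eq_or_ne (w t) 0 with h0 | h0
    · simp [h0]
    · simp only [flowEnergy, hμ, (h1 h0).2.2, NNReal.smul_def, enorm_smul, mul_pow,
        enorm_coe_nnreal]
      congr 2
      rw [← lintegral_const_mul]
      · exact lintegral_congr fun x ↦ by ring
      · exact (measurable_energy_density hK h.continuous h.measurable).comp measurable_prodMk_left

end Reparametrize

section Jensen

variable {Ω : Type*} [MeasurableSpace Ω]

theorem rpow_half_sq (a : ℝ≥0∞) : (a ^ (1 / 2 : ℝ)) ^ 2 = a := by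
  rw [← ENNReal.rpow_natCast, ← ENNReal.rpow_mul]; norm_num

theorem sq_rpow_half (a : ℝ≥0∞) : (a ^ 2) ^ (1 / 2 : ℝ) = a := by
  rw [← ENNReal.rpow_natCast, ← ENNReal.rpow_mul]; norm_num

theorem le_rpow_half_iff {a b : ℝ≥0∞} : a ≤ b ^ (1 / 2 : ℝ) ↔ a ^ 2 ≤ b := by
  constructor
  · intro h
    rw [← rpow_half_sq b]
    gcongr
  · intro h
    rw [← sq_rpow_half a]
    gcongr

theorem rpow_half_eq_zero {a : ℝ≥0∞} : a ^ (1 / 2 : ℝ) = 0 ↔ a = 0 :=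
  ENNReal.rpow_eq_zero_iff_of_pos (by norm_num)

theorem lintegral_sq_le {P : Measure Ω} [IsProbabilityMeasure P] {s : Ω → ℝ≥0∞}
    (hs : Measurable s) : (∫⁻ x, s x ∂P) ^ 2 ≤ ∫⁻ x, s x ^ 2 ∂P := by
  have h := ENNReal.lintegral_mul_le_Lp_mul_Lq P Real.HolderConjugate.two_two hs.aemeasurable
    (aemeasurable_const (b := (1 : ℝ≥0∞)))
  simp only [Pi.mul_apply, mul_one, ENNReal.one_rpow, lintegral_const, measure_univ] at h
  rw [← le_rpow_half_iff]
  simpa using h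

/-- The equality case of the Cauchy–Schwarz inequality against a constant. -/
theorem ae_eq_of_lintegral_sq_le {P : Measure Ω} [IsProbabilityMeasure P] {s : Ω → ℝ≥0∞}
    (hs : Measurable s) {L : ℝ≥0∞} (hL : L ≠ ⊤) (h1 : L ≤ ∫⁻ x, s x ∂P)
    (h2 : ∫⁻ x, s x ^ 2 ∂P ≤ L ^ 2) : ∀ᵐ x ∂P, s x = L := by
  have hsq : ∫⁻ x, s x ^ 2 ∂P ≠ ⊤ := (h2.trans_lt (by finiteness)).ne
  have hfin : ∀ᵐ x ∂P, s x < ⊤ := by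
    filter_upwards [ae_lt_top (hs.pow_const 2) hsq] with x hx
    by_contra h
    rw [not_lt, top_le_iff] at h
    simp [h] at hx
  have hint : ∫⁻ x, s x ∂P ≠ ⊤ := by
    intro h
    have := lintegral_sq_le (P := P) hs
    rw [h] at this
    exact hsq (top_le_iff.1 (by simpa using this))
  have hi1 : Integrable (fun x ↦ (s x).toReal) P :=
    integrable_toReal_of_lintegral_ne_top hs.aemeasurable hint
  have hi2 : Integrable (fun x ↦ (s x).toReal ^ 2) P := by
    simpa using integrable_toReal_of_lintegral_ne_top (hs.pow_const 2).aemeasurable hsq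
  have e1 : L.toReal ≤ ∫ x, (s x).toReal ∂P := by
    rw [integral_toReal hs.aemeasurable hfin]
    exact ENNReal.toReal_mono hint h1
  have e2 : ∫ x, (s x).toReal ^ 2 ∂P ≤ L.toReal ^ 2 := by
    have := integral_toReal (hs.pow_const 2).aemeasurable (ae_lt_top (hs.pow_const 2) hsq)
    simp only [ENNReal.toReal_pow] at this
    rw [this, ← ENNReal.toReal_pow]
    exact ENNReal.toReal_mono (by finiteness) h2
  have e3 : ∫ x, ((s x).toReal - L.toReal) ^ 2 ∂P = ∫ x, (s x).toReal ^ 2 ∂P -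
      2 * L.toReal * ∫ x, (s x).toReal ∂P + L.toReal ^ 2 := by
    have : ∀ x, ((s x).toReal - L.toReal) ^ 2 =
        (s x).toReal ^ 2 - 2 * L.toReal * (s x).toReal + L.toReal ^ 2 := fun x ↦ by ring
    simp_rw [this]
    rw [integral_add (f := fun x ↦ (s x).toReal ^ 2 - 2 * L.toReal * (s x).toReal)
      (hi2.sub (hi1.const_mul _)) (integrable_const _), integral_sub hi2 (hi1.const_mul _), integral_const_mul]
    simp
  have e4 : ∫ x, ((s x).toReal - L.toReal) ^ 2 ∂P = 0 := by
    refine le_antisymm ?_ (integral_nonneg fun x ↦ sq_nonneg _)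
    rw [e3]
    nlinarith [ENNReal.toReal_nonneg (a := L)]
  rw [integral_eq_zero_iff_of_nonneg (fun x ↦ sq_nonneg _)] at e4
  · filter_upwards [e4, hfin] with x hx hx'
    have : (s x).toReal = L.toReal := by
      simpa [sub_eq_zero] using hx
    exact (ENNReal.toReal_eq_toReal_iff' hx'.ne hL).1 this
  · have : (fun x ↦ ((s x).toReal - L.toReal) ^ 2) =
        fun x ↦ (s x).toReal ^ 2 - 2 * L.toReal * (s x).toReal + L.toReal ^ 2 := by
      ext x; ring
    rw [this]
    exact (hi2.sub (hi1.const_mul _)).add (integrable_const _)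

end Jensen

section FlowSet

variable {ι X E : Type*} [TopologicalSpace X] [CompactSpace X] [MeasurableSpace X] [BorelSpace X]
  [NormedAddCommGroup E] [InnerProductSpace ℝ E] [MeasurableSpace E]

/-- The flows on the time interval `(0, T)` that start at `ν` and end at `η`. -/
def FlowSet (G : GradientFamily ι X E) (T : ℝ) (ν η : ProbabilityMeasure X) :
    Set ((ℝ → ProbabilityMeasure X) × (ℝ → X → E)) :=
  {p | IsFlow G p.1 p.2 ∧ (∀ t ∉ Ioo 0 T, ∀ x, p.2 t x = 0) ∧ p.1 0 = ν ∧ p.1 T = η}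

/-- The action of a flow. -/
def flowAction (K : X → X → ℝ) (p : (ℝ → ProbabilityMeasure X) × (ℝ → X → E)) : ℝ≥0∞ :=
  ∫⁻ t, flowEnergy K p.1 p.2 t

/-- The length of a flow. -/
def flowLength (K : X → X → ℝ) (p : (ℝ → ProbabilityMeasure X) × (ℝ → X → E)) : ℝ≥0∞ :=
  ∫⁻ t, flowEnergy K p.1 p.2 t ^ (1 / 2 : ℝ)

/-- The distance defined by minimizing the action of flows. -/
def flowDist (G : GradientFamily ι X E) (K : X → X → ℝ) (ν η : ProbabilityMeasure X) : ℝ≥0∞ :=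
  (sInf (flowAction K '' FlowSet G 1 ν η)) ^ (1 / 2 : ℝ)

/-- The infimum of the length of flows on `(0, T)`. -/
def flowLengthInf (G : GradientFamily ι X E) (K : X → X → ℝ) (T : ℝ)
    (ν η : ProbabilityMeasure X) : ℝ≥0∞ :=
  sInf (flowLength K '' FlowSet G T ν η)

variable [TopologicalSpace.MetrizableSpace X] [FiniteDimensional ℝ E] [BorelSpace E]
  {G : GradientFamily ι X E} {K : X → X → ℝ} {T T' : ℝ} {ν η ρ : ProbabilityMeasure X}
  {p q : (ℝ → ProbabilityMeasure X) × (ℝ → X → E)}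

theorem flowEnergy_eq_zero {t : ℝ} (h : ∀ x, p.2 t x = 0) : flowEnergy K p.1 p.2 t = 0 := by
  simp [flowEnergy, h]

theorem FlowSet.eq_left (hp : p ∈ FlowSet G T ν η) {t : ℝ} (ht : t ≤ 0) : p.1 t = ν := by
  rw [← hp.2.2.1]
  refine hp.1.eq_of_ae_eq_zero ht (Eventually.of_forall fun r hr ↦ Eventually.of_forall ?_)
  exact hp.2.1 r fun h ↦ absurd h.1 (not_lt.2 hr.2)

theorem FlowSet.eq_right (hp : p ∈ FlowSet G T ν η) {t : ℝ} (ht : T ≤ t) : p.1 t = η := by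
  rw [← hp.2.2.2]
  refine (hp.1.eq_of_ae_eq_zero ht (Eventually.of_forall fun r hr ↦ Eventually.of_forall ?_)).symm
  exact hp.2.1 r fun h ↦ absurd h.2 (not_lt.2 hr.1.le)

theorem FlowSet.reparametrize {w : ℝ → ℝ≥0} (hp : p ∈ FlowSet G T ν η)
    (hw : Measurable w) (hT : 0 < T) (hT' : 0 < T') (hsupp : ∀ t ∉ Ioo 0 T, w t = 0)
    (hint : ∫⁻ t, (w t : ℝ≥0∞) = ENNReal.ofReal T')
    (hwc : ∀ᵐ t, t ∈ Ioo 0 T → w t = 0 → ∀ᵐ x ∂(p.1 t : Measure X), p.2 t x = 0) :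
    ∃ q ∈ FlowSet G T' ν η, ∃ S : ℝ → ℝ, Continuous S ∧ Monotone S ∧ S 0 = 0 ∧ S T = T' ∧
      (∀ t, q.1 (S t) = p.1 t) ∧
      ∀ K : X → X → ℝ, Continuous (uncurry K) → ∀ Φ : ℝ≥0∞ → ℝ≥0∞, Measurable Φ → Φ 0 = 0 →
        ∫⁻ u, Φ (flowEnergy K q.1 q.2 u) =
          ∫⁻ t, w t * Φ (((w t)⁻¹ : ℝ≥0) ^ 2 * flowEnergy K p.1 p.2 t) := by
  obtain ⟨S, σ, hS⟩ := exists_isTimeChange hw hT hT' hsupp hint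
  obtain ⟨h1, h2, h3⟩ := hp.1.reparametrize hw hT' hS (by
    filter_upwards [hwc] with t ht h0
    by_cases hI : t ∈ Ioo 0 T
    · exact ht hI h0
    · exact Eventually.of_forall fun x ↦ hp.2.1 t hI x)
  refine ⟨(_, _), ⟨h1, fun t ht x ↦ indicator_of_notMem (s := Ioo 0 T') ht
    (fun u ↦ ((w (σ u))⁻¹ : ℝ≥0) • p.2 (σ u) x), ?_, ?_⟩, S, hS.continuous,
    hS.monotone, hS.map_zero, hS.map_end, h2, h3⟩
  · simpa [hS.map_zero, hp.2.2.1] using h2 0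
  · simpa [hS.map_end, hp.2.2.2] using h2 T

theorem FlowSet.measurable_speed (hK : Continuous (uncurry K)) (hp : p ∈ FlowSet G T ν η) :
    Measurable fun t ↦ flowEnergy K p.1 p.2 t ^ (1 / 2 : ℝ) :=
  (measurable_flowEnergy hK hp.1.continuous hp.1.measurable).pow_const _

theorem FlowSet.lintegral_eq {Φ : ℝ≥0∞ → ℝ≥0∞} (hΦ : Φ 0 = 0) (hp : p ∈ FlowSet G T ν η) :
    ∫⁻ t, Φ (flowEnergy K p.1 p.2 t) = ∫⁻ t in Ioo 0 T, Φ (flowEnergy K p.1 p.2 t) := by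
  refine (setLIntegral_eq_of_support_subset fun t ht ↦ ?_).symm
  by_contra h
  exact ht (by simp only; rw [flowEnergy_eq_zero (hp.2.1 t h), hΦ])

instance : IsProbabilityMeasure (volume.restrict (Ioo (0 : ℝ) 1)) := ⟨by simp⟩

theorem FlowSet.length_sq_le (hK : Continuous (uncurry K)) (hp : p ∈ FlowSet G 1 ν η) :
    flowLength K p ^ 2 ≤ flowAction K p := by
  rw [flowLength, flowAction, FlowSet.lintegral_eq (Φ := fun a ↦ a ^ (1 / 2 : ℝ)) (by simp) hp,
    FlowSet.lintegral_eq (Φ := fun a ↦ a) rfl hp]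
  refine (lintegral_sq_le (FlowSet.measurable_speed hK hp)).trans_eq ?_
  simp only [rpow_half_sq]

theorem flowDist_sq : flowDist G K ν η ^ 2 = sInf (flowAction K '' FlowSet G 1 ν η) :=
  rpow_half_sq _

theorem flowDist_sq_le (hp : p ∈ FlowSet G 1 ν η) : flowDist G K ν η ^ 2 ≤ flowAction K p := by
  rw [flowDist_sq]
  exact sInf_le ⟨p, hp, rfl⟩

theorem flowLengthInf_le_flowDist (hK : Continuous (uncurry K)) (hT : 0 < T) :
    flowLengthInf G K T ν η ≤ flowDist G K ν η := by
  rw [flowDist, le_rpow_half_iff]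
  refine le_sInf ?_
  rintro _ ⟨p, hp, rfl⟩
  refine le_trans ?_ (FlowSet.length_sq_le hK hp)
  gcongr
  let w : ℝ → ℝ≥0 := (Ioo 0 1).indicator fun _ ↦ T.toNNReal
  have hTn : T.toNNReal ≠ 0 := by simpa using hT
  obtain ⟨q, hq, -, -, -, -, -, -, h⟩ := FlowSet.reparametrize hp (w := w) (T' := T)
    (measurable_const.indicator measurableSet_Ioo) one_pos hT (fun t ht ↦ indicator_of_notMem ht _)
    (by
      have : ∀ t, (w t : ℝ≥0∞) = (Ioo (0 : ℝ) 1).indicator (fun _ ↦ ENNReal.ofReal T) t := fun t ↦ by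
        by_cases ht : t ∈ Ioo (0 : ℝ) 1 <;> simp [w, ht, ENNReal.ofReal]
      simp_rw [this]
      rw [lintegral_indicator measurableSet_Ioo]
      simp)
    (Eventually.of_forall fun t ht h0 ↦ absurd h0 (by simp [w, ht, hT]))
  have := h K hK (fun a ↦ a ^ (1 / 2 : ℝ)) (measurable_id.pow_const _) (by simp)
  refine (sInf_le (mem_image_of_mem _ hq)).trans ?_
  rw [flowLength, this, flowLength]
  refine lintegral_mono fun t ↦ ?_
  by_cases ht : t ∈ Ioo (0 : ℝ) 1
  · simp only [w, indicator_of_mem ht]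
    rw [ENNReal.mul_rpow_of_nonneg _ _ (by norm_num), sq_rpow_half, ← mul_assoc,
      ← ENNReal.coe_mul, mul_inv_cancel₀ hTn, ENNReal.coe_one, one_mul]
  · simp [w, indicator_of_notMem ht]

theorem ae_eq_zero_of_flowEnergy_eq_zero (hK : Continuous (uncurry K))
    (hKpos : ∃ C : ℝ, 0 < C ∧ ∀ x y, C ≤ K x y) (hp : IsFlow G p.1 p.2) {t : ℝ}
    (h : flowEnergy K p.1 p.2 t = 0) : ∀ᵐ x ∂(p.1 t : Measure X), p.2 t x = 0 := by
  obtain ⟨C, hC, hCK⟩ := hKpos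
  have hm : Measurable fun x ↦ ENNReal.ofReal (mobility K (p.1 t) x) * ‖p.2 t x‖ₑ ^ 2 :=
    (measurable_energy_density hK hp.continuous hp.measurable).comp measurable_prodMk_left
  rw [flowEnergy, lintegral_eq_zero_iff hm] at h
  filter_upwards [h] with x hx
  have hm := hC.trans_le (le_mobility hK hCK (p.1 t) x)
  simpa [hm.not_ge] using hx

theorem FlowSet.ae_lt_top (hK : Continuous (uncurry K)) (hp : p ∈ FlowSet G T ν η)
    (hL : flowLength K p ≠ ⊤) : ∀ᵐ t, flowEnergy K p.1 p.2 t ^ (1 / 2 : ℝ) < ⊤ :=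
  MeasureTheory.ae_lt_top (FlowSet.measurable_speed hK hp) hL

theorem flowDist_le_flowLengthInf (hK : Continuous (uncurry K)) (hT : 0 < T) :
    flowDist G K ν η ≤ flowLengthInf G K T ν η := by
  refine le_sInf ?_
  rintro _ ⟨p, hp, rfl⟩
  rcases eq_or_ne (flowLength K p) ⊤ with hL | hL
  · rw [hL]; exact le_top
  set s : ℝ → ℝ≥0∞ := fun t ↦ flowEnergy K p.1 p.2 t ^ (1 / 2 : ℝ) with hs
  have hsm : Measurable s := FlowSet.measurable_speed hK hp
  obtain ⟨L, hL'⟩ : ∃ L : ℝ≥0, (L : ℝ≥0∞) = flowLength K p := ⟨_, ENNReal.coe_toNNReal hL⟩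
  have key : ∀ ε : ℝ≥0, 0 < ε →
      flowDist G K ν η ^ 2 ≤ ((ε * T.toNNReal + L : ℝ≥0) : ℝ≥0∞) * L := fun ε hε ↦ by
    set Z : ℝ≥0 := ε * T.toNNReal + L with hZ
    have hTn : 0 < T.toNNReal := by simpa using hT
    have hZ0 : Z ≠ 0 := (add_pos_of_pos_of_nonneg (mul_pos hε hTn) zero_le).ne'
    let w : ℝ → ℝ≥0 := (Ioo 0 T).indicator fun t ↦ Z⁻¹ * (ε + (s t).toNNReal)
    have hwne : ∀ t ∈ Ioo 0 T, w t ≠ 0 := fun t ht ↦ by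
      simp only [w, indicator_of_mem ht]
      exact mul_ne_zero (inv_ne_zero hZ0) (add_pos_of_pos_of_nonneg hε zero_le).ne'
    obtain ⟨q, hq, -, -, -, -, -, -, h⟩ := FlowSet.reparametrize hp (w := w) (T' := 1)
      ((measurable_const.mul (measurable_const.add hsm.ennreal_toNNReal)).indicator
        measurableSet_Ioo) hT one_pos (fun t ht ↦ indicator_of_notMem ht _)
      (by
        have : ∀ᵐ t, (w t : ℝ≥0∞) = (Ioo (0 : ℝ) T).indicator
            (fun t ↦ (Z⁻¹ : ℝ≥0) * (ε + s t)) t := by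
          filter_upwards [FlowSet.ae_lt_top hK hp hL] with t htop
          by_cases ht : t ∈ Ioo (0 : ℝ) T
          · simp only [w, ht, indicator_of_mem]
            rw [ENNReal.coe_mul, ENNReal.coe_add, ENNReal.coe_toNNReal htop.ne]
          · simp [w, ht]
        rw [lintegral_congr_ae this, lintegral_indicator measurableSet_Ioo, lintegral_const_mul]
        · rw [lintegral_add_left measurable_const]
          have h1 : ∫⁻ t in Ioo 0 T, s t = L := by
            rw [hL', flowLength, FlowSet.lintegral_eq (Φ := fun a ↦ a ^ (1 / 2 : ℝ)) (by simp) hp]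
          rw [h1]
          have h2 : ∫⁻ _ in Ioo 0 T, (ε : ℝ≥0∞) = ((ε * T.toNNReal : ℝ≥0) : ℝ≥0∞) := by
            simp [ENNReal.ofReal]
          rw [h2, ← ENNReal.coe_add, ← ENNReal.coe_mul, ← hZ, inv_mul_cancel₀ hZ0]
          simp
        · exact measurable_const.add hsm)
      (Eventually.of_forall fun t ht h0 ↦ absurd h0 (hwne t ht))
    refine (flowDist_sq_le hq).trans ?_
    have := h K hK (fun a ↦ a) measurable_id rfl
    rw [flowAction, this, hL', flowLength, ← lintegral_const_mul _ hsm]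
    refine lintegral_mono_ae ?_
    filter_upwards [FlowSet.ae_lt_top hK hp hL] with t htop
    by_cases ht : t ∈ Ioo 0 T
    · obtain ⟨r, hr⟩ : ∃ r : ℝ≥0, (r : ℝ≥0∞) = s t := ⟨_, ENNReal.coe_toNNReal htop.ne⟩
      have he : flowEnergy K p.1 p.2 t = (r : ℝ≥0∞) ^ 2 := by rw [hr, rpow_half_sq]
      have hwt : w t = Z⁻¹ * (ε + r) := by
        simp only [w, indicator_of_mem ht, ← hr, ENNReal.toNNReal_coe]
      rw [← hr, he, hwt]
      norm_cast
      have hεr : ε + r ≠ 0 := (add_pos_of_pos_of_nonneg hε zero_le).ne'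
      calc Z⁻¹ * (ε + r) * ((Z⁻¹ * (ε + r))⁻¹ ^ 2 * r ^ 2) = Z * (r * (r / (ε + r))) := by
            field_simp
        _ ≤ Z * (r * 1) := by
            gcongr
            exact div_le_one_of_le₀ (by simp) zero_le
        _ = Z * r := by rw [mul_one]
    · simp [w, ht]
  have hlim : Tendsto (fun ε : ℝ≥0 ↦ ((ε * T.toNNReal + L : ℝ≥0) : ℝ≥0∞) * L) (𝓝[>] 0)
      (𝓝 ((L : ℝ≥0∞) ^ 2)) := by
    have : Continuous fun ε : ℝ≥0 ↦ (((ε * T.toNNReal + L) * L : ℝ≥0) : ℝ≥0∞) :=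
      ENNReal.continuous_coe.comp (by fun_prop)
    have h := (this.tendsto 0).mono_left (nhdsWithin_le_nhds (s := Ioi 0))
    simpa [sq] using h
  have h := ge_of_tendsto hlim (eventually_nhdsWithin_of_forall key)
  rw [← hL', ← sq_rpow_half (L : ℝ≥0∞), le_rpow_half_iff]
  exact h

theorem flowDist_eq_flowLengthInf (hK : Continuous (uncurry K)) (hT : 0 < T) :
    flowDist G K ν η = flowLengthInf G K T ν η :=
  le_antisymm (flowDist_le_flowLengthInf hK hT) (flowLengthInf_le_flowDist hK hT)

theorem flowDist_le_flowLength (hK : Continuous (uncurry K)) (hT : 0 < T)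
    (hp : p ∈ FlowSet G T ν η) : flowDist G K ν η ≤ flowLength K p :=
  (flowDist_le_flowLengthInf hK hT).trans (sInf_le ⟨p, hp, rfl⟩)

/-- Minimizers of the action are the minimizers of the length with constant speed. -/
theorem FlowSet.ae_speed_eq (hK : Continuous (uncurry K)) (hp : p ∈ FlowSet G 1 ν η)
    (hfin : flowDist G K ν η < ⊤) (hmin : flowDist G K ν η ^ 2 = flowAction K p) :
    ∀ᵐ t ∂volume.restrict (Ioo (0 : ℝ) 1),
      flowEnergy K p.1 p.2 t ^ (1 / 2 : ℝ) = flowDist G K ν η := by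
  refine ae_eq_of_lintegral_sq_le (FlowSet.measurable_speed hK hp) hfin.ne ?_ ?_
  · have := flowDist_le_flowLength hK one_pos hp
    rwa [flowLength, FlowSet.lintegral_eq (Φ := fun a ↦ a ^ (1 / 2 : ℝ)) (by simp) hp] at this
  · simp only [rpow_half_sq]
    rw [hmin, flowAction, FlowSet.lintegral_eq (Φ := fun a ↦ a) rfl hp]

theorem FlowSet.exists_reparam_minimizer (hK : Continuous (uncurry K))
    (hKpos : ∃ C : ℝ, 0 < C ∧ ∀ x y, C ≤ K x y) (hT : 0 < T) (hp : p ∈ FlowSet G T ν η)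
    (hfin : flowDist G K ν η < ⊤) (hmin : flowLength K p = flowDist G K ν η) :
    ∃ q ∈ FlowSet G 1 ν η, flowDist G K ν η ^ 2 = flowAction K q ∧ ∃ S : ℝ → ℝ, Continuous S ∧
      Monotone S ∧ S 0 = 0 ∧ S T = 1 ∧ ∀ t, q.1 (S t) = p.1 t := by
  have hL : flowLength K p ≠ ⊤ := hmin ▸ hfin.ne
  suffices ∃ w : ℝ → ℝ≥0, Measurable w ∧ (∀ t ∉ Ioo 0 T, w t = 0) ∧
      (∫⁻ t, (w t : ℝ≥0∞) = 1) ∧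
      (∀ᵐ t, t ∈ Ioo 0 T → w t = 0 → ∀ᵐ x ∂(p.1 t : Measure X), p.2 t x = 0) ∧
      ∫⁻ t, w t * (((w t)⁻¹ : ℝ≥0) ^ 2 * flowEnergy K p.1 p.2 t) ≤ flowDist G K ν η ^ 2 by
    obtain ⟨w, h1, h2, h3, h4, h5⟩ := this
    obtain ⟨q, hq, S, hS1, hS2, hS3, hS4, hS5, h⟩ := FlowSet.reparametrize hp h1 hT one_pos h2
      (by simpa using h3) h4
    refine ⟨q, hq, le_antisymm (flowDist_sq_le hq) ?_, S, hS1, hS2, hS3, hS4, hS5⟩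
    have := h K hK (fun a ↦ a) measurable_id rfl
    rwa [flowAction, this]
  set s : ℝ → ℝ≥0∞ := fun t ↦ flowEnergy K p.1 p.2 t ^ (1 / 2 : ℝ) with hs
  have hsm : Measurable s := FlowSet.measurable_speed hK hp
  obtain ⟨L, hL'⟩ : ∃ L : ℝ≥0, (L : ℝ≥0∞) = flowLength K p := ⟨_, ENNReal.coe_toNNReal hL⟩
  have hTn : T.toNNReal ≠ 0 := by simpa using hT
  rcases eq_or_ne L 0 with h0 | h0
  · refine ⟨(Ioo 0 T).indicator fun _ ↦ T.toNNReal⁻¹, measurable_const.indicator measurableSet_Ioo,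
      fun t ht ↦ indicator_of_notMem ht _, ?_, Eventually.of_forall fun t ht h0 ↦
        absurd h0 (by simp [ht, hT]), ?_⟩
    · have : ∀ t, (((Ioo 0 T).indicator (fun _ ↦ T.toNNReal⁻¹) t : ℝ≥0) : ℝ≥0∞) =
          (Ioo (0 : ℝ) T).indicator (fun _ ↦ ((T.toNNReal⁻¹ : ℝ≥0) : ℝ≥0∞)) t := fun t ↦ by
        by_cases ht : t ∈ Ioo (0 : ℝ) T <;> simp [ht]
      simp_rw [this]
      rw [lintegral_indicator measurableSet_Ioo]
      simp only [lintegral_const, Measure.restrict_apply, MeasurableSet.univ, univ_inter,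
        Real.volume_Ioo, sub_zero]
      rw [ENNReal.ofReal, ← ENNReal.coe_mul, inv_mul_cancel₀ hTn, ENNReal.coe_one]
    · have he : ∀ᵐ t, flowEnergy K p.1 p.2 t = 0 := by
        have : flowLength K p = 0 := by rw [← hL', h0]; rfl
        rw [flowLength, lintegral_eq_zero_iff hsm] at this
        filter_upwards [this] with t ht
        exact rpow_half_eq_zero.1 ht
      rw [lintegral_congr_ae (g := fun _ ↦ 0)]
      · simp
      · filter_upwards [he] with t ht
        simp [ht]
  · have hst : ∀ t ∉ Ioo 0 T, s t = 0 := fun t ht ↦ by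
      simp [hs, flowEnergy_eq_zero (hp.2.1 t ht)]
    refine ⟨fun t ↦ L⁻¹ * (s t).toNNReal, measurable_const.mul hsm.ennreal_toNNReal,
      fun t ht ↦ by simp [hst t ht], ?_, ?_, ?_⟩
    · have : ∀ᵐ t, ((L⁻¹ * (s t).toNNReal : ℝ≥0) : ℝ≥0∞) = (L⁻¹ : ℝ≥0) * s t := by
        filter_upwards [FlowSet.ae_lt_top hK hp hL] with t htop
        rw [ENNReal.coe_mul, ENNReal.coe_toNNReal htop.ne]
      rw [lintegral_congr_ae this, lintegral_const_mul _ hsm]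
      change _ * flowLength K p = 1
      rw [← hL', ← ENNReal.coe_mul, inv_mul_cancel₀ h0, ENNReal.coe_one]
    · filter_upwards [FlowSet.ae_lt_top hK hp hL] with t htop _ hw
      refine ae_eq_zero_of_flowEnergy_eq_zero hK hKpos hp.1 ?_
      rcases mul_eq_zero.1 hw with h | h
      · exact absurd h (inv_ne_zero h0)
      · rw [ENNReal.toNNReal_eq_zero_iff, or_iff_left htop.ne] at h
        exact rpow_half_eq_zero.1 h
    · have : flowDist G K ν η ^ 2 = ∫⁻ t, L * s t := by
        rw [lintegral_const_mul _ hsm, ← hmin]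
        change flowLength K p ^ 2 = L * flowLength K p
        rw [← hL', sq]
      rw [this]
      refine lintegral_mono_ae ?_
      filter_upwards [FlowSet.ae_lt_top hK hp hL] with t htop
      obtain ⟨r, hr⟩ : ∃ r : ℝ≥0, (r : ℝ≥0∞) = s t := ⟨_, ENNReal.coe_toNNReal htop.ne⟩
      have he : flowEnergy K p.1 p.2 t = (r : ℝ≥0∞) ^ 2 := by rw [hr, rpow_half_sq]
      simp only [← hr, he, ENNReal.toNNReal_coe]
      norm_cast
      rcases eq_or_ne r 0 with rfl | hr0
      · simp
      · refine le_of_eq ?_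
        field_simp

end FlowSet

section Concat

variable {ι X E : Type*} [TopologicalSpace X] [CompactSpace X] [MeasurableSpace X] [BorelSpace X]
  [NormedAddCommGroup E] [InnerProductSpace ℝ E] [MeasurableSpace E]
  [TopologicalSpace.MetrizableSpace X] [FiniteDimensional ℝ E] [BorelSpace E]
  {G : GradientFamily ι X E} {K : X → X → ℝ} {T T₁ T₂ : ℝ} {ν η ρ : ProbabilityMeasure X}
  {p q : (ℝ → ProbabilityMeasure X) × (ℝ → X → E)}

theorem const_mem_flowSet (G : GradientFamily ι X E) (T : ℝ) (ν : ProbabilityMeasure X) :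
    (fun _ ↦ ν, fun _ _ ↦ 0) ∈ FlowSet G T ν ν :=
  ⟨⟨continuous_const, measurable_const, by simp, fun i s t _ ↦ by simp [flux]⟩,
    fun _ _ _ ↦ rfl, rfl, rfl⟩

theorem flowDist_self (G : GradientFamily ι X E) (K : X → X → ℝ) (ν : ProbabilityMeasure X) :
    flowDist G K ν ν = 0 := by
  have := flowDist_sq_le (K := K) (const_mem_flowSet G 1 ν)
  simpa [flowAction, flowEnergy] using this

/-- The restriction of a flow to the time interval `(a, b)`, shifted to `(0, b - a)`. -/
theorem FlowSet.exists_restrict (hK : Continuous (uncurry K)) (hp : p ∈ FlowSet G T ν η) {a b : ℝ}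
    (hab : a ≤ b) : ∃ q ∈ FlowSet G (b - a) (p.1 a) (p.1 b),
      flowLength K q = ∫⁻ t in Ioo a b, flowEnergy K p.1 p.2 t ^ (1 / 2 : ℝ) := by
  set μ : ℝ → ProbabilityMeasure X := fun t ↦ p.1 (max a (min (t + a) b)) with hμ
  set c : ℝ → X → E := fun t ↦ (Ioo 0 (b - a)).indicator (fun t ↦ p.2 (t + a)) t with hc
  have hin : ∀ t ∈ Ioo 0 (b - a), μ t = p.1 (t + a) ∧ c t = p.2 (t + a) := fun t ht ↦ by
    have h1 : t + a ≤ b := by linarith [ht.2]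
    have h2 : a ≤ t + a := by linarith [ht.1]
    simp [hμ, hc, h1, h2, ht]
  have hout : ∀ t ∉ Ioo 0 (b - a), c t = 0 := fun t ht ↦ indicator_of_notMem ht _
  have hcm : Measurable (uncurry c) := by
    have h1 : Measurable fun z : ℝ × X ↦ p.2 (z.1 + a) z.2 :=
      hp.1.measurable.comp ((measurable_fst.add_const a).prodMk measurable_snd)
    have h2 := h1.indicator (s := Prod.fst ⁻¹' Ioo 0 (b - a)) (measurable_fst measurableSet_Ioo)
    convert h2 using 1
    ext ⟨t, x⟩
    by_cases ht : t ∈ Ioo 0 (b - a)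
    · rw [indicator_of_mem (by exact ht)]
      exact congrFun (hin t ht).2 x
    · rw [indicator_of_notMem (by exact ht)]
      exact congrFun (hout t ht) x
  have hlint : ∀ (F : ProbabilityMeasure X → (X → E) → ℝ≥0∞), (∀ ν, F ν 0 = 0) →
      Measurable (fun t ↦ F (p.1 t) (p.2 t)) →
      ∫⁻ t, F (μ t) (c t) = ∫⁻ t in Ioo a b, F (p.1 t) (p.2 t) := fun F hF hFm ↦ by
    rw [← lintegral_indicator measurableSet_Ioo, ← lintegral_add_right_eq_self
      (fun t ↦ (Ioo a b).indicator (fun t ↦ F (p.1 t) (p.2 t)) t) a]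
    refine lintegral_congr fun t ↦ ?_
    by_cases ht : t ∈ Ioo 0 (b - a)
    · rw [(hin t ht).1, (hin t ht).2, indicator_of_mem]
      exact ⟨by linarith [ht.1], by linarith [ht.2]⟩
    · rw [hout t ht, hF, indicator_of_notMem]
      rintro ⟨h1, h2⟩
      exact ht ⟨by linarith, by linarith⟩
  have hflux : ∀ i t, flux G μ c i t =
      (Ioo a b).indicator (fun r ↦ flux G p.1 p.2 i r) (t + a) := fun i t ↦ by
    by_cases ht : t ∈ Ioo 0 (b - a)
    · rw [indicator_of_mem (show t + a ∈ Ioo a b from ⟨by linarith [ht.1], by linarith [ht.2]⟩)]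
      simp only [flux, (hin t ht).1, (hin t ht).2]
    · rw [indicator_of_notMem fun h : t + a ∈ Ioo a b ↦ ht ⟨by linarith [h.1], by linarith [h.2]⟩]
      exact flux_eq_zero (Eventually.of_forall fun x ↦ by rw [hout t ht]; rfl)
  refine ⟨(μ, c), ⟨⟨?_, hcm, ?_, ?_⟩, fun t ht x ↦ congrFun (hout t ht) x, ?_, ?_⟩, ?_⟩
  · exact hp.1.continuous.comp (by fun_prop)
  · refine (hlint (fun (ν : ProbabilityMeasure X) (d : X → E) ↦ ∫⁻ x, ‖d x‖ₑ ∂(ν : Measure X))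
      (by simp) (measurable_lintegral_curve (f := fun t x ↦ ‖p.2 t x‖ₑ)
      hp.1.continuous hp.1.measurable.enorm)).trans_lt ?_
    exact (setLIntegral_le_lintegral _ _).trans_lt hp.1.lintegral_lt_top
  · intro i s t hst
    have hm : max a (min (s + a) b) ≤ max a (min (t + a) b) := by gcongr
    change ∫ x, G.toFun i x ∂(p.1 _ : Measure X) - ∫ x, G.toFun i x ∂(p.1 _ : Measure X) = _
    rw [hp.1.balance i _ _ hm]
    simp_rw [hflux]
    rw [intervalIntegral.integral_comp_add_right
        (fun r ↦ (Ioo a b).indicator (fun r ↦ flux G p.1 p.2 i r) r) a,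
      intervalIntegral.integral_of_le hm, intervalIntegral.integral_of_le (by linarith),
      ← integral_indicator measurableSet_Ioc, ← integral_indicator measurableSet_Ioc]
    refine integral_congr_ae ?_
    have hb : ∀ᵐ r : ℝ, r ≠ b := by simp [ae_iff]
    filter_upwards [hb] with r hrb
    have : r ∈ Ioc (max a (min (s + a) b)) (max a (min (t + a) b)) ↔
        r ∈ Ioc (s + a) (t + a) ∧ r ∈ Ioo a b := by
      simp only [mem_Ioc, mem_Ioo, max_lt_iff, min_lt_iff, le_max_iff, le_min_iff]
      constructor
      · rintro ⟨⟨h1, h2⟩, h3⟩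
        have h4 : r ≤ t + a ∧ r ≤ b := h3.resolve_left (not_le.2 h1)
        have h5 : r < b := lt_of_le_of_ne h4.2 hrb
        exact ⟨⟨h2.resolve_right (not_lt.2 h4.2), h4.1⟩, h1, h5⟩
      · rintro ⟨⟨h1, h2⟩, h3, h4⟩
        exact ⟨⟨h3, Or.inl h1⟩, Or.inr ⟨h2, h4.le⟩⟩
    by_cases h1 : r ∈ Ioc (s + a) (t + a) <;> by_cases h2 : r ∈ Ioo a b <;>
      simp only [indicator, this, h1, h2, and_self, and_true, and_false, if_true, if_false]
  · simp [hμ, hab]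
  · simp [hμ, hab]
  · exact hlint (fun (ν : ProbabilityMeasure X) (d : X → E) ↦
      (∫⁻ x, ENNReal.ofReal (mobility K ν x) * ‖d x‖ₑ ^ 2 ∂(ν : Measure X)) ^ (1 / 2 : ℝ))
      (by simp) (FlowSet.measurable_speed hK hp)

/-- The concatenation of two flows. -/
theorem FlowSet.exists_concat (hK : Continuous (uncurry K)) (hT₁ : 0 < T₁) (hT₂ : 0 < T₂)
    (hp : p ∈ FlowSet G T₁ ν η) (hq : q ∈ FlowSet G T₂ η ρ) :
    ∃ r ∈ FlowSet G (T₁ + T₂) ν ρ, flowLength K r = flowLength K p + flowLength K q := by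
  set μ : ℝ → ProbabilityMeasure X := fun t ↦ if t ≤ T₁ then p.1 t else q.1 (t - T₁) with hμ
  set c : ℝ → X → E := fun t x ↦ p.2 t x + q.2 (t - T₁) x with hc
  have hle : ∀ t ≤ T₁, μ t = p.1 t ∧ c t = p.2 t ∧ q.1 (t - T₁) = η ∧
      ∀ x, q.2 (t - T₁) x = 0 := fun t ht ↦ by
    have h0 : ∀ x, q.2 (t - T₁) x = 0 := hq.2.1 _ fun h ↦ absurd h.1 (by linarith)
    refine ⟨by simp [hμ, ht], ?_, FlowSet.eq_left hq (by linarith), h0⟩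
    ext x
    simp [hc, h0 x]
  have hgt : ∀ t, T₁ < t → μ t = q.1 (t - T₁) ∧ c t = q.2 (t - T₁) ∧ p.1 t = η ∧
      ∀ x, p.2 t x = 0 := fun t ht ↦ by
    have h0 : ∀ x, p.2 t x = 0 := hp.2.1 _ fun h ↦ absurd h.2 (not_lt.2 ht.le)
    refine ⟨by simp [hμ, ht], ?_, FlowSet.eq_right hp ht.le, h0⟩
    ext x
    simp [hc, h0 x]
  have hlint : ∀ (F : ProbabilityMeasure X → (X → E) → ℝ≥0∞), (∀ ν, F ν 0 = 0) →
      Measurable (fun t ↦ F (p.1 t) (p.2 t)) →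
      ∫⁻ t, F (μ t) (c t) = (∫⁻ t, F (p.1 t) (p.2 t)) + ∫⁻ t, F (q.1 t) (q.2 t) :=
        fun F hF hFm ↦ by
    rw [← lintegral_sub_right_eq_self (fun t ↦ F (q.1 t) (q.2 t)) T₁, ← lintegral_add_left (f := fun t ↦ F (p.1 t) (p.2 t)) hFm]
    refine lintegral_congr fun t ↦ ?_
    rcases le_or_gt t T₁ with ht | ht
    · obtain ⟨h1, h2, -, h4⟩ := hle t ht
      rw [h1, h2, show q.2 (t - T₁) = 0 from funext h4, hF, add_zero]
    · obtain ⟨h1, h2, -, h4⟩ := hgt t ht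
      rw [h1, h2, show p.2 t = 0 from funext h4, hF, zero_add]
  have hflux : ∀ i t, flux G μ c i t = flux G p.1 p.2 i t + flux G q.1 q.2 i (t - T₁) :=
      fun i t ↦ by
    rcases le_or_gt t T₁ with ht | ht
    · obtain ⟨h1, h2, -, h4⟩ := hle t ht
      rw [flux_eq_zero (μ := q.1) (Eventually.of_forall h4), add_zero]
      simp only [flux, h1, h2]
    · obtain ⟨h1, h2, -, h4⟩ := hgt t ht
      rw [flux_eq_zero (μ := p.1) (Eventually.of_forall h4), zero_add]
      simp only [flux, h1, h2]
  have hval : ∀ i t, ∫ x, G.toFun i x ∂(μ t : Measure X) = ∫ x, G.toFun i x ∂(p.1 t : Measure X) +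
      ∫ x, G.toFun i x ∂(q.1 (t - T₁) : Measure X) - ∫ x, G.toFun i x ∂(η : Measure X) :=
      fun i t ↦ by
    rcases le_or_gt t T₁ with ht | ht
    · obtain ⟨h1, -, h3, -⟩ := hle t ht
      rw [h1, h3]; ring
    · obtain ⟨h1, -, h3, -⟩ := hgt t ht
      rw [h1, h3]; ring
  refine ⟨(μ, c), ⟨⟨?_, ?_, ?_, ?_⟩, fun t ht x ↦ ?_, ?_, ?_⟩, ?_⟩
  · refine Continuous.if_le hp.1.continuous (hq.1.continuous.comp (by fun_prop)) continuous_id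
      continuous_const fun t ht ↦ ?_
    rw [ht, hp.2.2.2, sub_self, hq.2.2.1]
  · exact hp.1.measurable.add
      (hq.1.measurable.comp ((measurable_fst.sub_const T₁).prodMk measurable_snd))
  · refine (hlint (fun (ν : ProbabilityMeasure X) (d : X → E) ↦ ∫⁻ x, ‖d x‖ₑ ∂(ν : Measure X))
      (by simp) (measurable_lintegral_curve (f := fun t x ↦ ‖p.2 t x‖ₑ)
      hp.1.continuous hp.1.measurable.enorm)).trans_lt ?_
    exact ENNReal.add_lt_top.2 ⟨hp.1.lintegral_lt_top, hq.1.lintegral_lt_top⟩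
  · intro i s t hst
    change ∫ x, G.toFun i x ∂(μ t : Measure X) - ∫ x, G.toFun i x ∂(μ s : Measure X) = _
    have h1 := hp.1.balance i s t hst
    have h2 := hq.1.balance i (s - T₁) (t - T₁) (by linarith)
    simp_rw [hflux]
    rw [intervalIntegral.integral_add (hp.1.integrable_flux i).intervalIntegrable
      ((hq.1.integrable_flux i).comp_sub_right T₁).intervalIntegrable,
      intervalIntegral.integral_comp_sub_right (fun r ↦ flux G q.1 q.2 i r), ← h1, ← h2, hval, hval]
    ring
  · change c t x = 0
    rcases le_or_gt t T₁ with ht' | ht'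
    · rw [(hle t ht').2.1]
      exact hp.2.1 t (fun h ↦ ht ⟨h.1, by linarith [h.2]⟩) x
    · rw [(hgt t ht').2.1]
      exact hq.2.1 _ (fun h ↦ ht ⟨by linarith, by linarith [h.2]⟩) x
  · exact (hle 0 hT₁.le).1.trans hp.2.2.1
  · change μ (T₁ + T₂) = ρ
    rw [(hgt (T₁ + T₂) (by linarith)).1, add_sub_cancel_left, hq.2.2.2]
  · exact hlint (fun (ν : ProbabilityMeasure X) (d : X → E) ↦
      (∫⁻ x, ENNReal.ofReal (mobility K ν x) * ‖d x‖ₑ ^ 2 ∂(ν : Measure X)) ^ (1 / 2 : ℝ))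
      (by simp) (FlowSet.measurable_speed hK hp)

theorem flowDist_triangle (hK : Continuous (uncurry K)) (ν η ρ : ProbabilityMeasure X) :
    flowDist G K ν ρ ≤ flowDist G K ν η + flowDist G K η ρ := by
  rw [flowDist_eq_flowLengthInf (ν := ν) (η := η) hK one_pos,
    flowDist_eq_flowLengthInf (ν := η) (η := ρ) hK one_pos, flowLengthInf, ← tsub_le_iff_right]
  refine le_sInf ?_
  rintro _ ⟨p, hp, rfl⟩
  rw [tsub_le_iff_left, ← tsub_le_iff_right]
  refine le_sInf ?_
  rintro _ ⟨q, hq, rfl⟩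
  rw [tsub_le_iff_right, add_comm]
  obtain ⟨r, hr, hlen⟩ := FlowSet.exists_concat hK one_pos one_pos hp hq
  exact hlen ▸ flowDist_le_flowLength hK (by norm_num) hr

/-- Minimizers of the action are geodesics. -/
theorem FlowSet.flowDist_eq (hK : Continuous (uncurry K)) (hp : p ∈ FlowSet G 1 ν η)
    (hfin : flowDist G K ν η < ⊤) (hmin : flowDist G K ν η ^ 2 = flowAction K p) {s t : ℝ}
    (hs : 0 ≤ s) (hst : s ≤ t) (ht : t ≤ 1) :
    flowDist G K (p.1 s) (p.1 t) = ENNReal.ofReal (t - s) * flowDist G K ν η := by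
  have hle : ∀ a b : ℝ, 0 ≤ a → a ≤ b → b ≤ 1 →
      flowDist G K (p.1 a) (p.1 b) ≤ ENNReal.ofReal (b - a) * flowDist G K ν η := by
    intro a b ha hab hb
    rcases hab.eq_or_lt with rfl | hlt
    · rw [flowDist_self]; exact zero_le
    obtain ⟨q, hq, hlen⟩ := FlowSet.exists_restrict hK hp hab
    refine (flowDist_le_flowLength hK (sub_pos.2 hlt) hq).trans ?_
    have hae := ae_restrict_of_ae_restrict_of_subset (Ioo_subset_Ioo ha hb)
      (FlowSet.ae_speed_eq hK hp hfin hmin)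
    rw [hlen, lintegral_congr_ae hae, lintegral_const, Measure.restrict_apply_univ,
      Real.volume_Ioo, mul_comm]
  refine le_antisymm (hle s t hs hst ht) ?_
  set W := flowDist G K ν η with hW
  have h1 := hle 0 s le_rfl hs (hst.trans ht)
  have h3 := hle t 1 (hs.trans hst) ht le_rfl
  rw [hp.2.2.1] at h1
  rw [hp.2.2.2] at h3
  have h4 : W ≤ ENNReal.ofReal (s - 0) * W + flowDist G K (p.1 s) (p.1 t) +
      ENNReal.ofReal (1 - t) * W :=
    (flowDist_triangle hK ν (p.1 t) η).trans
      (add_le_add ((flowDist_triangle hK ν (p.1 s) (p.1 t)).trans (by gcongr)) h3)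
  have h5 : W = ENNReal.ofReal (s - 0) * W + ENNReal.ofReal (t - s) * W +
      ENNReal.ofReal (1 - t) * W := by
    rw [← add_mul, ← add_mul, ← ENNReal.ofReal_add (by linarith) (by linarith),
      ← ENNReal.ofReal_add (by linarith) (by linarith)]
    simp
  conv_lhs at h4 => rw [h5]
  rw [ENNReal.add_le_add_iff_right (by finiteness), ENNReal.add_le_add_iff_left (by finiteness)]
    at h4
  exact h4

end Concat

/-- A linear functional bounded by a linear map into a Hilbert space is represented by a vector. -/
theorem exists_inner_eq_of_abs_le {V H : Type*} [AddCommGroup V] [Module ℝ V]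
    [NormedAddCommGroup H] [InnerProductSpace ℝ H] [CompleteSpace H] (D : V →ₗ[ℝ] H)
    (l : V →ₗ[ℝ] ℝ) {C : ℝ} (hC : 0 ≤ C) (h : ∀ v, |l v| ≤ C * ‖D v‖) :
    ∃ u : H, ‖u‖ ≤ C ∧ ∀ v, l v = inner ℝ u (D v) := by
  have hker : LinearMap.ker D ≤ LinearMap.ker l := fun v hv ↦ by
    have := h v
    rw [LinearMap.mem_ker.1 hv, norm_zero, mul_zero] at this
    exact abs_nonpos_iff.1 this
  let g : LinearMap.range D →ₗ[ℝ] ℝ :=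
    (LinearMap.ker D).liftQ l hker ∘ₗ D.quotKerEquivRange.symm.toLinearMap
  have hg : ∀ v, g ⟨D v, LinearMap.mem_range_self D v⟩ = l v := fun v ↦ by
    have : D.quotKerEquivRange.symm ⟨D v, LinearMap.mem_range_self D v⟩ =
        (LinearMap.ker D).mkQ v := by
      rw [LinearEquiv.symm_apply_eq]
      exact Subtype.ext rfl
    change (LinearMap.ker D).liftQ l hker (D.quotKerEquivRange.symm _) = _
    rw [this]
    simp
  let g' : StrongDual ℝ (LinearMap.range D) := g.mkContinuous C (by
    rintro ⟨_, v, rfl⟩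
    rw [hg]
    exact h v)
  obtain ⟨f, hf, hnorm⟩ := exists_extension_norm_eq (LinearMap.range D) g'
  refine ⟨(InnerProductSpace.toDual ℝ H).symm f, ?_, fun v ↦ ?_⟩
  · rw [LinearIsometryEquiv.norm_map, hnorm]
    exact LinearMap.mkContinuous_norm_le _ hC _
  · rw [InnerProductSpace.toDual_symm_apply]
    exact ((hf ⟨D v, LinearMap.mem_range_self D v⟩).trans (hg v)).symm

section Existence

variable {ι X E : Type*} [TopologicalSpace X] [CompactSpace X] [MeasurableSpace X] [BorelSpace X]
  [NormedAddCommGroup E] [InnerProductSpace ℝ E] [MeasurableSpace E]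

/-- The space-time gradients of combinations of the functions `1_{(s, t]} f_i`. -/
def testField (G : GradientFamily ι X E) : (ι × ℝ × ℝ →₀ ℝ) →ₗ[ℝ] (ℝ × X → E) :=
  Finsupp.linearCombination ℝ fun j z ↦
    (Ioc j.2.1 j.2.2 ∩ Ioo 0 1).indicator (fun _ ↦ G.grad j.1 z.2) z.1

/-- The increments of a curve of measures, tested with the functions of the family. -/
def increment (G : GradientFamily ι X E) (μ : ℝ → ProbabilityMeasure X) :
    (ι × ℝ × ℝ →₀ ℝ) →ₗ[ℝ] ℝ :=
  Finsupp.linearCombination ℝ fun j ↦ ∫ x, G.toFun j.1 x ∂(μ (max j.2.1 j.2.2) : Measure X) -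
    ∫ x, G.toFun j.1 x ∂(μ j.2.1 : Measure X)

theorem testField_apply (G : GradientFamily ι X E) (a : ι × ℝ × ℝ →₀ ℝ) (z : ℝ × X) :
    testField G a z = ∑ j ∈ a.support,
      (a j * (Ioc j.2.1 j.2.2 ∩ Ioo 0 1).indicator 1 z.1) • G.grad j.1 z.2 := by
  rw [testField, Finsupp.linearCombination_apply, Finsupp.sum, Finset.sum_apply]
  refine Finset.sum_congr rfl fun j _ ↦ ?_
  by_cases h : z.1 ∈ Ioc j.2.1 j.2.2 ∩ Ioo 0 1
  · simp only [Pi.smul_apply, indicator_of_mem h, Pi.one_apply, mul_one]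
  · simp only [Pi.smul_apply, indicator_of_notMem h, smul_zero, mul_zero, zero_smul]

theorem testField_single (G : GradientFamily ι X E) (j : ι × ℝ × ℝ) (z : ℝ × X) :
    testField G (Finsupp.single j 1) z =
      (Ioc j.2.1 j.2.2 ∩ Ioo 0 1).indicator (fun _ ↦ G.grad j.1 z.2) z.1 := by
  simp [testField]

theorem increment_single (G : GradientFamily ι X E) (μ : ℝ → ProbabilityMeasure X) (i : ι)
    {s t : ℝ} (hst : s ≤ t) : increment G μ (Finsupp.single (i, s, t) 1) =
      ∫ x, G.toFun i x ∂(μ t : Measure X) - ∫ x, G.toFun i x ∂(μ s : Measure X) := by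
  simp [increment, hst]

theorem testField_eq_zero (G : GradientFamily ι X E) (a : ι × ℝ × ℝ →₀ ℝ) {z : ℝ × X}
    (hz : z.1 ∉ Ioo (0 : ℝ) 1) : testField G a z = 0 := by
  rw [testField_apply]
  refine Finset.sum_eq_zero fun j _ ↦ ?_
  rw [indicator_of_notMem fun h ↦ hz h.2, mul_zero, zero_smul]

theorem exists_norm_testField_le (G : GradientFamily ι X E) (a : ι × ℝ × ℝ →₀ ℝ) :
    ∃ B : ℝ, 0 ≤ B ∧ ∀ z, ‖testField G a z‖ ≤ B := by
  choose B hB0 hB using G.exists_norm_grad_le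
  refine ⟨∑ j ∈ a.support, |a j| * B j.1, Finset.sum_nonneg fun j _ ↦
    mul_nonneg (abs_nonneg _) (hB0 _).le, fun z ↦ ?_⟩
  rw [testField_apply]
  refine (norm_sum_le _ _).trans (Finset.sum_le_sum fun j _ ↦ ?_)
  rw [norm_smul, norm_mul, Real.norm_eq_abs]
  have h1 : ‖(Ioc j.2.1 j.2.2 ∩ Ioo 0 1).indicator (1 : ℝ → ℝ) z.1‖ ≤ 1 :=
    (norm_indicator_le_norm_self _ _).trans (by simp)
  calc _ ≤ |a j| * 1 * B j.1 := by
        gcongr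
        exact hB _ _
    _ = _ := by rw [mul_one]

theorem continuous_norm_sq_testField (G : GradientFamily ι X E) (a : ι × ℝ × ℝ →₀ ℝ) (t : ℝ) :
    Continuous fun x ↦ ‖testField G a (t, x)‖ ^ 2 := by
  simp only [testField_apply, ← real_inner_self_eq_norm_sq, sum_inner, inner_sum, inner_smul_left,
    inner_smul_right]
  exact continuous_finsetSum _ fun j _ ↦ continuous_const.mul <| continuous_finsetSum _ fun k _ ↦
    continuous_const.mul (G.continuous_inner _ _)

variable [TopologicalSpace.MetrizableSpace X] [FiniteDimensional ℝ E] [BorelSpace E]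
  {G : GradientFamily ι X E} {K : X → X → ℝ} {ν η : ProbabilityMeasure X}
  {p : (ℝ → ProbabilityMeasure X) × (ℝ → X → E)}

theorem measurable_testField (G : GradientFamily ι X E) (a : ι × ℝ × ℝ →₀ ℝ) :
    Measurable (testField G a) := by
  have : testField G a = fun z ↦ ∑ j ∈ a.support,
      (a j * (Ioc j.2.1 j.2.2 ∩ Ioo 0 1).indicator 1 z.1) • G.grad j.1 z.2 :=
    funext (testField_apply G a)
  rw [this]
  refine Finset.measurable_fun_sum _ fun j _ ↦ Measurable.smul ?_
    ((G.measurable_grad _).comp measurable_snd)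
  exact measurable_const.mul ((measurable_one.indicator
    (measurableSet_Ioc.inter measurableSet_Ioo)).comp measurable_fst)

/-- The square root of the mobility along a curve of measures. -/
def rootMobility (K : X → X → ℝ) (μ : ℝ → ProbabilityMeasure X) (z : ℝ × X) : ℝ :=
  √(mobility K (μ z.1) z.2)

theorem continuous_rootMobility (hK : Continuous (uncurry K)) {μ : ℝ → ProbabilityMeasure X}
    (hμ : Continuous μ) : Continuous (rootMobility K μ) :=
  ((continuous_mobility hK).comp
    ((hμ.comp continuous_fst).prodMk continuous_snd)).sqrt

theorem sqrt_le_rootMobility (hK : Continuous (uncurry K)) {C : ℝ} (hC : ∀ x y, C ≤ K x y)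
    (μ : ℝ → ProbabilityMeasure X) (z : ℝ × X) : √C ≤ rootMobility K μ z :=
  Real.sqrt_le_sqrt (le_mobility hK hC _ _)

/-- The squared norm of a test field in the dual of the action. -/
def dualNormSq (G : GradientFamily ι X E) (K : X → X → ℝ) (μ : ℝ → ProbabilityMeasure X)
    (a : ι × ℝ × ℝ →₀ ℝ) : ℝ :=
  ∫ t in Ioo (0 : ℝ) 1, ∫ x, ‖testField G a (t, x)‖ ^ 2 / mobility K (μ t) x ∂(μ t : Measure X)

theorem memLp_testField (hK : Continuous (uncurry K)) {C : ℝ} (hC : 0 < C)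
    (hCK : ∀ x y, C ≤ K x y) {μ : ℝ → ProbabilityMeasure X} (hμ : Continuous μ)
    (a : ι × ℝ × ℝ →₀ ℝ) :
    MemLp (fun z ↦ (rootMobility K μ z)⁻¹ • testField G a z) 2 (spaceTime μ hμ) := by
  obtain ⟨B, hB0, hB⟩ := exists_norm_testField_le G a
  have hset : MeasurableSet (Ioo (0 : ℝ) 1 ×ˢ (univ : Set X)) := measurableSet_Ioo.prod .univ
  have hfin : spaceTime μ hμ (Ioo (0 : ℝ) 1 ×ˢ (univ : Set X)) ≠ ⊤ := by
    rw [spaceTime, Measure.compProd_apply_prod measurableSet_Ioo .univ]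
    simp
  have hm : Measurable fun z ↦ (rootMobility K μ z)⁻¹ • testField G a z :=
    (continuous_rootMobility hK hμ).measurable.inv.smul (measurable_testField G a)
  refine MemLp.mono (memLp_indicator_const 2 hset ((√C)⁻¹ * B) (Or.inr hfin))
    hm.aestronglyMeasurable (Eventually.of_forall fun z ↦ ?_)
  by_cases hz : z.1 ∈ Ioo (0 : ℝ) 1
  · rw [indicator_of_mem (by exact ⟨hz, trivial⟩), norm_smul, norm_inv]
    have h1 : 0 < √C := Real.sqrt_pos.2 hC
    have h2 := sqrt_le_rootMobility hK hCK μ z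
    rw [Real.norm_of_nonneg (h1.le.trans h2), Real.norm_of_nonneg (by positivity)]
    gcongr
    exact hB z
  · rw [testField_eq_zero G a hz, smul_zero, norm_zero]
    exact norm_nonneg _

theorem integral_norm_sq_eq_dualNormSq (hK : Continuous (uncurry K)) {C : ℝ} (hC : 0 < C)
    (hCK : ∀ x y, C ≤ K x y) {μ : ℝ → ProbabilityMeasure X} (hμ : Continuous μ)
    (a : ι × ℝ × ℝ →₀ ℝ) :
    ∫ z, ‖(rootMobility K μ z)⁻¹ • testField G a z‖ ^ 2 ∂spaceTime μ hμ =
      dualNormSq G K μ a := by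
  rw [integral_spaceTime hμ (memLp_testField hK hC hCK hμ a).norm.integrable_sq, dualNormSq,
    ← integral_indicator measurableSet_Ioo]
  refine integral_congr_ae (Eventually.of_forall fun t ↦ ?_)
  by_cases ht : t ∈ Ioo (0 : ℝ) 1
  · simp only [indicator_of_mem ht]
    refine integral_congr_ae (Eventually.of_forall fun x ↦ ?_)
    have := hC.trans_le (le_mobility hK hCK (μ t) x)
    simp only [norm_smul, mul_pow, norm_inv, rootMobility, Real.norm_eq_abs, inv_pow, sq_abs]
    rw [Real.sq_sqrt this.le]
    field_simp
  · simp only [indicator_of_notMem ht]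
    simp [testField_eq_zero G a (z := (t, _)) ht]

/-- The increments of a flow are controlled by its action. -/
theorem FlowSet.increment_sq_le (hK : Continuous (uncurry K)) {C : ℝ} (hC : 0 < C)
    (hCK : ∀ x y, C ≤ K x y) (hp : p ∈ FlowSet G 1 ν η) {A : ℝ} (hA : 0 ≤ A)
    (hpA : flowAction K p ≤ ENNReal.ofReal A) (a : ι × ℝ × ℝ →₀ ℝ) :
    increment G p.1 a ^ 2 ≤ A * dualNormSq G K p.1 a := by
  set lam := spaceTime p.1 hp.1.continuous with hlam
  have hpos : ∀ z, 0 < rootMobility K p.1 z := fun z ↦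
    (Real.sqrt_pos.2 hC).trans_le (sqrt_le_rootMobility hK hCK p.1 z)
  have hint : ∀ j : ι × ℝ × ℝ, Integrable (fun z ↦ inner ℝ
      ((Ioc j.2.1 j.2.2 ∩ Ioo 0 1).indicator (fun _ ↦ G.grad j.1 z.2) z.1) (p.2 z.1 z.2)) lam ∧
      ∫ z, inner ℝ ((Ioc j.2.1 j.2.2 ∩ Ioo 0 1).indicator (fun _ ↦ G.grad j.1 z.2) z.1)
        (p.2 z.1 z.2) ∂lam = ∫ x, G.toFun j.1 x ∂(p.1 (max j.2.1 j.2.2) : Measure X) -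
          ∫ x, G.toFun j.1 x ∂(p.1 j.2.1 : Measure X) := by
    rintro ⟨i, s, t⟩
    have heq : (fun z : ℝ × X ↦ inner ℝ
        ((Ioc s t ∩ Ioo 0 1).indicator (fun _ ↦ G.grad i z.2) z.1) (p.2 z.1 z.2)) =
        (Prod.fst ⁻¹' Ioc s t).indicator fun z ↦ inner ℝ (G.grad i z.2) (p.2 z.1 z.2) := by
      ext z
      by_cases h1 : z.1 ∈ Ioc s t
      · rw [indicator_of_mem (s := Prod.fst ⁻¹' Ioc s t) h1]
        by_cases h2 : z.1 ∈ Ioo (0 : ℝ) 1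
        · rw [indicator_of_mem (s := Ioc s t ∩ Ioo 0 1) ⟨h1, h2⟩]
        · rw [hp.2.1 _ h2, inner_zero_right, inner_zero_right]
      · rw [indicator_of_notMem (s := Prod.fst ⁻¹' Ioc s t) h1,
          indicator_of_notMem (s := Ioc s t ∩ Ioo 0 1) fun h ↦ h1 h.1, inner_zero_left]
    simp only [heq]
    have hi := (integrable_inner_spaceTime (G := G) hp.1.continuous hp.1.measurable
      hp.1.lintegral_lt_top i).indicator (s := Prod.fst ⁻¹' Ioc s t)
        (measurable_fst measurableSet_Ioc)
    refine ⟨hi, ?_⟩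
    rw [integral_spaceTime _ hi, hp.1.balance i s (max s t) (le_max_left _ _),
      intervalIntegral.integral_of_le (le_max_left _ _), ← integral_indicator measurableSet_Ioc]
    refine integral_congr_ae (Eventually.of_forall fun r ↦ ?_)
    have hIoc : Ioc s (max s t) = Ioc s t := by
      rcases le_total s t with h | h
      · rw [max_eq_right h]
      · rw [max_eq_left h, Ioc_self, Ioc_eq_empty (not_lt.2 h)]
    rw [hIoc]
    by_cases hr : r ∈ Ioc s t
    · simp only [indicator_of_mem hr]
      refine integral_congr_ae (Eventually.of_forall fun x ↦ ?_)
      simp only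
      rw [indicator_of_mem (by exact hr)]
    · simp only [indicator_of_notMem hr]
      refine integral_eq_zero_of_ae (Eventually.of_forall fun x ↦ ?_)
      exact indicator_of_notMem (by exact hr) _
  have h1 : increment G p.1 a = ∫ z, inner ℝ (testField G a z) (p.2 z.1 z.2) ∂lam := by
    simp only [testField, increment, Finsupp.linearCombination_apply, Finsupp.sum, Finset.sum_apply,
      Pi.smul_apply, sum_inner, inner_smul_left]
    rw [integral_finsetSum _ fun j _ ↦ (hint j).1.const_mul _]
    refine Finset.sum_congr rfl fun j _ ↦ ?_
    rw [integral_const_mul, (hint j).2]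
    simp
  set D : ℝ × X → E := fun z ↦ (rootMobility K p.1 z)⁻¹ • testField G a z with hD
  set u : ℝ × X → E := fun z ↦ rootMobility K p.1 z • p.2 z.1 z.2 with hu
  have hDm : Measurable D := (continuous_rootMobility hK hp.1.continuous).measurable.inv.smul
    (measurable_testField G a)
  have hum : Measurable u :=
    (continuous_rootMobility hK hp.1.continuous).measurable.smul hp.1.measurable
  have h2 : ∀ z, inner ℝ (testField G a z) (p.2 z.1 z.2) = inner ℝ (D z) (u z) := fun z ↦ by
    simp only [hD, hu, inner_smul_left, inner_smul_right]
    simp [(hpos z).ne']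
  have h3 : ∫⁻ z, ‖u z‖ₑ ^ 2 ∂lam = flowAction K p := by
    rw [lintegral_spaceTime _ (hum.enorm.pow_const 2)]
    refine lintegral_congr fun t ↦ lintegral_congr fun x ↦ ?_
    simp only [hu, enorm_smul, mul_pow]
    congr 1
    rw [rootMobility, Real.enorm_of_nonneg (Real.sqrt_nonneg _),
      ← ENNReal.ofReal_pow (Real.sqrt_nonneg _),
      Real.sq_sqrt (hC.le.trans (le_mobility hK hCK _ _))]
  have h4 : ∫⁻ z, ‖D z‖ₑ ^ 2 ∂lam = ENNReal.ofReal (dualNormSq G K p.1 a) := by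
    rw [← integral_norm_sq_eq_dualNormSq hK hC hCK hp.1.continuous a,
      ofReal_integral_eq_lintegral_ofReal
        (memLp_testField hK hC hCK hp.1.continuous a).norm.integrable_sq
        (Eventually.of_forall fun z ↦ sq_nonneg _)]
    refine lintegral_congr fun z ↦ ?_
    rw [ENNReal.ofReal_pow (norm_nonneg _), ofReal_norm]
  have h5 : ‖increment G p.1 a‖ₑ ^ 2 ≤
      ENNReal.ofReal (dualNormSq G K p.1 a) * ENNReal.ofReal A := by
    have hH := ENNReal.lintegral_mul_le_Lp_mul_Lq lam Real.HolderConjugate.two_two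
      hDm.enorm.aemeasurable hum.enorm.aemeasurable
    simp only [Pi.mul_apply, ENNReal.rpow_two] at hH
    rw [h3, h4] at hH
    have : ‖increment G p.1 a‖ₑ ≤ ENNReal.ofReal (dualNormSq G K p.1 a) ^ (1 / 2 : ℝ) *
        flowAction K p ^ (1 / 2 : ℝ) := by
      refine le_trans ?_ hH
      rw [h1]
      refine (enorm_integral_le_lintegral_enorm _).trans (lintegral_mono fun z ↦ ?_)
      rw [h2, ← ofReal_norm, ← ofReal_norm, ← ofReal_norm, ← ENNReal.ofReal_mul (norm_nonneg _)]
      exact ENNReal.ofReal_le_ofReal (norm_inner_le_norm _ _)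
    calc _ ≤ (ENNReal.ofReal (dualNormSq G K p.1 a) ^ (1 / 2 : ℝ) *
        flowAction K p ^ (1 / 2 : ℝ)) ^ 2 := by gcongr
      _ = ENNReal.ofReal (dualNormSq G K p.1 a) * flowAction K p := by
        rw [mul_pow, rpow_half_sq, rpow_half_sq]
      _ ≤ _ := by gcongr
  have h6 : 0 ≤ dualNormSq G K p.1 a := by
    rw [← integral_norm_sq_eq_dualNormSq hK hC hCK hp.1.continuous a]
    exact integral_nonneg fun z ↦ sq_nonneg _
  rw [← ENNReal.ofReal_mul h6, ← ofReal_norm, ← ENNReal.ofReal_pow (norm_nonneg _),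
    ENNReal.ofReal_le_ofReal_iff (mul_nonneg h6 hA), Real.norm_eq_abs, sq_abs] at h5
  linarith

end Existence

section Compactness

variable {ι X E : Type*} [TopologicalSpace X] [CompactSpace X] [MeasurableSpace X] [BorelSpace X]
  [NormedAddCommGroup E] [InnerProductSpace ℝ E] [MeasurableSpace E]
  [TopologicalSpace.MetrizableSpace X] [FiniteDimensional ℝ E] [BorelSpace E]
  {K : X → X → ℝ} {ν η : ProbabilityMeasure X}
  {p : (ℝ → ProbabilityMeasure X) × (ℝ → X → E)}

/-- A family of curves of measures that is equi-Hölder against a dense family of functions has a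
subsequence that converges at all times. -/
theorem GradientFamily.exists_subseq_tendsto (G : GradientFamily ι X E)
    {P : ℕ → ℝ → ProbabilityMeasure X} {M : ι → ℝ} (hM0 : ∀ i, 0 ≤ M i)
    (hM : ∀ i k s t, s ≤ t → (∫ x, G.toFun i x ∂(P k t : Measure X) -
      ∫ x, G.toFun i x ∂(P k s : Measure X)) ^ 2 ≤ M i * (t - s)) :
    ∃ μ : ℝ → ProbabilityMeasure X, Continuous μ ∧ ∃ φ : ℕ → ℕ, StrictMono φ ∧
      ∀ t, Tendsto (fun k ↦ P (φ k) t) atTop (𝓝 (μ t)) := by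
  have hM' : ∀ i k s t, (∫ x, G.toFun i x ∂(P k t : Measure X) -
      ∫ x, G.toFun i x ∂(P k s : Measure X)) ^ 2 ≤ M i * |t - s| := fun i k s t ↦ by
    rcases le_total s t with h | h
    · rw [abs_of_nonneg (sub_nonneg.2 h)]
      exact hM i k s t h
    · rw [← neg_sq, neg_sub, abs_of_nonpos (sub_nonpos.2 h), neg_sub]
      exact hM i k t s h
  obtain ⟨μQ, -, φ, hφ, hlim⟩ := (isCompact_univ (X := ℚ → ProbabilityMeasure X)).tendsto_subseq
    (x := fun k (q : ℚ) ↦ P k q) fun _ ↦ mem_univ _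
  rw [tendsto_pi_nhds] at hlim
  have hint : ∀ i, Continuous fun ρ : ProbabilityMeasure X ↦
      ∫ x, G.toFun i x ∂(ρ : Measure X) :=
    fun i ↦ ProbabilityMeasure.continuous_integral_continuousMap (G.toFun i)
  have hcauchy : ∀ i t, CauchySeq fun k ↦ ∫ x, G.toFun i x ∂(P (φ k) t : Measure X) := fun i t ↦ by
    rw [Metric.cauchySeq_iff]
    intro ε hε
    obtain ⟨q, hq1, hq2⟩ := exists_rat_btwn
      (show t < t + (ε / 3) ^ 2 / (M i + 1) by have := hM0 i; simp; positivity)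
    have hclose : ∀ k, |∫ x, G.toFun i x ∂(P (φ k) q : Measure X) -
        ∫ x, G.toFun i x ∂(P (φ k) t : Measure X)| < ε / 3 := fun k ↦ by
      refine abs_lt_of_sq_lt_sq ((hM i (φ k) t q hq1.le).trans_lt ?_) (by positivity)
      have h1 : (q : ℝ) - t < (ε / 3) ^ 2 / (M i + 1) := by linarith
      have h2 := hM0 i
      rw [lt_div_iff₀ (by positivity)] at h1
      nlinarith
    obtain ⟨N, hN⟩ := Metric.cauchySeq_iff.1 (((hint i).tendsto _).comp (hlim q)).cauchySeq (ε / 3)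
      (by positivity)
    refine ⟨N, fun m hm k hk ↦ ?_⟩
    have h1 := abs_lt.1 (hclose m)
    have h2 := abs_lt.1 (hclose k)
    have h3 := hN m hm k hk
    rw [Real.dist_eq, abs_lt] at h3 ⊢
    simp only [comp_apply] at h3
    constructor <;> linarith
  have hex : ∀ t, ∃ ρ, Tendsto (fun k ↦ P (φ k) t) atTop (𝓝 ρ) := fun t ↦ by
    obtain ⟨ρ, -, hρ⟩ := isCompact_univ.ultrafilter_le_nhds
      ((hyperfilter ℕ).map fun k ↦ P (φ k) t) (by simp)
    refine ⟨ρ, G.tendsto_of_integral fun i ↦ ?_⟩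
    obtain ⟨L, hL⟩ := cauchySeq_tendsto_of_complete (hcauchy i t)
    have h1 : Tendsto (fun k ↦ ∫ x, G.toFun i x ∂(P (φ k) t : Measure X)) (hyperfilter ℕ)
        (𝓝 (∫ x, G.toFun i x ∂(ρ : Measure X))) := ((hint i).tendsto ρ).comp hρ
    have h2 := hL.mono_left Nat.hyperfilter_le_atTop
    rwa [tendsto_nhds_unique h1 h2]
  choose μ hμ using hex
  refine ⟨μ, ?_, φ, hφ, hμ⟩
  rw [continuous_iff_continuousAt]
  refine fun t ↦ G.tendsto_of_integral fun i ↦ ?_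
  have hb : ∀ s, (∫ x, G.toFun i x ∂(μ s : Measure X) - ∫ x, G.toFun i x ∂(μ t : Measure X)) ^ 2 ≤
      M i * |s - t| := fun s ↦
    le_of_tendsto (((((hint i).tendsto _).comp (hμ s)).sub
      (((hint i).tendsto _).comp (hμ t))).pow 2) (Eventually.of_forall fun k ↦ hM' i _ t s)
  rw [tendsto_iff_dist_tendsto_zero]
  have h0 : Tendsto (fun s ↦ √(M i * |s - t|)) (𝓝 t) (𝓝 0) := by
    have : Continuous fun s ↦ √(M i * |s - t|) := by fun_prop
    simpa using this.tendsto t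
  refine squeeze_zero (fun _ ↦ dist_nonneg) (fun s ↦ ?_) h0
  rw [Real.dist_eq]
  exact Real.abs_le_sqrt (hb s)

theorem dualNormSq_single_le (G : GradientFamily ι X E) (hK : Continuous (uncurry K)) {C : ℝ}
    (hC : 0 < C) (hCK : ∀ x y, C ≤ K x y) {μ : ℝ → ProbabilityMeasure X} {i : ι} {B : ℝ}
    (hB : ∀ x, ‖G.grad i x‖ ≤ B) {s t : ℝ} (hst : s ≤ t) :
    dualNormSq G K μ (Finsupp.single (i, s, t) 1) ≤ B ^ 2 / C * (t - s) := by
  have hm : ∀ t x, 0 < mobility K (μ t) x := fun t x ↦ hC.trans_le (le_mobility hK hCK _ _)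
  have h1 : ∀ r, ∫ x, ‖testField G (Finsupp.single (i, s, t) 1) (r, x)‖ ^ 2 / mobility K (μ r) x
      ∂(μ r : Measure X) ≤ (Ioc s t).indicator (fun _ ↦ B ^ 2 / C) r := fun r ↦ by
    have : (Ioc s t).indicator (fun _ ↦ B ^ 2 / C) r =
      ∫ _, (Ioc s t).indicator (fun _ ↦ B ^ 2 / C) r ∂(μ r : Measure X) := by simp
    rw [this]
    refine integral_mono_of_nonneg (Eventually.of_forall fun x ↦ ?_) (integrable_const _)
      (Eventually.of_forall fun x ↦ ?_)
    · exact div_nonneg (sq_nonneg _) (hm r x).le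
    · by_cases hr : r ∈ Ioc s t ∩ Ioo 0 1
      · simp only [testField_single, indicator_of_mem hr, indicator_of_mem hr.1]
        gcongr
        · exact hB x
        · exact le_mobility hK hCK _ _
      · simp only [testField_single, indicator_of_notMem hr, norm_zero, ne_eq, OfNat.ofNat_ne_zero,
          not_false_eq_true, zero_pow, zero_div]
        exact indicator_nonneg (fun _ _ ↦ by positivity) _
  have hI : Integrable ((Ioc s t).indicator fun _ ↦ B ^ 2 / C) :=
    (integrable_indicator_iff measurableSet_Ioc).2 (by simp)
  calc dualNormSq G K μ (Finsupp.single (i, s, t) 1)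
      ≤ ∫ r in Ioo (0 : ℝ) 1, (Ioc s t).indicator (fun _ ↦ B ^ 2 / C) r :=
        integral_mono_of_nonneg (Eventually.of_forall fun r ↦ integral_nonneg fun x ↦
          div_nonneg (sq_nonneg _) (hm r x).le) hI.restrict (Eventually.of_forall h1)
    _ ≤ ∫ r, (Ioc s t).indicator (fun _ ↦ B ^ 2 / C) r :=
        setIntegral_le_integral hI (Eventually.of_forall
          (indicator_nonneg fun _ _ ↦ by positivity))
    _ = _ := by
        rw [integral_indicator measurableSet_Ioc]
        simp [hst, mul_comm]

theorem tendsto_dualNormSq (G : GradientFamily ι X E) (hK : Continuous (uncurry K)) {C : ℝ}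
    (hC : 0 < C) (hCK : ∀ x y, C ≤ K x y) {P : ℕ → ℝ → ProbabilityMeasure X}
    {μ : ℝ → ProbabilityMeasure X} (hP : ∀ k, Continuous (P k))
    (hlim : ∀ t, Tendsto (fun k ↦ P k t) atTop (𝓝 (μ t))) (a : ι × ℝ × ℝ →₀ ℝ) :
    Tendsto (fun k ↦ dualNormSq G K (P k) a) atTop (𝓝 (dualNormSq G K μ a)) := by
  obtain ⟨B, hB0, hB⟩ := exists_norm_testField_le G a
  have hm : ∀ (ρ : ProbabilityMeasure X) x, 0 < mobility K ρ x :=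
    fun ρ x ↦ hC.trans_le (le_mobility hK hCK _ _)
  refine tendsto_integral_of_dominated_convergence (fun _ ↦ B ^ 2 / C) (fun k ↦ ?_)
    (integrable_const _) (fun k ↦ Eventually.of_forall fun t ↦ ?_)
    (Eventually.of_forall fun t ↦ ?_)
  · refine (measurable_integral_curve (hP k)
      (f := fun t x ↦ ‖testField G a (t, x)‖ ^ 2 / mobility K (P k t) x) ?_).aestronglyMeasurable
    refine ((measurable_testField G a).norm.pow_const 2).div ?_
    exact ((continuous_mobility hK).comp
      (((hP k).comp continuous_fst).prodMk continuous_snd)).measurable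
  · refine (norm_integral_le_of_norm_le_const (C := B ^ 2 / C)
      (Eventually.of_forall fun x ↦ ?_)).trans (by simp)
    rw [Real.norm_of_nonneg (div_nonneg (sq_nonneg _) (hm _ x).le)]
    gcongr
    · exact hB _
    · exact le_mobility hK hCK _ _
  · have hc : Continuous fun ρ : ProbabilityMeasure X ↦
        ∫ x, ‖testField G a (t, x)‖ ^ 2 / mobility K ρ x ∂(ρ : Measure X) := by
      refine Continuous.integral_probabilityMeasure (F := fun (ρ : ProbabilityMeasure X) x ↦
        ‖testField G a (t, x)‖ ^ 2 / mobility K ρ x) ?_ continuous_id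
      exact ((continuous_norm_sq_testField G a t).comp continuous_snd).div
        (continuous_mobility hK) fun z ↦ (hm _ _).ne'
    exact (hc.tendsto (μ t)).comp (hlim t)

end Compactness

section Existence

variable {ι X E : Type*} [TopologicalSpace X] [CompactSpace X] [MeasurableSpace X] [BorelSpace X]
  [NormedAddCommGroup E] [InnerProductSpace ℝ E] [MeasurableSpace E]
  [TopologicalSpace.MetrizableSpace X] [FiniteDimensional ℝ E] [BorelSpace E]
  {G : GradientFamily ι X E} {K : X → X → ℝ} {ν η : ProbabilityMeasure X}
  {p : (ℝ → ProbabilityMeasure X) × (ℝ → X → E)}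

theorem dualNormSq_nonneg (hK : Continuous (uncurry K)) {C : ℝ} (hC : 0 < C)
    (hCK : ∀ x y, C ≤ K x y) {μ : ℝ → ProbabilityMeasure X} (hμ : Continuous μ)
    (a : ι × ℝ × ℝ →₀ ℝ) : 0 ≤ dualNormSq G K μ a := by
  rw [← integral_norm_sq_eq_dualNormSq hK hC hCK hμ a]
  exact integral_nonneg fun z ↦ sq_nonneg _

/-- A curve of measures whose increments are bounded in the dual of the action is transported by a
velocity of finite action. -/
theorem exists_velocity (hK : Continuous (uncurry K)) {C : ℝ} (hC : 0 < C)
    (hCK : ∀ x y, C ≤ K x y) {μ : ℝ → ProbabilityMeasure X} (hμ : Continuous μ)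
    {A : ℝ} (hA : 0 ≤ A)
    (h : ∀ a, increment G μ a ^ 2 ≤ A * dualNormSq G K μ a) :
    ∃ c, (μ, c) ∈ FlowSet G 1 (μ 0) (μ 1) ∧ flowAction K (μ, c) ≤ ENNReal.ofReal A := by
  set lam := spaceTime μ hμ with hlam
  have hpos : ∀ z, 0 < rootMobility K μ z := fun z ↦
    (Real.sqrt_pos.2 hC).trans_le (sqrt_le_rootMobility hK hCK μ z)
  have hmem := memLp_testField (G := G) hK hC hCK hμ
  let D : (ι × ℝ × ℝ →₀ ℝ) →ₗ[ℝ] Lp E 2 lam :=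
    { toFun := fun a ↦ (hmem a).toLp _
      map_add' := fun a b ↦ by
        rw [← MemLp.toLp_add]
        exact MemLp.toLp_congr _ _ (Eventually.of_forall fun z ↦ by simp)
      map_smul' := fun r a ↦ by
        rw [RingHom.id_apply, ← MemLp.toLp_const_smul]
        exact MemLp.toLp_congr _ _ (Eventually.of_forall fun z ↦ by simp [smul_comm r]) }
  have hDcoe : ∀ a, D a =ᵐ[lam] fun z ↦ (rootMobility K μ z)⁻¹ • testField G a z :=
    fun a ↦ (hmem a).coeFn_toLp
  have hDnorm : ∀ a, ‖D a‖ ^ 2 = dualNormSq G K μ a := fun a ↦ by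
    rw [← integral_norm_sq_eq_dualNormSq hK hC hCK hμ a, ← real_inner_self_eq_norm_sq, L2.inner_def]
    refine integral_congr_ae ?_
    filter_upwards [hDcoe a] with z hz
    rw [hz, real_inner_self_eq_norm_sq]
  obtain ⟨u, hu, hinner⟩ := exists_inner_eq_of_abs_le D (increment G μ) (Real.sqrt_nonneg A)
    fun a ↦ by
      refine abs_le_of_sq_le_sq ?_ (by positivity)
      rw [mul_pow, Real.sq_sqrt hA, hDnorm]
      exact h a
  have hum : Measurable u := (Lp.stronglyMeasurable u).measurable
  have hu2 : ∫⁻ z, ‖u z‖ₑ ^ 2 ∂lam ≤ ENNReal.ofReal A := by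
    have h1 : ∫ z, ‖u z‖ ^ 2 ∂lam = ‖u‖ ^ 2 := by
      rw [← real_inner_self_eq_norm_sq, L2.inner_def]
      simp only [real_inner_self_eq_norm_sq]
    have h2 : ENNReal.ofReal (∫ z, ‖u z‖ ^ 2 ∂lam) = ∫⁻ z, ‖u z‖ₑ ^ 2 ∂lam := by
      rw [ofReal_integral_eq_lintegral_ofReal (Lp.memLp u).norm.integrable_sq
        (Eventually.of_forall fun z ↦ sq_nonneg _)]
      refine lintegral_congr fun z ↦ ?_
      rw [ENNReal.ofReal_pow (norm_nonneg _), ofReal_norm]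
    rw [← h2, h1]
    refine ENNReal.ofReal_le_ofReal ?_
    calc ‖u‖ ^ 2 ≤ √A ^ 2 := by gcongr
      _ = A := Real.sq_sqrt hA
  set c : ℝ → X → E := fun t x ↦
    (Ioo (0 : ℝ) 1).indicator (fun t ↦ (rootMobility K μ (t, x))⁻¹ • u (t, x)) t with hc
  have hcm : Measurable (uncurry c) :=
    ((continuous_rootMobility hK hμ).measurable.inv.smul hum).indicator
      (s := Prod.fst ⁻¹' Ioo (0 : ℝ) 1) (measurable_fst measurableSet_Ioo)
  have hc0 : ∀ t ∉ Ioo (0 : ℝ) 1, ∀ x, c t x = 0 := fun t ht x ↦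
    indicator_of_notMem (s := Ioo (0 : ℝ) 1) ht _
  have hact : flowAction K (μ, c) ≤ ENNReal.ofReal A := by
    refine le_trans ?_ hu2
    rw [flowAction, lintegral_spaceTime hμ (f := fun z ↦ ‖u z‖ₑ ^ 2) (hum.enorm.pow_const 2)]
    refine lintegral_mono fun t ↦ lintegral_mono fun x ↦ ?_
    by_cases ht : t ∈ Ioo (0 : ℝ) 1
    · have hm := hC.trans_le (le_mobility hK hCK (μ t) x)
      simp only [hc, indicator_of_mem ht, enorm_smul, mul_pow]
      rw [← mul_assoc, rootMobility, Real.enorm_of_nonneg (inv_nonneg.2 (Real.sqrt_nonneg _)),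
        ← ENNReal.ofReal_pow (inv_nonneg.2 (Real.sqrt_nonneg _)), inv_pow, Real.sq_sqrt hm.le,
        ← ENNReal.ofReal_mul hm.le, mul_inv_cancel₀ hm.ne', ENNReal.ofReal_one, one_mul]
    · simp [hc0 t ht]
  have hL1 : ∫⁻ t, ∫⁻ x, ‖c t x‖ₑ ∂(μ t : Measure X) < ⊤ := by
    have hb : ∀ t, ∫⁻ x, ‖c t x‖ₑ ∂(μ t : Measure X) ≤ (Ioo (0 : ℝ) 1).indicator 1 t +
        (ENNReal.ofReal C)⁻¹ * flowEnergy K μ c t := fun t ↦ by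
      by_cases ht : t ∈ Ioo (0 : ℝ) 1
      · rw [indicator_of_mem ht, flowEnergy, ← lintegral_const_mul]
        · have h1 : (1 : ℝ → ℝ≥0∞) t = ∫⁻ _, 1 ∂(μ t : Measure X) := by simp
          rw [h1, ← lintegral_add_left measurable_const]
          refine lintegral_mono fun x ↦ ?_
          have hCm : ENNReal.ofReal C ≤ ENNReal.ofReal (mobility K (μ t) x) :=
            ENNReal.ofReal_le_ofReal (le_mobility hK hCK (μ t) x)
          have hC0 : ENNReal.ofReal C ≠ 0 := by simpa using hC
          calc ‖c t x‖ₑ ≤ 1 + ‖c t x‖ₑ ^ 2 := by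
                rcases le_total ‖c t x‖ₑ 1 with h | h
                · exact h.trans le_self_add
                · exact (le_self_pow₀ h two_ne_zero).trans le_add_self
            _ = 1 + (ENNReal.ofReal C)⁻¹ * (ENNReal.ofReal C * ‖c t x‖ₑ ^ 2) := by
                rw [← mul_assoc, ENNReal.inv_mul_cancel hC0 ENNReal.ofReal_ne_top, one_mul]
            _ ≤ _ := by gcongr
        · exact (measurable_energy_density hK hμ hcm).comp measurable_prodMk_left
      · simp [hc0 t ht]
    refine (lintegral_mono hb).trans_lt ?_
    rw [lintegral_add_left (measurable_one.indicator measurableSet_Ioo),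
      lintegral_const_mul _ (measurable_flowEnergy hK hμ hcm)]
    refine ENNReal.add_lt_top.2 ⟨?_, ENNReal.mul_lt_top ?_ (hact.trans_lt ENNReal.ofReal_lt_top)⟩
    · rw [lintegral_indicator_one measurableSet_Ioo]; simp
    · simpa using hC
  refine ⟨c, ⟨⟨hμ, hcm, hL1, fun i s t hst ↦ ?_⟩, hc0, rfl, rfl⟩, hact⟩
  rw [← increment_single G μ i hst, hinner, L2.inner_def,
    intervalIntegral.integral_of_le hst, ← integral_indicator measurableSet_Ioc]
  have hi := (integrable_inner_spaceTime (G := G) hμ hcm hL1 i).indicator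
    (s := Prod.fst ⁻¹' Ioc s t) (measurable_fst measurableSet_Ioc)
  have heq : ∫ z, inner ℝ (u z) (D (Finsupp.single (i, s, t) 1) z) ∂lam =
      ∫ z, (Prod.fst ⁻¹' Ioc s t).indicator (fun z : ℝ × X ↦ inner ℝ (G.grad i z.2) (c z.1 z.2)) z
        ∂lam := by
    refine integral_congr_ae ?_
    filter_upwards [hDcoe (Finsupp.single (i, s, t) 1)] with z hz
    rw [hz, testField_single]
    by_cases h1 : z.1 ∈ Ioc s t
    · rw [indicator_of_mem (s := Prod.fst ⁻¹' Ioc s t) h1]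
      by_cases h2 : z.1 ∈ Ioo (0 : ℝ) 1
      · rw [indicator_of_mem (s := Ioc s t ∩ Ioo 0 1) ⟨h1, h2⟩]
        simp only [hc, indicator_of_mem h2, inner_smul_right]
        rw [real_inner_comm]
      · rw [hc0 _ h2, indicator_of_notMem (s := Ioc s t ∩ Ioo 0 1) fun h ↦ h2 h.2]
        simp
    · rw [indicator_of_notMem (s := Prod.fst ⁻¹' Ioc s t) h1,
        indicator_of_notMem (s := Ioc s t ∩ Ioo 0 1) fun h ↦ h1 h.1]
      simp
  rw [heq, integral_spaceTime hμ hi]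
  refine integral_congr_ae (Eventually.of_forall fun r ↦ ?_)
  by_cases hr : r ∈ Ioc s t
  · simp only [indicator_of_mem hr]
    refine integral_congr_ae (Eventually.of_forall fun x ↦ ?_)
    exact indicator_of_mem (s := Prod.fst ⁻¹' Ioc s t) (a := (r, x)) hr _
  · simp only [indicator_of_notMem hr]
    refine integral_eq_zero_of_ae (Eventually.of_forall fun x ↦ ?_)
    exact indicator_of_notMem (s := Prod.fst ⁻¹' Ioc s t) (a := (r, x)) hr _

/-- Existence of minimizers of the action. -/
theorem exists_flowAction_eq (hK : Continuous (uncurry K))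
    (hKpos : ∃ C : ℝ, 0 < C ∧ ∀ x y, C ≤ K x y) (hfin : flowDist G K ν η < ⊤) :
    ∃ p ∈ FlowSet G 1 ν η, flowDist G K ν η ^ 2 = flowAction K p := by
  obtain ⟨C, hC, hCK⟩ := hKpos
  obtain ⟨W, hW⟩ : ∃ W : ℝ≥0, (W : ℝ≥0∞) = flowDist G K ν η := ⟨_, ENNReal.coe_toNNReal hfin.ne⟩
  have hex : ∀ k : ℕ, ∃ p ∈ FlowSet G 1 ν η,
      flowAction K p ≤ ENNReal.ofReal ((W : ℝ) ^ 2 + 1 / (k + 1)) := fun k ↦ by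
    have hlt : sInf (flowAction K '' FlowSet G 1 ν η) <
        ENNReal.ofReal ((W : ℝ) ^ 2 + 1 / (k + 1)) := by
      rw [← flowDist_sq, ← hW, ← ENNReal.ofReal_coe_nnreal, ← ENNReal.ofReal_pow W.coe_nonneg,
        ENNReal.ofReal_lt_ofReal_iff (by positivity)]
      have : (0 : ℝ) < 1 / (k + 1) := by positivity
      linarith
    obtain ⟨_, ⟨p, hp, rfl⟩, hlt'⟩ := sInf_lt_iff.1 hlt
    exact ⟨p, hp, hlt'.le⟩
  choose p hp hpA using hex
  choose B hB0 hB using G.exists_norm_grad_le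
  have hinc : ∀ k a, increment G (p k).1 a ^ 2 ≤
      ((W : ℝ) ^ 2 + 1 / (k + 1)) * dualNormSq G K (p k).1 a := fun k a ↦
    FlowSet.increment_sq_le hK hC hCK (hp k) (by positivity) (hpA k) a
  obtain ⟨μ, hμ, φ, hφ, hlim⟩ := G.exists_subseq_tendsto (P := fun k ↦ (p k).1)
    (M := fun i ↦ ((W : ℝ) ^ 2 + 1) * (B i ^ 2 / C)) (fun i ↦ by positivity) fun i k s t hst ↦ by
      rw [← increment_single G _ i hst]
      have hk : (1 : ℝ) / (k + 1) ≤ 1 := by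
        rw [div_le_one (by positivity)]
        linarith [(Nat.cast_nonneg k : (0 : ℝ) ≤ k)]
      calc _ ≤ _ := hinc k _
        _ ≤ ((W : ℝ) ^ 2 + 1) * (B i ^ 2 / C * (t - s)) := by
          gcongr
          · exact dualNormSq_nonneg hK hC hCK (hp k).1.continuous _
          · exact dualNormSq_single_le G hK hC hCK (hB i) hst
        _ = _ := by ring
  have hval : ∀ (t : ℝ) (ρ : ProbabilityMeasure X), (∀ k, (p k).1 t = ρ) → μ t = ρ := fun t ρ h ↦
    tendsto_nhds_unique (hlim t) (by simp only [h]; exact tendsto_const_nhds)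
  obtain ⟨c, hc, hcA⟩ := exists_velocity (G := G) hK hC hCK hμ (A := (W : ℝ) ^ 2) (by positivity)
    fun a ↦ by
      have e1 : Tendsto (fun k ↦ increment G (p (φ k)).1 a ^ 2) atTop (𝓝 (increment G μ a ^ 2)) := by
        refine Tendsto.pow ?_ 2
        simp only [increment, Finsupp.linearCombination_apply, Finsupp.sum]
        refine tendsto_finsetSum _ fun j _ ↦ Tendsto.const_smul (Tendsto.sub ?_ ?_) _
        · exact ((ProbabilityMeasure.continuous_integral_continuousMap (G.toFun j.1)).tendsto
            _).comp (hlim _)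
        · exact ((ProbabilityMeasure.continuous_integral_continuousMap (G.toFun j.1)).tendsto
            _).comp (hlim _)
      have e2 := tendsto_dualNormSq G hK hC hCK (fun k ↦ (hp (φ k)).1.continuous) hlim a
      have e3 : Tendsto (fun k ↦ (W : ℝ) ^ 2 + 1 / ((φ k : ℝ) + 1)) atTop (𝓝 ((W : ℝ) ^ 2)) := by
        simpa using (tendsto_one_div_add_atTop_nhds_zero_nat.comp hφ.tendsto_atTop).const_add
          ((W : ℝ) ^ 2)
      exact le_of_tendsto_of_tendsto' e1 (e3.mul e2) fun k ↦ hinc (φ k) a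
  rw [hval 0 ν fun k ↦ (hp k).2.2.1, hval 1 η fun k ↦ (hp k).2.2.2] at hc
  refine ⟨_, hc, le_antisymm (flowDist_sq_le hc) (hcA.trans_eq ?_)⟩
  rw [← hW, ENNReal.ofReal_pow W.coe_nonneg, ENNReal.ofReal_coe_nnreal]

end Existence

section Frame

variable {B : Type*} [TopologicalSpace B] {n : ℕ} {V : B → Type*}
  [TopologicalSpace (TotalSpace (EuclideanSpace ℝ (Fin n)) V)]
  [∀ x, NormedAddCommGroup (V x)] [∀ x, InnerProductSpace ℝ (V x)]
  [FiberBundle (EuclideanSpace ℝ (Fin n)) V] [VectorBundle ℝ (EuclideanSpace ℝ (Fin n)) V]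

theorem continuousOn_trivialization_symm (x₀ : B) {σ : B → EuclideanSpace ℝ (Fin n)}
    (hσ : ContinuousOn σ (trivializationAt (EuclideanSpace ℝ (Fin n)) V x₀).baseSet) :
    ContinuousOn (fun x ↦ (⟨x, (trivializationAt (EuclideanSpace ℝ (Fin n)) V x₀).symm x (σ x)⟩ :
      TotalSpace (EuclideanSpace ℝ (Fin n)) V))
      (trivializationAt (EuclideanSpace ℝ (Fin n)) V x₀).baseSet :=
  (trivializationAt (EuclideanSpace ℝ (Fin n)) V x₀).continuousOn_symm.comp
    (continuousOn_id.prodMk hσ) fun _ hx ↦ ⟨hx, mem_univ _⟩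

theorem exists_local_orthonormal_frame [IsContinuousRiemannianBundle (EuclideanSpace ℝ (Fin n)) V]
    (x₀ : B) : ∃ (g : Fin n → ∀ x, V x) (σ : Fin n → B → EuclideanSpace ℝ (Fin n)),
      (∀ x ∈ (trivializationAt (EuclideanSpace ℝ (Fin n)) V x₀).baseSet,
        Orthonormal ℝ fun i ↦ g i x) ∧
      (∀ i, ContinuousOn (σ i) (trivializationAt (EuclideanSpace ℝ (Fin n)) V x₀).baseSet) ∧
      ∀ i, ∀ x ∈ (trivializationAt (EuclideanSpace ℝ (Fin n)) V x₀).baseSet,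
        g i x = (trivializationAt (EuclideanSpace ℝ (Fin n)) V x₀).symm x (σ i x) := by
  set e := trivializationAt (EuclideanSpace ℝ (Fin n)) V x₀ with he
  let f : Fin n → ∀ x, V x := fun i x ↦ e.symm x (EuclideanSpace.single i 1)
  have hf : ∀ x ∈ e.baseSet, LinearIndependent ℝ fun i ↦ f i x := by
    intro x hx
    have h := (EuclideanSpace.basisFun (Fin n) ℝ).toBasis.linearIndependent.map'
      ((e.continuousLinearEquivAt ℝ x hx).symm.toLinearEquiv : _ →ₗ[ℝ] V x)
      (LinearEquiv.ker _)
    convert h using 1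
    ext i
    simp [f]
    rfl
  have hsymm : ∀ x ∈ e.baseSet, ∀ a : ℝ, ∀ u, e.symm x (a • u) = a • e.symm x u := by
    intro x hx a u
    rw [← e.symmL_apply (R := ℝ) hx, ← e.symmL_apply (R := ℝ) hx, map_smul]
  have key : ∀ i, ∃ σ : B → EuclideanSpace ℝ (Fin n), ContinuousOn σ e.baseSet ∧
      ∀ x ∈ e.baseSet, InnerProductSpace.gramSchmidt ℝ (fun i ↦ f i x) i = e.symm x (σ x) := by
    intro i
    induction i using WellFoundedLT.induction with
    | _ i ih =>
    choose σ hσc hσ using ih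
    let c : Fin n → B → ℝ := fun j x ↦
      inner ℝ (InnerProductSpace.gramSchmidt ℝ (fun i ↦ f i x) j) (f i x) /
        (‖InnerProductSpace.gramSchmidt ℝ (fun i ↦ f i x) j‖ : ℝ) ^ 2
    refine ⟨fun x ↦ EuclideanSpace.single i 1 - ∑ j ∈ (Finset.Iio i).attach,
      c j x • σ j (Finset.mem_Iio.1 j.2) x, ?_, ?_⟩
    · refine continuousOn_const.sub (continuousOn_finsetSum _ fun j _ ↦ ?_)
      have hj := Finset.mem_Iio.1 j.2
      refine ContinuousOn.fun_smul ?_ (hσc j hj)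
      have h1 : ContinuousOn (fun x ↦ (⟨x, InnerProductSpace.gramSchmidt ℝ (fun i ↦ f i x) j⟩ :
          TotalSpace (EuclideanSpace ℝ (Fin n)) V)) e.baseSet :=
        (continuousOn_trivialization_symm x₀ (hσc j hj)).congr fun x hx ↦ by
          simp only [hσ j hj x hx, he]
      have h2 : ContinuousOn (fun x ↦ (⟨x, f i x⟩ :
          TotalSpace (EuclideanSpace ℝ (Fin n)) V)) e.baseSet :=
        continuousOn_trivialization_symm x₀ continuousOn_const
      refine (h1.inner_bundle h2).div ?_ fun x hx ↦ ?_
      · simp_rw [← real_inner_self_eq_norm_sq]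
        exact h1.inner_bundle h1
      · exact pow_ne_zero _ (norm_ne_zero_iff.2
          (InnerProductSpace.gramSchmidt_ne_zero _ (hf x hx)))
    · intro x hx
      have h1 := InnerProductSpace.gramSchmidt_def'' (𝕜 := ℝ) (fun i ↦ f i x) i
      have h2 : e.symm x (EuclideanSpace.single i 1 - ∑ j ∈ (Finset.Iio i).attach,
          c j x • σ j (Finset.mem_Iio.1 j.2) x) = f i x - ∑ j ∈ (Finset.Iio i).attach,
          c j x • e.symm x (σ j (Finset.mem_Iio.1 j.2) x) := by
        rw [← e.symmL_apply (R := ℝ) hx, map_sub, map_sum]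
        simp only [e.symmL_apply hx, hsymm x hx, f]
      rw [h2, eq_sub_iff_add_eq, h1, ← Finset.sum_attach (Finset.Iio i)]
      congr 1
      refine Finset.sum_congr rfl fun j _ ↦ ?_
      rw [← hσ j (Finset.mem_Iio.1 j.2) x hx]
      rfl
  choose σ hσc hσ using key
  refine ⟨fun i x ↦ InnerProductSpace.gramSchmidtNormed ℝ (fun i ↦ f i x) i,
    fun i x ↦ (‖InnerProductSpace.gramSchmidt ℝ (fun i ↦ f i x) i‖ : ℝ)⁻¹ • σ i x,
    fun x hx ↦ InnerProductSpace.gramSchmidtNormed_orthonormal (hf x hx), fun i ↦ ?_,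
    fun i x hx ↦ ?_⟩
  · have h1 : ContinuousOn (fun x ↦ (⟨x, InnerProductSpace.gramSchmidt ℝ (fun i ↦ f i x) i⟩ :
        TotalSpace (EuclideanSpace ℝ (Fin n)) V)) e.baseSet :=
      (continuousOn_trivialization_symm x₀ (hσc i)).congr fun x hx ↦ by
        simp only [hσ i x hx, he]
    refine ContinuousOn.fun_smul (ContinuousOn.inv₀ ?_ fun x hx ↦ ?_) (hσc i)
    · simp_rw [norm_eq_sqrt_real_inner]
      exact (h1.inner_bundle h1).sqrt
    · exact norm_ne_zero_iff.2 (InnerProductSpace.gramSchmidt_ne_zero _ (hf x hx))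
  · rw [hsymm x hx, ← hσ i x hx]
    rfl

theorem exists_borel_orthonormal_frame
    [IsContinuousRiemannianBundle (EuclideanSpace ℝ (Fin n)) V] [SigmaCompactSpace B]
    [MeasurableSpace B] [BorelSpace B] :
    ∃ b : ∀ x, OrthonormalBasis (Fin n) ℝ (V x),
      (@Measurable (TotalSpace (EuclideanSpace ℝ (Fin n)) V) (EuclideanSpace ℝ (Fin n)) (borel _) _
        fun w ↦ (b w.proj).repr w.2) ∧
      (@Measurable (B × EuclideanSpace ℝ (Fin n)) (TotalSpace (EuclideanSpace ℝ (Fin n)) V) _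
        (borel _) fun q ↦ ⟨q.1, (b q.1).repr.symm q.2⟩) := by
  let _ : MeasurableSpace (TotalSpace (EuclideanSpace ℝ (Fin n)) V) := borel _
  have : BorelSpace (TotalSpace (EuclideanSpace ℝ (Fin n)) V) := ⟨rfl⟩
  rcases isEmpty_or_nonempty B with hB | hB
  · have : IsEmpty (TotalSpace (EuclideanSpace ℝ (Fin n)) V) := ⟨fun w ↦ hB.elim w.proj⟩
    exact ⟨fun x ↦ hB.elim x, measurable_of_empty _, measurable_of_empty _⟩
  let e := trivializationAt (EuclideanSpace ℝ (Fin n)) V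
  obtain ⟨s, hsc, hs⟩ := countable_cover_nhds_of_sigmaCompact fun x : B ↦
    (e x).open_baseSet.mem_nhds (FiberBundle.mem_baseSet_trivializationAt' x)
  have hsne : s.Nonempty := by
    by_contra h
    rw [not_nonempty_iff_eq_empty] at h
    simp only [h, mem_empty_iff_false, iUnion_of_empty, iUnion_empty] at hs
    exact empty_ne_univ hs
  obtain ⟨u, rfl⟩ := hsc.exists_eq_range hsne
  have hcov : ∀ x, ∃ j, x ∈ (e (u j)).baseSet := fun x ↦ by
    have := hs.symm ▸ mem_univ x
    simpa using this
  classical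
  let k : B → ℕ := fun x ↦ Nat.find (hcov x)
  have hk : ∀ x, x ∈ (e (u (k x))).baseSet := fun x ↦ Nat.find_spec (hcov x)
  have hkm : Measurable k := measurable_find _ fun j ↦ (e (u j)).open_baseSet.measurableSet
  choose g σ hg hσ hgσ using exists_local_orthonormal_frame (n := n) (V := V)
  have hspan : ∀ x, (⊤ : Submodule ℝ (V x)) ≤
      Submodule.span ℝ (range fun i ↦ g (u (k x)) i x) := by
    intro x
    let L := ((e (u (k x))).continuousLinearEquivAt ℝ x (hk x)).toLinearEquiv
    have : FiniteDimensional ℝ (V x) := L.symm.finiteDimensional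
    refine (LinearIndependent.span_eq_top_of_card_eq_finrank'
      (hg (u (k x)) x (hk x)).linearIndependent ?_).ge
    rw [L.finrank_eq, finrank_euclideanSpace]
  let b : ∀ x, OrthonormalBasis (Fin n) ℝ (V x) := fun x ↦
    OrthonormalBasis.mk (hg (u (k x)) x (hk x)) (hspan x)
  have hb : ∀ x i, b x i = g (u (k x)) i x := fun x i ↦ by
    simp only [b, OrthonormalBasis.coe_mk]
  have hgc : ∀ j i, ContinuousOn (fun x ↦ (⟨x, g (u j) i x⟩ :
      TotalSpace (EuclideanSpace ℝ (Fin n)) V)) (e (u j)).baseSet := fun j i ↦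
    (continuousOn_trivialization_symm (u j) (hσ (u j) i)).congr fun x hx ↦ by
      simp only [hgσ (u j) i x hx]
  have hproj : Continuous fun w : TotalSpace (EuclideanSpace ℝ (Fin n)) V ↦ w.proj :=
    FiberBundle.continuous_proj _ _
  refine ⟨b, ?_, ?_⟩
  · have h1 : ∀ i, Measurable fun w : TotalSpace (EuclideanSpace ℝ (Fin n)) V ↦
        (b w.proj).repr w.2 i := by
      intro i
      let Φ : ℕ × TotalSpace (EuclideanSpace ℝ (Fin n)) V → ℝ := fun q ↦
        (TotalSpace.proj ⁻¹' (e (u q.1)).baseSet).piecewise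
          (fun w ↦ inner ℝ (g (u q.1) i w.proj) w.2) (fun _ ↦ 0) q.2
      have hΦ : Measurable Φ := by
        refine measurable_from_prod_countable_right fun j ↦ ?_
        refine ContinuousOn.measurable_piecewise ?_ continuousOn_const
          ((e (u j)).open_baseSet.preimage hproj).measurableSet
        exact ContinuousOn.inner_bundle ((hgc j i).comp hproj.continuousOn fun w hw ↦ hw)
          continuousOn_id
      have h2 := hΦ.comp ((hkm.comp hproj.measurable).prodMk measurable_id)
      convert h2 using 1
      ext w
      have hw : w ∈ TotalSpace.proj ⁻¹' (e (u (k w.proj))).baseSet := hk w.proj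
      simp only [Φ, comp_apply, id_eq, piecewise_eq_of_mem _ _ _ hw,
        OrthonormalBasis.repr_apply_apply, hb]
    exact (WithLp.measurable_toLp 2 (Fin n → ℝ)).comp (measurable_pi_lambda _ h1)
  · let Ψ : ℕ × (B × EuclideanSpace ℝ (Fin n)) → TotalSpace (EuclideanSpace ℝ (Fin n)) V :=
      fun q ↦ (Prod.fst ⁻¹' (e (u q.1)).baseSet).piecewise
        (fun p ↦ ⟨p.1, (e (u q.1)).symm p.1 (∑ i, p.2 i • σ (u q.1) i p.1)⟩)
        (fun p ↦ zeroSection (EuclideanSpace ℝ (Fin n)) V p.1) q.2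
    have hΨ : Measurable Ψ := by
      refine measurable_from_prod_countable_right fun j ↦ ?_
      refine ContinuousOn.measurable_piecewise ?_
        ((Bundle.Trivialization.continuous_zeroSection ℝ).comp continuous_fst).continuousOn
        ((e (u j)).open_baseSet.preimage continuous_fst).measurableSet
      refine ContinuousOn.comp (f := fun p : B × EuclideanSpace ℝ (Fin n) ↦
        (p.1, ∑ i, p.2 i • σ (u j) i p.1)) (e (u j)).continuousOn_symm
        (continuousOn_fst.prodMk ?_) fun p hp ↦ ⟨hp, mem_univ _⟩
      refine continuousOn_finsetSum _ fun i _ ↦ ContinuousOn.fun_smul ?_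
        ((hσ (u j) i).comp continuousOn_fst fun p hp ↦ hp)
      exact (Continuous.comp (by fun_prop : Continuous fun a : EuclideanSpace ℝ (Fin n) ↦ a i)
        continuous_snd).continuousOn
    have h2 := hΨ.comp ((hkm.comp measurable_fst).prodMk measurable_id)
    convert h2 using 1
    ext1 q
    have hq : q ∈ Prod.fst ⁻¹' (e (u (k q.1))).baseSet := hk q.1
    simp only [Ψ, comp_apply, id_eq, piecewise_eq_of_mem _ _ _ hq]
    congr 1
    rw [← OrthonormalBasis.sum_repr_symm, ← (e (u (k q.1))).symmL_apply (R := ℝ) (hk q.1), map_sum]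
    refine Finset.sum_congr rfl fun i _ ↦ ?_
    rw [map_smul, (e (u (k q.1))).symmL_apply (R := ℝ) (hk q.1), hb, hgσ _ _ _ (hk q.1)]

end Frame

section SpaceTimeDerivative

variable {n : ℕ} {M : Type*} [TopologicalSpace M]
  [ChartedSpace (EuclideanSpace ℝ (Fin n)) M] [IsManifold (𝓡 n) ∞ M]

theorem continuous_mfderiv_prod {φ : M × ℝ → ℝ}
    (hφ : ContMDiff ((𝓡 n).prod 𝓘(ℝ, ℝ)) 𝓘(ℝ, ℝ) 1 φ) :
    Continuous fun q : TangentBundle (𝓡 n) M × (ℝ × ℝ) ↦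
      (mfderiv ((𝓡 n).prod 𝓘(ℝ, ℝ)) 𝓘(ℝ, ℝ) φ (q.1.proj, q.2.1) (q.1.2, q.2.2) : ℝ) := by
  have h1 : Continuous fun q : TangentBundle (𝓡 n) M × (ℝ × ℝ) ↦
      (equivTangentBundleProd (𝓡 n) M 𝓘(ℝ, ℝ) ℝ).symm
        (q.1, (tangentBundleModelSpaceHomeomorph 𝓘(ℝ, ℝ)).symm q.2) :=
    (contMDiff_equivTangentBundleProd_symm (n := 0)).continuous.comp
      (continuous_fst.prodMk ((Homeomorph.continuous _).comp continuous_snd))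
  have h2 := (hφ.continuous_tangentMap le_rfl).comp h1
  exact continuous_snd.comp ((tangentBundleModelSpaceHomeomorph 𝓘(ℝ, ℝ)).continuous.comp h2)

theorem spaceDeriv_eq {φ : M × ℝ → ℝ}
    (hφ : ContMDiff ((𝓡 n).prod 𝓘(ℝ, ℝ)) 𝓘(ℝ, ℝ) 1 φ) (t : ℝ) (x : M)
    (w : TangentSpace (𝓡 n) x) : spaceDeriv φ t x w =
      mfderiv ((𝓡 n).prod 𝓘(ℝ, ℝ)) 𝓘(ℝ, ℝ) φ (x, t) (w, 0) := by
  have h := mfderiv_comp (I := 𝓡 n) (I' := (𝓡 n).prod 𝓘(ℝ, ℝ)) (I'' := 𝓘(ℝ, ℝ)) (g := φ)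
    (f := fun y : M ↦ (y, t)) x (hφ.mdifferentiableAt one_ne_zero)
    (mdifferentiableAt_id.prodMk mdifferentiableAt_const)
  rw [mfderiv_prod_left] at h
  exact congrArg (fun L ↦ L w) h

theorem hasDerivAt_time {φ : M × ℝ → ℝ}
    (hφ : ContMDiff ((𝓡 n).prod 𝓘(ℝ, ℝ)) 𝓘(ℝ, ℝ) 1 φ) (t : ℝ) (x : M) :
    HasDerivAt (fun s ↦ φ (x, s)) 
      (mfderiv ((𝓡 n).prod 𝓘(ℝ, ℝ)) 𝓘(ℝ, ℝ) φ (x, t) (0, (1 : ℝ)) : ℝ) t := by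
  have h := mfderiv_comp (I := 𝓘(ℝ, ℝ)) (I' := (𝓡 n).prod 𝓘(ℝ, ℝ)) (I'' := 𝓘(ℝ, ℝ)) (g := φ)
    (f := fun s : ℝ ↦ (x, s)) t (hφ.mdifferentiableAt one_ne_zero)
    (mdifferentiableAt_const.prodMk mdifferentiableAt_id)
  rw [mfderiv_prod_right] at h
  have h2 : DifferentiableAt ℝ (fun s ↦ φ (x, s)) t := 
    ((hφ.mdifferentiableAt one_ne_zero).comp t 
      (mdifferentiableAt_const.prodMk mdifferentiableAt_id)).differentiableAt
  have h3 := h2.hasDerivAt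
  have h4 : deriv (fun s ↦ φ (x, s)) t = 
      (mfderiv ((𝓡 n).prod 𝓘(ℝ, ℝ)) 𝓘(ℝ, ℝ) φ (x, t) (0, (1 : ℝ)) : ℝ) := by
    rw [← fderiv_apply_one_eq_deriv, ← mfderiv_eq_fderiv]
    exact congrArg (fun L ↦ L (1 : ℝ)) h
  rwa [h4] at h3
end SpaceTimeDerivative

section InnerProduct

variable {n : ℕ} {V : Type*} [NormedAddCommGroup V] [InnerProductSpace ℝ V]

theorem sum_mul_eq_of_orthonormal (b : OrthonormalBasis (Fin n) ℝ V) {g : Fin n → V}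
    (hg : Orthonormal ℝ g) (L L' : V →L[ℝ] ℝ) :
    ∑ i, L (b i) * L' (b i) = ∑ i, L (g i) * L' (g i) := by
  have : FiniteDimensional ℝ V := b.toBasis.finiteDimensional_of_finite
  have : CompleteSpace V := FiniteDimensional.complete ℝ V
  have hspan : (⊤ : Submodule ℝ V) ≤ Submodule.span ℝ (range g) :=
    (hg.linearIndependent.span_eq_top_of_card_eq_finrank'
      (Module.finrank_eq_card_basis b.toBasis).symm).ge
  have key : ∀ c : OrthonormalBasis (Fin n) ℝ V, ∑ i, L (c i) * L' (c i) =
      inner ℝ ((InnerProductSpace.toDual ℝ V).symm L) ((InnerProductSpace.toDual ℝ V).symm L') := by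
    intro c
    rw [← c.sum_inner_mul_inner]
    refine Finset.sum_congr rfl fun i _ ↦ ?_
    rw [InnerProductSpace.toDual_symm_apply, real_inner_comm, InnerProductSpace.toDual_symm_apply]
  rw [key b, ← key (OrthonormalBasis.mk hg hspan), OrthonormalBasis.coe_mk]

end InnerProduct

/-- A measurable choice of orthonormal bases of the tangent spaces of `M`. -/
structure BorelFrame (n : ℕ) (M : Type*) [TopologicalSpace M]
    [ChartedSpace (EuclideanSpace ℝ (Fin n)) M] [IsManifold (𝓡 n) 1 M]
    [RiemannianBundle (fun x : M ↦ TangentSpace (𝓡 n) x)] [MeasurableSpace M] where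
  basis : ∀ x : M, OrthonormalBasis (Fin n) ℝ (TangentSpace (𝓡 n) x)
  measurable_repr : @Measurable (TangentBundle (𝓡 n) M) (EuclideanSpace ℝ (Fin n)) (borel _) _
    fun w ↦ (basis w.proj).repr w.2
  measurable_symm : @Measurable (M × EuclideanSpace ℝ (Fin n)) (TangentBundle (𝓡 n) M) _ (borel _)
    fun q ↦ ⟨q.1, (basis q.1).repr.symm q.2⟩

namespace BorelFrame

variable {n : ℕ} {M : Type*} [TopologicalSpace M]
  [ChartedSpace (EuclideanSpace ℝ (Fin n)) M] [IsManifold (𝓡 n) ∞ M]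
  [RiemannianBundle (fun x : M ↦ TangentSpace (𝓡 n) x)]
  [IsContMDiffRiemannianBundle (𝓡 n) ∞ (EuclideanSpace ℝ (Fin n))
    (fun x : M ↦ TangentSpace (𝓡 n) x)]
  [MeasurableSpace M] [BorelSpace M]

theorem isContinuousRiemannianBundle : IsContinuousRiemannianBundle (EuclideanSpace ℝ (Fin n))
    (fun x : M ↦ TangentSpace (𝓡 n) x) := by
  obtain ⟨g, hg, h⟩ := IsContMDiffRiemannianBundle.exists_contMDiff (IB := 𝓡 n) (n := ∞)
    (F := EuclideanSpace ℝ (Fin n)) (E := fun x : M ↦ TangentSpace (𝓡 n) x)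
  exact ⟨g, hg.continuous, h⟩

theorem nonempty [SigmaCompactSpace M] : Nonempty (BorelFrame n M) := by
  have := isContinuousRiemannianBundle (n := n) (M := M)
  obtain ⟨b, h1, h2⟩ := exists_borel_orthonormal_frame (n := n)
    (V := fun x : M ↦ TangentSpace (𝓡 n) x)
  exact ⟨⟨b, h1, h2⟩⟩

/-- The gradient in space of a function on `M × ℝ`, in the coordinates of the frame. -/
def gradient (b : BorelFrame n M) (φ : M × ℝ → ℝ) (t : ℝ) (x : M) : EuclideanSpace ℝ (Fin n) :=
  WithLp.toLp 2 fun i ↦ spaceDeriv φ t x (b.basis x i)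

theorem inner_gradient (b : BorelFrame n M) (φ : M × ℝ → ℝ) (t : ℝ) (x : M)
    (v : TangentSpace (𝓡 n) x) :
    inner ℝ (b.gradient φ t x) ((b.basis x).repr v) = spaceDeriv φ t x v := by
  conv_rhs => rw [← (b.basis x).sum_repr v]
  unfold spaceDeriv
  rw [map_sum, PiLp.inner_apply]
  refine Finset.sum_congr rfl fun i _ ↦ ?_
  rw [map_smul]
  rfl

theorem measurable_gradient (b : BorelFrame n M) {φ : M × ℝ → ℝ}
    (hφ : ContMDiff ((𝓡 n).prod 𝓘(ℝ, ℝ)) 𝓘(ℝ, ℝ) 1 φ) :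
    Measurable fun q : ℝ × M ↦ b.gradient φ q.1 q.2 := by
  let _ : MeasurableSpace (TangentBundle (𝓡 n) M) := borel _
  have : BorelSpace (TangentBundle (𝓡 n) M) := ⟨rfl⟩
  refine (WithLp.measurable_toLp 2 (Fin n → ℝ)).comp (measurable_pi_lambda _ fun i ↦ ?_)
  simp_rw [spaceDeriv_eq hφ]
  have h1 : Measurable fun x : M ↦ (⟨x, b.basis x i⟩ : TangentBundle (𝓡 n) M) := by
    have h := b.measurable_symm.comp
      (measurable_id.prodMk (measurable_const (a := EuclideanSpace.single i (1 : ℝ))))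
    convert h using 2 with x
    simp
  exact (continuous_mfderiv_prod hφ).measurable.comp
    ((h1.comp measurable_snd).prodMk (measurable_fst.prodMk measurable_const))

theorem continuous_gradient_apply (b : BorelFrame n M) {φ : M × ℝ → ℝ}
    (hφ : ContMDiff ((𝓡 n).prod 𝓘(ℝ, ℝ)) 𝓘(ℝ, ℝ) 1 φ) (x : M) :
    Continuous fun t : ℝ ↦ b.gradient φ t x := by
  refine (PiLp.continuous_toLp 2 _).comp (continuous_pi fun i ↦ ?_)
  simp_rw [spaceDeriv_eq hφ]
  exact (continuous_mfderiv_prod hφ).comp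
    ((continuous_const (y := (⟨x, b.basis x i⟩ : TangentBundle (𝓡 n) M))).prodMk
      (continuous_id.prodMk continuous_const))

theorem continuous_inner_gradient (b : BorelFrame n M) {φ ψ : M × ℝ → ℝ}
    (hφ : ContMDiff ((𝓡 n).prod 𝓘(ℝ, ℝ)) 𝓘(ℝ, ℝ) 1 φ)
    (hψ : ContMDiff ((𝓡 n).prod 𝓘(ℝ, ℝ)) 𝓘(ℝ, ℝ) 1 ψ) :
    Continuous fun q : M × ℝ ↦ inner ℝ (b.gradient φ q.2 q.1) (b.gradient ψ q.2 q.1) := by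
  rw [continuous_iff_continuousAt]
  rintro ⟨x₀, t₀⟩
  have := isContinuousRiemannianBundle (n := n) (M := M)
  obtain ⟨g, σ, hg, hσ, hgσ⟩ := exists_local_orthonormal_frame (n := n)
    (V := fun x : M ↦ TangentSpace (𝓡 n) x) x₀
  set e := trivializationAt (EuclideanSpace ℝ (Fin n)) (fun x : M ↦ TangentSpace (𝓡 n) x) x₀
  have hU : Prod.fst ⁻¹' e.baseSet ∈ 𝓝 (x₀, t₀) :=
    (e.open_baseSet.preimage continuous_fst).mem_nhds
      (show x₀ ∈ e.baseSet from FiberBundle.mem_baseSet_trivializationAt' x₀)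
  have hsec : ∀ {χ : M × ℝ → ℝ}, ContMDiff ((𝓡 n).prod 𝓘(ℝ, ℝ)) 𝓘(ℝ, ℝ) 1 χ → ∀ i,
      ContinuousOn (fun q : M × ℝ ↦ spaceDeriv χ q.2 q.1 (g i q.1)) (Prod.fst ⁻¹' e.baseSet) := by
    intro χ hχ i
    have h1 : ContinuousOn (fun x ↦ (⟨x, g i x⟩ : TangentBundle (𝓡 n) M)) e.baseSet :=
      (continuousOn_trivialization_symm x₀ (hσ i)).congr fun x hx ↦ by
        simp only [hgσ i x hx, e]
    simp_rw [spaceDeriv_eq hχ]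
    exact (continuous_mfderiv_prod hχ).comp_continuousOn
      ((h1.comp continuousOn_fst fun q hq ↦ hq).prodMk
        (continuousOn_snd.prodMk continuousOn_const))
  have h : ContinuousOn (fun q : M × ℝ ↦ ∑ i, spaceDeriv φ q.2 q.1 (g i q.1) *
      spaceDeriv ψ q.2 q.1 (g i q.1)) (Prod.fst ⁻¹' e.baseSet) :=
    continuousOn_finsetSum _ fun i _ ↦ (hsec hφ i).fun_mul (hsec hψ i)
  refine (h.continuousAt hU).congr ?_
  filter_upwards [hU] with q hq
  have h2 := sum_mul_eq_of_orthonormal (b.basis q.1) (hg q.1 hq)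
    (mfderiv (𝓡 n) 𝓘(ℝ, ℝ) (fun y : M ↦ φ (y, q.2)) q.1)
    (mfderiv (𝓡 n) 𝓘(ℝ, ℝ) (fun y : M ↦ ψ (y, q.2)) q.1)
  refine Eq.trans h2.symm ?_
  rw [PiLp.inner_apply]
  refine Finset.sum_congr rfl fun i _ ↦ ?_
  exact mul_comm _ _

end BorelFrame

section WeakDerivative

theorem hasCompactSupport_deriv_smoothTransition :
    HasCompactSupport (deriv Real.smoothTransition) := by
  refine HasCompactSupport.intro (isCompact_Icc (a := (0 : ℝ)) (b := 1)) fun x hx ↦ ?_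
  rw [mem_Icc, not_and_or, not_le, not_le] at hx
  rcases hx with hx | hx
  · have : Real.smoothTransition =ᶠ[𝓝 x] fun _ ↦ 0 := by
      filter_upwards [Iio_mem_nhds hx] with y hy
      exact Real.smoothTransition.zero_of_nonpos (le_of_lt hy)
    rw [this.deriv_eq, deriv_const]
  · have : Real.smoothTransition =ᶠ[𝓝 x] fun _ ↦ 1 := by
      filter_upwards [Ioi_mem_nhds hx] with y hy
      exact Real.smoothTransition.one_of_one_le (le_of_lt hy)
    rw [this.deriv_eq, deriv_const]

theorem continuous_deriv_smoothTransition : Continuous (deriv Real.smoothTransition) :=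
  (Real.smoothTransition.contDiff (n := 1)).continuous_deriv le_rfl

theorem hasDerivAt_smoothTransition (x : ℝ) :
    HasDerivAt Real.smoothTransition (deriv Real.smoothTransition x) x :=
  ((Real.smoothTransition.contDiff (n := 1)).differentiable one_ne_zero x).hasDerivAt

theorem integrable_deriv_smoothTransition : Integrable (deriv Real.smoothTransition) :=
  continuous_deriv_smoothTransition.integrable_of_hasCompactSupport
    hasCompactSupport_deriv_smoothTransition

theorem integral_deriv_smoothTransition : ∫ x, deriv Real.smoothTransition x = 1 := by
  rw [integral_of_hasDerivAt_of_tendsto (m := 0) (n := 1) hasDerivAt_smoothTransition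
    integrable_deriv_smoothTransition, sub_zero]
  · refine tendsto_const_nhds.congr' ?_
    filter_upwards [eventually_le_atBot (0 : ℝ)] with x hx
    exact (Real.smoothTransition.zero_of_nonpos hx).symm
  · refine tendsto_const_nhds.congr' ?_
    filter_upwards [eventually_ge_atTop (1 : ℝ)] with x hx
    exact (Real.smoothTransition.one_of_one_le hx).symm

variable {m g : ℝ → ℝ} {C T : ℝ}

theorem tendsto_integral_deriv_smoothTransition (hm : Continuous m) (hC : ∀ t, |m t| ≤ C) (s : ℝ) :
    Tendsto (fun k : ℕ ↦ ∫ r, ((k : ℝ) + 1) * deriv Real.smoothTransition (((k : ℝ) + 1) * (r - s))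
      * m r) atTop (𝓝 (m s)) := by
  have h1 : ∀ k : ℕ, ∫ r, ((k : ℝ) + 1) * deriv Real.smoothTransition (((k : ℝ) + 1) * (r - s))
      * m r = ∫ u, deriv Real.smoothTransition u * m (s + u / ((k : ℝ) + 1)) := by
    intro k
    have hk : (0 : ℝ) < (k : ℝ) + 1 := by positivity
    have e1 := Measure.integral_comp_mul_left
      (fun u ↦ deriv Real.smoothTransition u * m (s + u / ((k : ℝ) + 1))) ((k : ℝ) + 1)
    have e2 := integral_sub_right_eq_self (μ := volume) (fun x ↦ deriv Real.smoothTransition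
      (((k : ℝ) + 1) * x) * m (s + ((k : ℝ) + 1) * x / ((k : ℝ) + 1))) s
    rw [e1, abs_of_pos (inv_pos.2 hk), smul_eq_mul] at e2
    rw [← mul_right_inj' (inv_pos.2 hk).ne', ← e2, ← integral_const_mul]
    refine integral_congr_ae (.of_forall fun r ↦ ?_)
    simp only [mul_div_cancel_left₀ _ hk.ne', add_sub_cancel]
    field_simp
  simp_rw [h1]
  have h2 : m s = ∫ u, deriv Real.smoothTransition u * m s := by
    rw [integral_mul_const, integral_deriv_smoothTransition, one_mul]
  rw [h2]
  refine tendsto_integral_of_dominated_convergence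
    (fun u ↦ |deriv Real.smoothTransition u| * C) (fun k ↦ ?_)
    (integrable_deriv_smoothTransition.abs.mul_const C) (fun k ↦ ?_) ?_
  · exact (continuous_deriv_smoothTransition.mul (hm.comp (by fun_prop))).aestronglyMeasurable
  · refine .of_forall fun u ↦ ?_
    rw [Real.norm_eq_abs, abs_mul]
    exact mul_le_mul_of_nonneg_left (hC _) (abs_nonneg _)
  · refine .of_forall fun u ↦ tendsto_const_nhds.mul ?_
    have h3 : Tendsto (fun k : ℕ ↦ s + u / ((k : ℝ) + 1)) atTop (𝓝 (s + 0)) :=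
      tendsto_const_nhds.add (tendsto_const_nhds.div_atTop
        (tendsto_atTop_add_const_right _ _ tendsto_natCast_atTop_atTop))
    rw [add_zero] at h3
    exact (hm.tendsto s).comp h3

theorem tendsto_smoothTransition (s r : ℝ) :
    Tendsto (fun k : ℕ ↦ Real.smoothTransition (((k : ℝ) + 1) * (r - s))) atTop
      (𝓝 ((Ioi s).indicator 1 r)) := by
  by_cases h : s < r
  · rw [indicator_of_mem (mem_Ioi.2 h), Pi.one_apply]
    refine tendsto_const_nhds.congr' ?_
    have h1 : Tendsto (fun k : ℕ ↦ ((k : ℝ) + 1) * (r - s)) atTop atTop :=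
      (tendsto_atTop_add_const_right _ _ tendsto_natCast_atTop_atTop).atTop_mul_const
        (sub_pos.2 h)
    filter_upwards [h1.eventually_ge_atTop 1] with k hk
    exact (Real.smoothTransition.one_of_one_le hk).symm
  · rw [indicator_of_notMem (by simpa using h)]
    refine tendsto_const_nhds.congr fun k ↦ ?_
    exact (Real.smoothTransition.zero_of_nonpos (mul_nonpos_of_nonneg_of_nonpos (by positivity)
      (by linarith))).symm

/-- A continuous function with integrable weak derivative `g` is a primitive of `g`. -/
theorem sub_eq_integral_of_weakDeriv (hm : Continuous m) (hC : ∀ t, |m t| ≤ C)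
    (hg : Integrable g)
    (h : ∀ η : ℝ → ℝ, ContDiff ℝ 1 η → HasCompactSupport η → tsupport η ⊆ Ioo 0 T →
      ∫ t, (deriv η t * m t + η t * g t) = 0)
    {s t : ℝ} (hs : 0 < s) (hst : s ≤ t) (ht : t < T) :
    m t - m s = ∫ r in s..t, g r := by
  let θ : ℕ → ℝ → ℝ → ℝ := fun k a r ↦ Real.smoothTransition (((k : ℝ) + 1) * (r - a))
  let θ' : ℕ → ℝ → ℝ → ℝ := fun k a r ↦
    ((k : ℝ) + 1) * deriv Real.smoothTransition (((k : ℝ) + 1) * (r - a))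
  have hθ : ∀ k a r, HasDerivAt (θ k a) (θ' k a r) r := by
    intro k a r
    have := (hasDerivAt_smoothTransition (((k : ℝ) + 1) * (r - a))).comp r
      (((hasDerivAt_id r).sub_const a).const_mul ((k : ℝ) + 1))
    rw [mul_one, mul_comm] at this
    exact this
  have hθi : ∀ k a, Integrable fun r ↦ θ' k a r * m r := by
    intro k a
    refine Integrable.mul_bdd (c := C) ?_ hm.aestronglyMeasurable
      (.of_forall fun r ↦ (Real.norm_eq_abs _).trans_le (hC r))
    have h1 := (integrable_deriv_smoothTransition.comp_mul_left' (R := (k : ℝ) + 1)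
      (by positivity)).comp_sub_right a
    exact h1.const_mul _
  have hηb : ∀ k r, |θ k s r - θ k t r| ≤ 1 := by
    intro k r
    have := Real.smoothTransition.nonneg (((k : ℝ) + 1) * (r - s))
    have := Real.smoothTransition.nonneg (((k : ℝ) + 1) * (r - t))
    have := Real.smoothTransition.le_one (((k : ℝ) + 1) * (r - s))
    have := Real.smoothTransition.le_one (((k : ℝ) + 1) * (r - t))
    rw [abs_le]
    constructor <;> simp only [θ] <;> linarith
  have hηc : ∀ k, ContDiff ℝ 1 fun r ↦ θ k s r - θ k t r := fun k ↦
    (Real.smoothTransition.contDiff.comp (by fun_prop)).sub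
      (Real.smoothTransition.contDiff.comp (by fun_prop))
  have key : ∀ᶠ k : ℕ in atTop, (∫ r, θ' k s r * m r) - (∫ r, θ' k t r * m r) +
      ∫ r, (θ k s r - θ k t r) * g r = 0 := by
    have h1 : Tendsto (fun k : ℕ ↦ t + 1 / ((k : ℝ) + 1)) atTop (𝓝 (t + 0)) :=
      tendsto_const_nhds.add tendsto_one_div_add_atTop_nhds_zero_nat
    rw [add_zero] at h1
    filter_upwards [h1.eventually_lt_const ht] with k hk
    have hk0 : (0 : ℝ) < (k : ℝ) + 1 := by positivity
    have hsupp : ∀ r ∉ Icc s (t + 1 / ((k : ℝ) + 1)), θ k s r - θ k t r = 0 := by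
      intro r hr
      rw [mem_Icc, not_and_or, not_le, not_le] at hr
      rcases hr with hr | hr
      · simp only [θ]
        rw [Real.smoothTransition.zero_of_nonpos, Real.smoothTransition.zero_of_nonpos, sub_zero]
        · exact mul_nonpos_of_nonneg_of_nonpos hk0.le (by linarith)
        · exact mul_nonpos_of_nonneg_of_nonpos hk0.le (by linarith)
      · have h2 : 1 ≤ ((k : ℝ) + 1) * (r - t) := by
          have : 1 / ((k : ℝ) + 1) ≤ r - t := by linarith
          rwa [div_le_iff₀' hk0] at this
        simp only [θ]
        rw [Real.smoothTransition.one_of_one_le h2, Real.smoothTransition.one_of_one_le, sub_self]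
        refine h2.trans (mul_le_mul_of_nonneg_left (by linarith) hk0.le)
    have h3 := h _ (hηc k) (HasCompactSupport.intro isCompact_Icc hsupp)
      ((closure_minimal (s := support fun r ↦ θ k s r - θ k t r)
        (fun r hr ↦ by_contra fun hr' ↦ hr (hsupp r hr')) isClosed_Icc).trans
        (Icc_subset_Ioo hs hk))
    rw [← h3, ← integral_sub (hθi k s) (hθi k t),
      ← integral_add (f := fun r ↦ θ' k s r * m r - θ' k t r * m r) ((hθi k s).sub (hθi k t))]
    · refine integral_congr_ae (.of_forall fun r ↦ ?_)
      simp only [((hθ k s r).fun_sub (hθ k t r)).deriv]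
      ring
    · exact hg.bdd_mul (c := 1) (hηc k).continuous.aestronglyMeasurable
        (.of_forall fun r ↦ (Real.norm_eq_abs _).trans_le (hηb k r))
  have hlim : Tendsto (fun k : ℕ ↦ ∫ r, (θ k s r - θ k t r) * g r) atTop
      (𝓝 (∫ r, ((Ioi s).indicator 1 r - (Ioi t).indicator 1 r) * g r)) := by
    refine tendsto_integral_of_dominated_convergence (fun r ↦ |g r|) (fun k ↦ ?_) hg.abs
      (fun k ↦ .of_forall fun r ↦ ?_) (.of_forall fun r ↦ ?_)
    · exact (hηc k).continuous.aestronglyMeasurable.mul hg.1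
    · rw [Real.norm_eq_abs, abs_mul]
      exact mul_le_of_le_one_left (abs_nonneg _) (hηb k r)
    · exact ((tendsto_smoothTransition s r).sub (tendsto_smoothTransition t r)).mul_const _
  have hlim2 := ((tendsto_integral_deriv_smoothTransition hm hC s).sub
    (tendsto_integral_deriv_smoothTransition hm hC t)).add hlim
  have h0 := tendsto_nhds_unique (hlim2.congr' key) tendsto_const_nhds
  have h4 : ∫ r, ((Ioi s).indicator 1 r - (Ioi t).indicator 1 r) * g r = ∫ r in s..t, g r := by
    rw [intervalIntegral.integral_of_le hst, ← integral_indicator measurableSet_Ioc]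
    refine integral_congr_ae (.of_forall fun r ↦ ?_)
    simp only [indicator, mem_Ioi, mem_Ioc, Pi.one_apply]
    by_cases h5 : s < r <;> by_cases h6 : t < r
    · simp [h5, h6]
    · simp [h5, h6, not_lt.1 h6]
    · exact absurd (hst.trans_lt h6) h5
    · simp [h5, h6]
  rw [h4] at h0
  linarith

theorem sub_eq_integral_of_weakDeriv_of_clamp (hT : 0 < T) (hm : Continuous m)
    (hmT : ∀ t, m t = m (max 0 (min t T))) (hg : Integrable g) (hgT : ∀ t ∉ Ioo 0 T, g t = 0)
    (h : ∀ η : ℝ → ℝ, ContDiff ℝ 1 η → HasCompactSupport η → tsupport η ⊆ Ioo 0 T →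
      ∫ t, (deriv η t * m t + η t * g t) = 0) (s t : ℝ) :
    m t - m s = ∫ r in s..t, g r := by
  have hmem : ∀ t, max 0 (min t T) ∈ Icc 0 T := fun t ↦
    ⟨le_max_left _ _, max_le hT.le (min_le_right _ _)⟩
  obtain ⟨C, hC⟩ : ∃ C, ∀ t, |m t| ≤ C := by
    obtain ⟨C, hC⟩ := (isCompact_Icc (a := (0 : ℝ)) (b := T)).exists_bound_of_continuousOn
      hm.continuousOn
    exact ⟨C, fun t ↦ by rw [hmT t]; exact hC _ (hmem t)⟩
  let Φ : ℝ → ℝ := fun t ↦ m t - ∫ r in 0..t, g r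
  have hΦ : Continuous Φ := hm.sub (intervalIntegral.continuous_primitive
    (fun _ _ ↦ hg.intervalIntegrable) 0)
  have hsub : ∀ s t, Φ t - Φ s = m t - m s - ∫ r in s..t, g r := fun s t ↦ by
    rw [← intervalIntegral.integral_interval_sub_left (a := 0) hg.intervalIntegrable
      hg.intervalIntegrable]
    simp only [Φ]
    ring
  have h1 : ∀ t ∈ Ioo 0 T, Φ t = Φ (T / 2) := by
    intro t ht
    have hT2 : T / 2 ∈ Ioo 0 T := ⟨by linarith, by linarith⟩
    rcases le_total t (T / 2) with hle | hle
    · have := hsub t (T / 2)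
      rw [sub_eq_integral_of_weakDeriv hm hC hg h ht.1 hle hT2.2, sub_self] at this
      linarith
    · have := hsub (T / 2) t
      rw [sub_eq_integral_of_weakDeriv hm hC hg h hT2.1 hle ht.2, sub_self] at this
      linarith
  have h2 : ∀ t ∈ Icc 0 T, Φ t = Φ (T / 2) := by
    intro t ht
    rw [← closure_Ioo hT.ne] at ht
    exact closure_minimal (fun r hr ↦ h1 r hr) (isClosed_eq hΦ continuous_const) ht
  have h3 : ∀ t, Φ t = Φ (T / 2) := by
    intro t
    rw [← h2 _ (hmem t), ← sub_eq_zero, hsub, ← hmT t, sub_self, zero_sub, neg_eq_zero]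
    refine intervalIntegral.integral_zero_ae (.of_forall fun r hr ↦ hgT r fun hr' ↦ ?_)
    rw [mem_uIoc] at hr
    rcases hr with hr | hr
    · have h4 := max_lt_iff.1 hr.1
      rcases min_lt_iff.1 h4.2 with h5 | h5
      · rcases le_total t T with h6 | h6
        · rw [min_eq_left h6] at hr
          have := (le_max_right 0 t).trans_lt hr.1
          linarith [hr.2]
        · rw [min_eq_right h6] at h4
          linarith [h4.2, hr'.2]
      · linarith [hr'.2]
    · rcases le_max_iff.1 hr.2 with h5 | h5
      · linarith [hr'.1]
      · linarith [hr.1, min_le_left t T]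
  have := hsub s t
  rw [h3 s, h3 t] at this
  linarith

end WeakDerivative

section TimeDependent

variable {ι X E : Type*} [TopologicalSpace X] [CompactSpace X] [MeasurableSpace X] [BorelSpace X]
  [TopologicalSpace.MetrizableSpace X]
  [NormedAddCommGroup E] [InnerProductSpace ℝ E] [MeasurableSpace E] [FiniteDimensional ℝ E]
  [BorelSpace E]
  {G : GradientFamily ι X E} {μ : ℝ → ProbabilityMeasure X} {c : ℝ → X → E}
  {φ ψ : ℝ → X → ℝ} {idx : ℝ → ι} {B C T : ℝ}

/-- The largest multiple of `h` below `r`. -/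
def floorStep (h r : ℝ) : ℝ := h * ⌊r / h⌋

theorem measurable_floorStep (h : ℝ) : Measurable (floorStep h) :=
  ((measurable_from_top (f := fun k : ℤ ↦ (k : ℝ))).comp
    (Int.measurable_floor.comp (measurable_id.div_const h))).const_mul h

theorem abs_floorStep_sub_le {h : ℝ} (hh : 0 < h) (r : ℝ) : |floorStep h r - r| ≤ h := by
  have h1 := Int.floor_le (r / h)
  have h2 := Int.lt_floor_add_one (r / h)
  rw [le_div_iff₀' hh] at h1
  rw [div_lt_iff₀' hh] at h2
  unfold floorStep
  rw [abs_le]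
  constructor <;> linarith

theorem floorStep_eq {h : ℝ} (hh : 0 < h) {k : ℕ} {r : ℝ}
    (hr : r ∈ Ioo ((k : ℝ) * h) (((k + 1 : ℕ) : ℝ) * h)) : floorStep h r = (k : ℝ) * h := by
  have : ⌊r / h⌋ = (k : ℤ) := by
    rw [Int.floor_eq_iff]
    refine ⟨?_, ?_⟩
    · rw [le_div_iff₀ hh]
      exact_mod_cast hr.1.le
    · rw [div_lt_iff₀ hh]
      exact_mod_cast hr.2
  rw [floorStep, this, mul_comm]
  simp

theorem integral_sub_eq_integral_deriv (hderiv : ∀ x t, HasDerivAt (fun s ↦ φ s x) (ψ t x) t)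
    (hψ : Continuous (uncurry ψ)) (hC : ∀ t x, |ψ t x| ≤ C)
    (hφ : ∀ t, Continuous (φ t)) (ν : ProbabilityMeasure X) {a b : ℝ} :
    ∫ r in a..b, ∫ x, ψ r x ∂(ν : Measure X) =
      ∫ x, φ b x ∂(ν : Measure X) - ∫ x, φ a x ∂(ν : Measure X) := by
  have hint : ∀ t, Integrable (φ t) (ν : Measure X) := fun t ↦
    (hφ t).integrable_of_hasCompactSupport (HasCompactSupport.of_compactSpace _)
  have : SecondCountableTopology X := by
    let _ := TopologicalSpace.metrizableSpaceMetric X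
    infer_instance
  rw [intervalIntegral_integral_swap, ← integral_sub (hint b) (hint a)]
  · refine integral_congr_ae (.of_forall fun x ↦ ?_)
    refine intervalIntegral.integral_eq_sub_of_hasDerivAt (fun t _ ↦ hderiv x t) ?_
    exact (hψ.comp (continuous_id.prodMk continuous_const)).intervalIntegrable _ _
  · have : IsFiniteMeasure (volume.restrict (uIoc a b)) :=
      inferInstanceAs (IsFiniteMeasure (volume.restrict (Ioc _ _)))
    exact Integrable.of_bound hψ.measurable.aestronglyMeasurable C
      (.of_forall fun z ↦ (Real.norm_eq_abs _).trans_le (hC z.1 z.2))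

/-- A flow solves the weak formulation with a time-dependent test function. -/
theorem IsFlow.integral_eq_zero (hflow : IsFlow G μ c) (hT : 0 < T)
    (hc0 : ∀ t ∉ Ioo 0 T, ∀ x, c t x = 0) (hφ : ∀ t x, G.toFun (idx t) x = φ t x)
    (hderiv : ∀ x t, HasDerivAt (fun s ↦ φ s x) (ψ t x) t)
    (hψ : Continuous (uncurry ψ)) (hC : ∀ t x, |ψ t x| ≤ C)
    (hDm : Measurable (uncurry fun t x ↦ G.grad (idx t) x))
    (hDc : ∀ x, Continuous fun t ↦ G.grad (idx t) x) (hB : ∀ t x, ‖G.grad (idx t) x‖ ≤ B)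
    (hzero : ∀ t ∉ Ioo 0 T, ∀ x, φ t x = 0) :
    (∫ t in 0..T, ∫ x, ψ t x ∂(μ t : Measure X)) +
      ∫ t, ∫ x, inner ℝ (G.grad (idx t) x) (c t x) ∂(μ t : Measure X) = 0 := by
  let h : ℕ → ℝ := fun N ↦ T / ((N : ℝ) + 1)
  have hh : ∀ N, 0 < h N := fun N ↦ by positivity
  have hhlim : Tendsto h atTop (𝓝 0) := tendsto_const_nhds.div_atTop
    (tendsto_atTop_add_const_right _ _ tendsto_natCast_atTop_atTop)
  have hfl : ∀ r, Tendsto (fun N ↦ floorStep (h N) r) atTop (𝓝 r) := fun r ↦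
    tendsto_iff_norm_sub_tendsto_zero.2 (squeeze_zero (fun _ ↦ norm_nonneg _)
      (fun N ↦ abs_floorStep_sub_le (hh N) r) hhlim)
  have hφc : ∀ t, Continuous (φ t) := fun t ↦ by
    have : φ t = G.toFun (idx t) := funext fun x ↦ (hφ t x).symm
    rw [this]
    exact (G.toFun (idx t)).continuous
  let P : ℕ → ℝ → ℝ := fun N r ↦ ∫ x, ψ r x ∂(μ (floorStep (h N) r + h N) : Measure X)
  let Q : ℕ → ℝ → ℝ := fun N r ↦
    ∫ x, inner ℝ (G.grad (idx (floorStep (h N) r)) x) (c r x) ∂(μ r : Measure X)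
  have hpair : Continuous fun q : ℝ × ℝ ↦ ∫ x, ψ q.1 x ∂(μ q.2 : Measure X) :=
    Continuous.integral_probabilityMeasure (F := fun (q : ℝ × ℝ) x ↦ ψ q.1 x)
      (hψ.comp ((continuous_fst.comp continuous_fst).prodMk continuous_snd))
      (hflow.continuous.comp continuous_snd)
  have hPm : ∀ N, Measurable (P N) := fun N ↦ hpair.measurable.comp
    (measurable_id.prodMk ((measurable_floorStep (h N)).add_const _))
  have hPb : ∀ N r, ‖P N r‖ ≤ C := fun N r ↦ by
    refine (norm_integral_le_of_norm_le_const (C := C) (.of_forall fun x ↦ ?_)).trans_eq ?_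
    · exact (Real.norm_eq_abs _).trans_le (hC r x)
    · simp
  have hcn : Integrable (fun z : ℝ × X ↦ ‖c z.1 z.2‖) (spaceTime μ hflow.continuous) := by
    refine ⟨hflow.measurable.norm.aestronglyMeasurable, ?_⟩
    rw [hasFiniteIntegral_iff_enorm, lintegral_spaceTime (f := fun z ↦ ‖‖c z.1 z.2‖‖ₑ)
      hflow.continuous hflow.measurable.norm.enorm]
    simpa using hflow.lintegral_lt_top
  have hbound : ∀ t (z : ℝ × X), ‖(inner ℝ (G.grad (idx t) z.2) (c z.1 z.2) : ℝ)‖ ≤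
      B * ‖c z.1 z.2‖ := fun t z ↦ (norm_inner_le_norm _ _).trans
    (mul_le_mul_of_nonneg_right (hB _ _) (norm_nonneg _))
  have hm : ∀ {τ : ℝ → ℝ}, Measurable τ → AEStronglyMeasurable (fun z : ℝ × X ↦
      (inner ℝ (G.grad (idx (τ z.1)) z.2) (c z.1 z.2) : ℝ)) (spaceTime μ hflow.continuous) :=
    fun hτ ↦ ((hDm.comp ((hτ.comp measurable_fst).prodMk measurable_snd)).inner
      hflow.measurable).aestronglyMeasurable
  have hi : ∀ {τ : ℝ → ℝ}, Measurable τ → Integrable (fun z : ℝ × X ↦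
      (inner ℝ (G.grad (idx (τ z.1)) z.2) (c z.1 z.2) : ℝ)) (spaceTime μ hflow.continuous) :=
    fun hτ ↦ (hcn.const_mul B).mono' (hm hτ) (.of_forall fun z ↦ hbound _ z)
  have hQi : ∀ N, Integrable (Q N) := fun N ↦
    integrable_integral_curve hflow.continuous (hi (measurable_floorStep (h N)))
  have hsum : ∀ N, (∫ r in 0..T, P N r) + ∫ r, Q N r = 0 := by
    intro N
    have e1 : ∫ r, Q N r = ∫ r in 0..T, Q N r := by
      rw [intervalIntegral.integral_of_le hT.le, integral_Ioc_eq_integral_Ioo,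
        setIntegral_eq_integral_of_forall_compl_eq_zero]
      intro r hr
      simp [Q, hc0 r hr]
    have hPi : ∀ a b, IntervalIntegrable (P N) volume a b := fun a b ↦
      (intervalIntegrable_const (c := C)).mono_fun (hPm N).aestronglyMeasurable
        (.of_forall fun r ↦ (hPb N r).trans (le_abs_self C))
    have e2 : ∀ k : ℕ, ∫ r in ((k : ℝ) * h N)..(((k + 1 : ℕ) : ℝ) * h N), (P N r + Q N r) =
        (∫ x, φ (((k + 1 : ℕ) : ℝ) * h N) x ∂(μ (((k + 1 : ℕ) : ℝ) * h N) : Measure X)) -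
          ∫ x, φ ((k : ℝ) * h N) x ∂(μ ((k : ℝ) * h N) : Measure X) := by
      intro k
      have hle : (k : ℝ) * h N ≤ ((k + 1 : ℕ) : ℝ) * h N := by
        have := hh N
        push_cast
        nlinarith
      have hb : (k : ℝ) * h N + h N = ((k + 1 : ℕ) : ℝ) * h N := by push_cast; ring
      rw [intervalIntegral.integral_add (hPi _ _) ((hQi N).intervalIntegrable),
        intervalIntegral.integral_congr_Ioo_of_le hle (g := fun r ↦
          ∫ x, ψ r x ∂(μ (((k + 1 : ℕ) : ℝ) * h N) : Measure X)) fun r hr ↦ by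
            simp only [P, floorStep_eq (hh N) hr, hb],
        intervalIntegral.integral_congr_Ioo_of_le hle (f := Q N)
          (g := flux G μ c (idx ((k : ℝ) * h N))) fun r hr ↦ by
            simp only [Q, floorStep_eq (hh N) hr, flux],
        integral_sub_eq_integral_deriv hderiv hψ hC hφc, ← hflow.balance _ _ _ hle]
      simp only [hφ]
      ring
    rw [e1, ← intervalIntegral.integral_add (hPi _ _) ((hQi N).intervalIntegrable)]
    have e3 := intervalIntegral.sum_integral_adjacent_intervals (μ := volume)
      (f := fun r ↦ P N r + Q N r) (a := fun k : ℕ ↦ (k : ℝ) * h N) (n := N + 1)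
      fun k _ ↦ (hPi _ _).add ((hQi N).intervalIntegrable)
    have e4 : ((N + 1 : ℕ) : ℝ) * h N = T := by
      simp only [h]
      push_cast
      field_simp
    rw [e4] at e3
    simp only [Nat.cast_zero, zero_mul] at e3
    rw [← e3, Finset.sum_congr rfl fun k _ ↦ e2 k,
      Finset.sum_range_sub (fun k : ℕ ↦ ∫ x, φ ((k : ℝ) * h N) x ∂(μ ((k : ℝ) * h N) : Measure X)),
      e4]
    simp [hzero T (by simp), hzero 0 (by simp)]
  have hPlim : Tendsto (fun N ↦ ∫ r in 0..T, P N r) atTop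
      (𝓝 (∫ t in 0..T, ∫ x, ψ t x ∂(μ t : Measure X))) := by
    refine intervalIntegral.tendsto_integral_filter_of_dominated_convergence (fun _ ↦ C)
      (.of_forall fun N ↦ (hPm N).aestronglyMeasurable)
      (.of_forall fun N ↦ .of_forall fun r _ ↦ hPb N r) intervalIntegrable_const
      (.of_forall fun r _ ↦ ?_)
    have h1 : Tendsto (fun N ↦ (r, floorStep (h N) r + h N)) atTop (𝓝 (r, r + 0)) :=
      tendsto_const_nhds.prodMk_nhds ((hfl r).add hhlim)
    rw [add_zero] at h1
    exact (hpair.tendsto (r, r)).comp h1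
  have hQlim : Tendsto (fun N ↦ ∫ r, Q N r) atTop
      (𝓝 (∫ t, ∫ x, inner ℝ (G.grad (idx t) x) (c t x) ∂(μ t : Measure X))) := by
    have e1 : ∀ {τ : ℝ → ℝ}, Measurable τ →
        ∫ t, ∫ x, inner ℝ (G.grad (idx (τ t)) x) (c t x) ∂(μ t : Measure X) =
        ∫ z, inner ℝ (G.grad (idx (τ z.1)) z.2) (c z.1 z.2) ∂(spaceTime μ hflow.continuous) :=
      fun hτ ↦ (integral_spaceTime hflow.continuous (hi hτ)).symm
    rw [e1 (τ := fun t ↦ t) measurable_id]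
    simp_rw [Q, e1 (measurable_floorStep _)]
    refine tendsto_integral_of_dominated_convergence (fun z ↦ B * ‖c z.1 z.2‖)
      (fun N ↦ hm (measurable_floorStep _)) (hcn.const_mul B)
      (fun N ↦ .of_forall fun z ↦ hbound _ z) (.of_forall fun z ↦ ?_)
    exact (((hDc z.2).tendsto z.1).comp (hfl z.1)).inner tendsto_const_nhds
  have := hPlim.add hQlim
  simp only [hsum] at this
  exact tendsto_nhds_unique this tendsto_const_nhds

end TimeDependent

section Bridge

variable {n : ℕ} {M : Type*} [TopologicalSpace M] [T2Space M] [CompactSpace M]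
  [ChartedSpace (EuclideanSpace ℝ (Fin n)) M] [IsManifold (𝓡 n) ∞ M]
  [RiemannianBundle (fun x : M ↦ TangentSpace (𝓡 n) x)]
  [IsContMDiffRiemannianBundle (𝓡 n) ∞ (EuclideanSpace ℝ (Fin n))
    (fun x : M ↦ TangentSpace (𝓡 n) x)]
  [MeasurableSpace M] [BorelSpace M]

theorem contMDiff_comp_fst {ζ : M → ℝ} (hζ : ContMDiff (𝓡 n) 𝓘(ℝ, ℝ) 1 ζ) :
    ContMDiff ((𝓡 n).prod 𝓘(ℝ, ℝ)) 𝓘(ℝ, ℝ) 1 fun q : M × ℝ ↦ ζ q.1 :=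
  hζ.comp contMDiff_fst

/-- The `C¹` functions on `M` with their gradients in an orthonormal frame. -/
def BorelFrame.gradientFamily (b : BorelFrame n M) :
    GradientFamily {ζ : M → ℝ // ContMDiff (𝓡 n) 𝓘(ℝ, ℝ) 1 ζ} M (EuclideanSpace ℝ (Fin n)) where
  toFun ζ := ⟨ζ.1, ζ.2.continuous⟩
  grad ζ := b.gradient (fun q ↦ ζ.1 q.1) 0
  measurable_grad ζ := (b.measurable_gradient (contMDiff_comp_fst ζ.2)).comp
    (measurable_const.prodMk measurable_id)
  continuous_inner ζ ξ := (b.continuous_inner_gradient (contMDiff_comp_fst ζ.2)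
    (contMDiff_comp_fst ξ.2)).comp (continuous_id.prodMk continuous_const)
  denseRange := by
    intro f
    rw [Metric.mem_closure_iff]
    intro ε hε
    obtain ⟨g, hg, -⟩ := f.continuous.exists_contMDiff_approx (𝓡 n) 1
      (ε := fun _ ↦ ε / 2) continuous_const fun _ ↦ half_pos hε
    refine ⟨_, ⟨⟨g, g.contMDiff⟩, rfl⟩, ?_⟩
    refine ((ContinuousMap.dist_le (half_pos hε).le).2 fun x ↦ ?_).trans_lt (half_lt_self hε)
    rw [dist_comm]
    exact (hg x).le

variable (b : BorelFrame n M) {T : ℝ} {ν η : ProbabilityMeasure M} {K : M → M → ℝ}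

/-- The coordinate form of a pair, extended to all times. -/
def BorelFrame.toFlow (b : BorelFrame n M) (T : ℝ) (p : Pair n M) :
    (ℝ → ProbabilityMeasure M) × (ℝ → M → EuclideanSpace ℝ (Fin n)) :=
  (fun t ↦ p.1 (max 0 (min t T)), fun t x ↦
    (Ioo 0 T).indicator (fun t ↦ (b.basis x).repr (p.2 t x)) t)

/-- The pair with prescribed coordinates. -/
def BorelFrame.ofFlow (b : BorelFrame n M)
    (q : (ℝ → ProbabilityMeasure M) × (ℝ → M → EuclideanSpace ℝ (Fin n))) : Pair n M :=
  (q.1, fun t x ↦ (b.basis x).repr.symm (q.2 t x))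

theorem BorelFrame.toFlow_fst {p : Pair n M} {t : ℝ} (ht : t ∈ Icc 0 T) :
    (b.toFlow T p).1 t = p.1 t := by
  simp [toFlow, ht.1, ht.2]

theorem BorelFrame.toFlow_snd {p : Pair n M} {t : ℝ} (ht : t ∈ Ioo 0 T) (x : M) :
    (b.toFlow T p).2 t x = (b.basis x).repr (p.2 t x) := by
  simp [toFlow, ht]

theorem BorelFrame.toFlow_snd_of_notMem {p : Pair n M} {t : ℝ} (ht : t ∉ Ioo 0 T) (x : M) :
    (b.toFlow T p).2 t x = 0 := by
  simp only [toFlow, indicator_of_notMem ht]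

theorem BorelFrame.flowEnergy_toFlow {p : Pair n M} {t : ℝ} (ht : t ∈ Ioo 0 T) :
    flowEnergy K (b.toFlow T p).1 (b.toFlow T p).2 t = energy K p t := by
  simp only [flowEnergy, energy, b.toFlow_fst (Ioo_subset_Icc_self ht), b.toFlow_snd ht]
  refine lintegral_congr fun x ↦ ?_
  rw [LinearIsometryEquiv.enorm_map]

theorem BorelFrame.energy_ofFlow
    {q : (ℝ → ProbabilityMeasure M) × (ℝ → M → EuclideanSpace ℝ (Fin n))} {t : ℝ} :
    energy K (b.ofFlow q) t = flowEnergy K q.1 q.2 t := by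
  simp only [flowEnergy, energy, ofFlow]
  refine lintegral_congr fun x ↦ ?_
  rw [LinearIsometryEquiv.enorm_map]

theorem BorelFrame.measurable_toFlow {p : Pair n M} (hp : IsBorelField T p.2) :
    Measurable (uncurry (b.toFlow T p).2) := by
  let e : Ioo (0 : ℝ) T × M → ℝ × M := Prod.map (↑) id
  have he : MeasurableEmbedding e :=
    (MeasurableEmbedding.subtype_coe measurableSet_Ioo).prodMap .id
  have hf : Measurable fun q : Ioo (0 : ℝ) T × M ↦ (b.basis q.2).repr (p.2 q.1 q.2) :=
    @Measurable.comp _ _ _ _ (borel (TangentBundle (𝓡 n) M)) _ _ _ b.measurable_repr hp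
  convert he.measurable_extend hf (measurable_const (a := (0 : EuclideanSpace ℝ (Fin n)))) using 1
  ext1 ⟨t, x⟩
  by_cases ht : t ∈ Ioo 0 T
  · have h1 : (t, x) = e (⟨t, ht⟩, x) := rfl
    rw [h1, he.injective.extend_apply, ← h1]
    exact b.toFlow_snd ht x
  · rw [extend_apply']
    · exact b.toFlow_snd_of_notMem ht x
    · rintro ⟨⟨s, y⟩, h⟩
      have h1 : (s : ℝ) = t := congrArg Prod.fst h
      exact ht (h1 ▸ s.2)

theorem BorelFrame.isBorelField_ofFlow
    {q : (ℝ → ProbabilityMeasure M) × (ℝ → M → EuclideanSpace ℝ (Fin n))}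
    (hq : Measurable (uncurry q.2)) : IsBorelField T (b.ofFlow q).2 := by
  have h1 : Measurable fun z : Ioo (0 : ℝ) T × M ↦ (z.2, q.2 z.1 z.2) :=
    measurable_snd.prodMk (hq.comp ((measurable_subtype_coe.comp measurable_fst).prodMk
      measurable_snd))
  exact @Measurable.comp _ _ _ _ _ (borel (TangentBundle (𝓡 n) M)) _ _ b.measurable_symm h1

theorem isTestFunction_mul {ζ : M → ℝ} (hζ : ContMDiff (𝓡 n) 𝓘(ℝ, ℝ) 1 ζ) {θ : ℝ → ℝ}
    (hθ : ContDiff ℝ 1 θ) (hc : HasCompactSupport θ) (hs : tsupport θ ⊆ Ioo 0 T) :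
    IsTestFunction n T fun q : M × ℝ ↦ θ q.2 * ζ q.1 := by
  have hsupp : (support fun q : M × ℝ ↦ θ q.2 * ζ q.1) ⊆ univ ×ˢ tsupport θ := fun q hq ↦
    ⟨mem_univ _, subset_tsupport _ (left_ne_zero_of_mul hq)⟩
  refine ⟨?_, ?_, ?_⟩
  · exact (hθ.contMDiff.comp contMDiff_snd).smul (contMDiff_comp_fst hζ)
  · exact HasCompactSupport.intro (isCompact_univ.prod hc) fun q hq ↦ by
      by_contra h
      exact hq (hsupp h)
  · exact (closure_minimal hsupp (isClosed_univ.prod (isClosed_tsupport θ))).trans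
      (prod_mono le_rfl hs)

theorem spaceDeriv_mul {ζ : M → ℝ} (hζ : ContMDiff (𝓡 n) 𝓘(ℝ, ℝ) 1 ζ) (θ : ℝ → ℝ) (t : ℝ) (x : M)
    (w : TangentSpace (𝓡 n) x) : spaceDeriv (fun q : M × ℝ ↦ θ q.2 * ζ q.1) t x w =
      θ t * spaceDeriv (fun q : M × ℝ ↦ ζ q.1) 0 x w := by
  have h := const_smul_mfderiv (hζ.mdifferentiableAt one_ne_zero (x := x)) (θ t)
  exact congrArg (fun L ↦ L w) h

variable [TopologicalSpace.MetrizableSpace M]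

theorem BorelFrame.toFlow_mem (hT : 0 < T) {p : Pair n M} (hp : p ∈ CE n T ν η) :
    b.toFlow T p ∈ FlowSet b.gradientFamily T ν η := by
  obtain ⟨⟨hcont, hborel, hfin, heq⟩, h0, h1⟩ := hp
  set q := b.toFlow T p with hq
  have hclamp : ∀ t, max 0 (min t T) ∈ Icc 0 T := fun t ↦
    ⟨le_max_left _ _, max_le hT.le (min_le_right _ _)⟩
  have hμ : Continuous q.1 := hcont.comp_continuous (by fun_prop) hclamp
  have hc : Measurable (uncurry q.2) := b.measurable_toFlow hborel
  have hoff : ∀ t ∉ Ioo 0 T, ∀ x, q.2 t x = 0 := fun t ht x ↦ b.toFlow_snd_of_notMem ht x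
  have hL : ∫⁻ t, ∫⁻ x, ‖q.2 t x‖ₑ ∂(q.1 t : Measure M) < ⊤ := by
    rw [← setLIntegral_eq_of_support_subset (s := Ioo 0 T)]
    · refine lt_of_eq_of_lt (setLIntegral_congr_fun measurableSet_Ioo fun t ht ↦ ?_) hfin
      simp only [hq, b.toFlow_fst (Ioo_subset_Icc_self ht), b.toFlow_snd ht]
      refine lintegral_congr fun x ↦ ?_
      rw [LinearIsometryEquiv.enorm_map]
    · intro t ht
      by_contra h
      exact ht (by simp [hoff t h])
  refine ⟨⟨hμ, hc, hL, fun ζ s t _ ↦ ?_⟩, hoff, ?_, ?_⟩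
  · have hint := integrable_inner_spaceTime (G := b.gradientFamily) hμ hc hL ζ
    have hae : ∀ᵐ t, Integrable (fun x ↦ inner ℝ (b.gradientFamily.grad ζ x) (q.2 t x))
      (q.1 t : Measure M) := ((Measure.integrable_compProd_iff hint.1).1 hint).1
    refine sub_eq_integral_of_weakDeriv_of_clamp hT
      (m := fun t ↦ ∫ x, b.gradientFamily.toFun ζ x ∂(q.1 t : Measure M))
      (Continuous.integral_probabilityMeasure (F := fun _ x ↦ b.gradientFamily.toFun ζ x)
        ((b.gradientFamily.toFun ζ).continuous.comp continuous_snd) hμ) (fun t ↦ ?_)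
      (integrable_integral_curve hμ hint) (fun t ht ↦ ?_) (fun θ hθ hθc hθs ↦ ?_) s t
    · have : q.1 (max 0 (min t T)) = q.1 t := b.toFlow_fst (hclamp t)
      simp only [this]
    · simp [hoff t ht]
    · have key := heq _ (isTestFunction_mul ζ.2 hθ hθc hθs)
      rw [← key, ← setIntegral_eq_integral_of_forall_compl_eq_zero (s := Ioo 0 T)]
      · refine setIntegral_congr_ae measurableSet_Ioo ?_
        filter_upwards [hae] with t hti ht
        have hμt : q.1 t = p.1 t := b.toFlow_fst (Ioo_subset_Icc_self ht)
        have hI : Integrable (fun x ↦ deriv θ t * ζ.1 x) (q.1 t : Measure M) :=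
          (continuous_const.mul ζ.2.continuous).integrable_of_hasCompactSupport
            (HasCompactSupport.of_compactSpace _)
        rw [← hμt]
        calc _ = ∫ x, (deriv θ t * ζ.1 x + θ t * inner ℝ (b.gradientFamily.grad ζ x) (q.2 t x))
              ∂(q.1 t : Measure M) := by
              rw [integral_add hI (hti.const_mul _), integral_const_mul, integral_const_mul]
              rfl
          _ = _ := by
              refine integral_congr_ae (.of_forall fun x ↦ ?_)
              have e1 : deriv (fun s ↦ θ s * ζ.1 x) t = deriv θ t * ζ.1 x :=
                deriv_mul_const (hθ.differentiable one_ne_zero t) _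
              simp only [e1, spaceDeriv_mul ζ.2, hq, b.toFlow_snd ht]
              congr 2
              exact b.inner_gradient _ _ _ _
      · intro t ht
        have h2 : θ t = 0 := image_eq_zero_of_notMem_tsupport fun h ↦ ht (hθs h)
        have h3 : deriv θ t = 0 := by
          by_contra h
          exact ht (hθs (support_deriv_subset h))
        simp [h2, h3]
  · rw [hq, b.toFlow_fst ⟨le_rfl, hT.le⟩, h0]
  · rw [hq, b.toFlow_fst ⟨hT.le, le_rfl⟩, h1]

end Bridge

section Bridge

variable {n : ℕ} {M : Type*} [TopologicalSpace M] [T2Space M] [CompactSpace M]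
  [ChartedSpace (EuclideanSpace ℝ (Fin n)) M] [IsManifold (𝓡 n) ∞ M]
  [RiemannianBundle (fun x : M ↦ TangentSpace (𝓡 n) x)]
  [IsContMDiffRiemannianBundle (𝓡 n) ∞ (EuclideanSpace ℝ (Fin n))
    (fun x : M ↦ TangentSpace (𝓡 n) x)]
  [MeasurableSpace M] [BorelSpace M]

theorem exists_bound_of_compact_time {f : ℝ × M → ℝ} (hf : Continuous f) {T : ℝ}
    (h0 : ∀ t ∉ Ioo 0 T, ∀ x, f (t, x) = 0) : ∃ C, 0 ≤ C ∧ ∀ t x, |f (t, x)| ≤ C := by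
  obtain ⟨C, hC⟩ := ((isCompact_Icc (a := (0 : ℝ)) (b := T)).prod
    (isCompact_univ (X := M))).exists_bound_of_continuousOn hf.continuousOn
  refine ⟨|C|, abs_nonneg C, fun t x ↦ ?_⟩
  by_cases ht : t ∈ Ioo 0 T
  · exact (hC (t, x) ⟨Ioo_subset_Icc_self ht, mem_univ x⟩).trans (le_abs_self C)
  · rw [h0 t ht x, abs_zero]
    exact abs_nonneg C

variable (b : BorelFrame n M) {T : ℝ} {ν η : ProbabilityMeasure M} {K : M → M → ℝ}
  [TopologicalSpace.MetrizableSpace M]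

theorem BorelFrame.ofFlow_mem (hT : 0 < T)
    {q : (ℝ → ProbabilityMeasure M) × (ℝ → M → EuclideanSpace ℝ (Fin n))}
    (hq : q ∈ FlowSet b.gradientFamily T ν η) : b.ofFlow q ∈ CE n T ν η := by
  obtain ⟨hflow, hoff, h0, h1⟩ := hq
  refine ⟨⟨hflow.continuous.continuousOn, b.isBorelField_ofFlow hflow.measurable, ?_, ?_⟩, h0, h1⟩
  · refine lt_of_le_of_lt (setLIntegral_le_lintegral _ _) (lt_of_eq_of_lt ?_ hflow.lintegral_lt_top)
    simp only [ofFlow, LinearIsometryEquiv.enorm_map]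
  · rintro φ ⟨hφ, -, hsupp⟩
    have hnear : ∀ t ∉ Ioo 0 T, ∀ x, φ =ᶠ[𝓝 (x, t)] 0 := fun t ht x ↦
      notMem_tsupport_iff_eventuallyEq.1 fun h ↦ ht (hsupp h).2
    have hslice : ∀ t, ContMDiff (𝓡 n) 𝓘(ℝ, ℝ) 1 fun x ↦ φ (x, t) := fun t ↦
      hφ.comp (contMDiff_id.prodMk contMDiff_const)
    let idx : ℝ → {ζ : M → ℝ // ContMDiff (𝓡 n) 𝓘(ℝ, ℝ) 1 ζ} := fun t ↦ ⟨_, hslice t⟩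
    have hgrad : ∀ t x, b.gradientFamily.grad (idx t) x = b.gradient φ t x := fun t x ↦ rfl
    let ψ : ℝ → M → ℝ := fun t x ↦
      mfderiv ((𝓡 n).prod 𝓘(ℝ, ℝ)) 𝓘(ℝ, ℝ) φ (x, t) (0, (1 : ℝ))
    have hderiv : ∀ x t, HasDerivAt (fun s ↦ φ (x, s)) (ψ t x) t := fun x t ↦
      hasDerivAt_time hφ t x
    have hψ : Continuous (uncurry ψ) := by
      have hz : Continuous fun x : M ↦ zeroSection (EuclideanSpace ℝ (Fin n))
          (fun x : M ↦ TangentSpace (𝓡 n) x) x := Bundle.Trivialization.continuous_zeroSection ℝ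
      exact (continuous_mfderiv_prod hφ).comp
        ((hz.comp continuous_snd).prodMk (continuous_fst.prodMk continuous_const))
    have hψ0 : ∀ t ∉ Ioo 0 T, ∀ x, ψ t x = 0 := by
      intro t ht x
      refine (hderiv x t).unique ((hasDerivAt_const t (0 : ℝ)).congr_of_eventuallyEq ?_)
      exact (Continuous.prodMk_right x).continuousAt.eventually (hnear t ht x)
    obtain ⟨C, -, hC⟩ := exists_bound_of_compact_time hψ hψ0
    have hsd0 : ∀ t ∉ Ioo 0 T, ∀ x, b.gradient φ t x = 0 := by
      intro t ht x
      have h2 : (fun y : M ↦ φ (y, t)) = fun _ ↦ 0 :=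
        funext fun y ↦ (hnear t ht y).eq_of_nhds
      ext i
      change mfderiv (𝓡 n) 𝓘(ℝ, ℝ) (fun y : M ↦ φ (y, t)) x (b.basis x i) = 0
      rw [h2, mfderiv_const]
      rfl
    obtain ⟨B, hB0, hB⟩ := exists_bound_of_compact_time
      (f := fun z : ℝ × M ↦ inner ℝ (b.gradient φ z.1 z.2) (b.gradient φ z.1 z.2)) (T := T)
      ((b.continuous_inner_gradient hφ hφ).comp continuous_swap)
      fun t ht x ↦ by simp [hsd0 t ht x]
    have hD : ∀ t x, ‖b.gradient φ t x‖ ≤ B + 1 := by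
      intro t x
      have := (le_abs_self _).trans (hB t x)
      simp only [real_inner_self_eq_norm_sq] at this
      nlinarith [norm_nonneg (b.gradient φ t x)]
    have key := hflow.integral_eq_zero (φ := fun t x ↦ φ (x, t)) (ψ := ψ) (idx := idx) hT hoff
      (fun t x ↦ rfl) hderiv hψ hC (b.measurable_gradient hφ) (b.continuous_gradient_apply hφ) hD
      fun t ht x ↦ (hnear t ht x).eq_of_nhds
    have hcn : Integrable (fun z : ℝ × M ↦ ‖q.2 z.1 z.2‖) (spaceTime q.1 hflow.continuous) := by
      refine ⟨hflow.measurable.norm.aestronglyMeasurable, ?_⟩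
      rw [hasFiniteIntegral_iff_enorm, lintegral_spaceTime (f := fun z ↦ ‖‖q.2 z.1 z.2‖‖ₑ)
        hflow.continuous hflow.measurable.norm.enorm]
      simpa using hflow.lintegral_lt_top
    have hint : Integrable (fun z : ℝ × M ↦
        (inner ℝ (b.gradient φ z.1 z.2) (q.2 z.1 z.2) : ℝ)) (spaceTime q.1 hflow.continuous) :=
      (hcn.const_mul (B + 1)).mono'
        ((b.measurable_gradient hφ).inner hflow.measurable).aestronglyMeasurable
        (.of_forall fun z ↦ (norm_inner_le_norm _ _).trans
          (mul_le_mul_of_nonneg_right (hD _ _) (norm_nonneg _)))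
    have hae := ((Measure.integrable_compProd_iff hint.1).1 hint).1
    have hψi : ∀ t, Integrable (ψ t) (q.1 t : Measure M) := fun t ↦
      (hψ.comp (continuous_const.prodMk continuous_id)).integrable_of_hasCompactSupport
        (HasCompactSupport.of_compactSpace _)
    have hψt : Continuous fun t ↦ ∫ x, ψ t x ∂(q.1 t : Measure M) :=
      Continuous.integral_probabilityMeasure hψ hflow.continuous
    have hres : ∫ t, ∫ x, inner ℝ (b.gradientFamily.grad (idx t) x) (q.2 t x)
        ∂(q.1 t : Measure M) = ∫ t in Ioo 0 T, ∫ x,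
          inner ℝ (b.gradientFamily.grad (idx t) x) (q.2 t x) ∂(q.1 t : Measure M) := by
      rw [setIntegral_eq_integral_of_forall_compl_eq_zero]
      intro t ht
      simp only [hoff t ht, inner_zero_right, integral_zero]
    rw [intervalIntegral.integral_of_le hT.le, integral_Ioc_eq_integral_Ioo, hres,
      ← integral_add] at key
    · refine Eq.trans ?_ key
      refine setIntegral_congr_ae measurableSet_Ioo ?_
      filter_upwards [hae] with t hti _
      refine Eq.trans ?_ (integral_add (hψi t) hti)
      refine integral_congr_ae (.of_forall fun x ↦ ?_)
      simp only [(hderiv x t).deriv, ofFlow]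
      congr 1
      rw [← b.inner_gradient, LinearIsometryEquiv.apply_symm_apply, ← hgrad]
    · exact (hψt.integrableOn_Icc (a := 0) (b := T)).mono_set Ioo_subset_Icc_self
    · exact (integrable_integral_curve hflow.continuous hint).integrableOn

theorem BorelFrame.length_eq_toFlow (hT : 0 < T) {p : Pair n M} (hp : p ∈ CE n T ν η) :
    flowLength K (b.toFlow T p) = length K T p := by
  rw [flowLength, FlowSet.lintegral_eq (Φ := fun a ↦ a ^ (1 / 2 : ℝ)) (by simp)
    (b.toFlow_mem hT hp)]
  refine setLIntegral_congr_fun measurableSet_Ioo fun t ht ↦ ?_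
  simp only [b.flowEnergy_toFlow ht]
  rfl

theorem BorelFrame.action_eq_toFlow {p : Pair n M} (hp : p ∈ CE n 1 ν η) :
    flowAction K (b.toFlow 1 p) = action K p := by
  rw [flowAction, FlowSet.lintegral_eq (Φ := fun a ↦ a) rfl (b.toFlow_mem one_pos hp)]
  exact setLIntegral_congr_fun measurableSet_Ioo fun t ht ↦ b.flowEnergy_toFlow ht

theorem BorelFrame.length_ofFlow
    {q : (ℝ → ProbabilityMeasure M) × (ℝ → M → EuclideanSpace ℝ (Fin n))}
    (hq : q ∈ FlowSet b.gradientFamily T ν η) :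
    length K T (b.ofFlow q) = flowLength K q := by
  rw [flowLength, FlowSet.lintegral_eq (Φ := fun a ↦ a ^ (1 / 2 : ℝ)) (by simp) hq]
  simp only [length, speed, b.energy_ofFlow]

theorem BorelFrame.action_ofFlow
    {q : (ℝ → ProbabilityMeasure M) × (ℝ → M → EuclideanSpace ℝ (Fin n))}
    (hq : q ∈ FlowSet b.gradientFamily 1 ν η) :
    action K (b.ofFlow q) = flowAction K q := by
  rw [flowAction, FlowSet.lintegral_eq (Φ := fun a ↦ a) rfl hq]
  simp only [action, b.energy_ofFlow]

theorem BorelFrame.W_eq : W n K ν η = flowDist b.gradientFamily K ν η := by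
  unfold W flowDist
  congr 2
  ext a
  constructor
  · rintro ⟨p, hp, rfl⟩
    exact ⟨_, b.toFlow_mem one_pos hp, b.action_eq_toFlow hp⟩
  · rintro ⟨q, hq, rfl⟩
    exact ⟨_, b.ofFlow_mem one_pos hq, b.action_ofFlow hq⟩

theorem BorelFrame.lengthInf_eq (hT : 0 < T) :
    lengthInf n K T ν η = flowLengthInf b.gradientFamily K T ν η := by
  unfold lengthInf flowLengthInf
  congr 1
  ext a
  constructor
  · rintro ⟨p, hp, rfl⟩
    exact ⟨_, b.toFlow_mem hT hp, b.length_eq_toFlow hT hp⟩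
  · rintro ⟨q, hq, rfl⟩
    exact ⟨_, b.ofFlow_mem hT hq, b.length_ofFlow hq⟩

end Bridge

end NonlocalTransport

end

theorem mainTheorem1 {n : ℕ} {M : Type*} [TopologicalSpace M] [T2Space M] [CompactSpace M]
    [ChartedSpace (EuclideanSpace ℝ (Fin n)) M] [IsManifold (𝓡 n) ∞ M]
    [RiemannianBundle (fun x : M ↦ TangentSpace (𝓡 n) x)]
    [IsContMDiffRiemannianBundle (𝓡 n) ∞ (EuclideanSpace ℝ (Fin n))
      (fun x : M ↦ TangentSpace (𝓡 n) x)]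
    [MeasurableSpace M] [BorelSpace M]
    (K : M → M → ℝ) (hK : Continuous (Function.uncurry K))
    (hKpos : ∃ C : ℝ, 0 < C ∧ ∀ x y, C ≤ K x y) :
    -- existence of minimizers of the action
    (∀ μ₀ μ₁ : ProbabilityMeasure M, NonlocalTransport.W n K μ₀ μ₁ < (⊤ : ℝ≥0∞) →
      ∃ p ∈ NonlocalTransport.CE n 1 μ₀ μ₁,
        NonlocalTransport.W n K μ₀ μ₁ ^ 2 = NonlocalTransport.action K p) ∧
    -- the distance is the infimum of the length, for every time horizon
    (∀ μ₀ μ₁ : ProbabilityMeasure M, ∀ T : ℝ, 0 < T →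
      NonlocalTransport.W n K μ₀ μ₁ = NonlocalTransport.lengthInf n K T μ₀ μ₁) ∧
    -- minimizers of the action are exactly the minimizers of the length with constant speed
    (∀ μ₀ μ₁ : ProbabilityMeasure M, NonlocalTransport.W n K μ₀ μ₁ < (⊤ : ℝ≥0∞) →
      ∀ p ∈ NonlocalTransport.CE n 1 μ₀ μ₁,
        (NonlocalTransport.W n K μ₀ μ₁ ^ 2 = NonlocalTransport.action K p ↔
          NonlocalTransport.length K 1 p = NonlocalTransport.lengthInf n K 1 μ₀ μ₁ ∧
            ∃ c : ℝ≥0∞, ∀ᵐ t ∂(volume.restrict (Ioo (0 : ℝ) 1)),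
              NonlocalTransport.speed K p t = c)) ∧
    -- every minimizer of the length is a reparametrization of a minimizer of the action
    (∀ μ₀ μ₁ : ProbabilityMeasure M, NonlocalTransport.W n K μ₀ μ₁ < (⊤ : ℝ≥0∞) →
      ∀ T : ℝ, 0 < T → ∀ p ∈ NonlocalTransport.CE n T μ₀ μ₁,
        NonlocalTransport.length K T p = NonlocalTransport.lengthInf n K T μ₀ μ₁ →
          ∃ q ∈ NonlocalTransport.CE n 1 μ₀ μ₁,
            NonlocalTransport.W n K μ₀ μ₁ ^ 2 = NonlocalTransport.action K q ∧
            ∃ τ : ℝ → ℝ, MonotoneOn τ (Icc 0 T) ∧ ContinuousOn τ (Icc 0 T) ∧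
              τ 0 = 0 ∧ τ T = 1 ∧ ∀ t ∈ Icc 0 T, p.1 t = q.1 (τ t)) ∧
    -- minimizers of the action have constant speed
    (∀ μ₀ μ₁ : ProbabilityMeasure M, NonlocalTransport.W n K μ₀ μ₁ < (⊤ : ℝ≥0∞) →
      ∀ p ∈ NonlocalTransport.CE n 1 μ₀ μ₁,
        NonlocalTransport.W n K μ₀ μ₁ ^ 2 = NonlocalTransport.action K p →
          (∀ᵐ t ∂(volume.restrict (Ioo (0 : ℝ) 1)),
            NonlocalTransport.speed K p t = NonlocalTransport.W n K μ₀ μ₁) ∧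
          (∀ s t : ℝ, 0 ≤ s → s ≤ t → t ≤ 1 →
            NonlocalTransport.W n K (p.1 s) (p.1 t) =
              ENNReal.ofReal (t - s) * NonlocalTransport.W n K μ₀ μ₁)) := by
  have := Manifold.metrizableSpace (𝓡 n) M
  obtain ⟨b⟩ := NonlocalTransport.BorelFrame.nonempty (n := n) (M := M)
  have hsq : ∀ {ν η : ProbabilityMeasure M} {p}, p ∈ NonlocalTransport.CE n 1 ν η →
      NonlocalTransport.length K 1 p ^ 2 ≤ NonlocalTransport.action K p := fun hp ↦ by
    rw [← b.length_eq_toFlow one_pos hp, ← b.action_eq_toFlow hp]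
    exact NonlocalTransport.FlowSet.length_sq_le hK (b.toFlow_mem one_pos hp)
  have hW : ∀ ν η : ProbabilityMeasure M, ∀ T : ℝ, 0 < T →
      NonlocalTransport.W n K ν η = NonlocalTransport.lengthInf n K T ν η := fun ν η T hT ↦ by
    rw [b.W_eq, b.lengthInf_eq hT]
    exact NonlocalTransport.flowDist_eq_flowLengthInf hK hT
  have hspeed : ∀ ν η : ProbabilityMeasure M, NonlocalTransport.W n K ν η < (⊤ : ℝ≥0∞) →
      ∀ p ∈ NonlocalTransport.CE n 1 ν η,
        NonlocalTransport.W n K ν η ^ 2 = NonlocalTransport.action K p →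
        ∀ᵐ t ∂(volume.restrict (Ioo (0 : ℝ) 1)),
          NonlocalTransport.speed K p t = NonlocalTransport.W n K ν η := by
    intro ν η hfin p hp hmin
    rw [b.W_eq] at hfin hmin ⊢
    rw [← b.action_eq_toFlow hp] at hmin
    have h := NonlocalTransport.FlowSet.ae_speed_eq hK (b.toFlow_mem one_pos hp) hfin hmin
    filter_upwards [h, ae_restrict_mem measurableSet_Ioo] with t ht htm
    rw [← ht, b.flowEnergy_toFlow htm]
    rfl
  refine ⟨fun ν η hfin ↦ ?_, hW, fun ν η hfin p hp ↦ ⟨fun hmin ↦ ?_, ?_⟩,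
    fun ν η hfin T hT p hp hmin ↦ ?_, fun ν η hfin p hp hmin ↦ ⟨hspeed ν η hfin p hp hmin,
      fun s t hs hst ht ↦ ?_⟩⟩
  · rw [b.W_eq] at hfin ⊢
    obtain ⟨q, hq, h⟩ := NonlocalTransport.exists_flowAction_eq hK hKpos hfin
    exact ⟨_, b.ofFlow_mem one_pos hq, by rw [h, b.action_ofFlow hq]⟩
  · have h := hspeed ν η hfin p hp hmin
    refine ⟨?_, _, h⟩
    rw [← hW ν η 1 one_pos, NonlocalTransport.length, lintegral_congr_ae h]
    simp
  · rintro ⟨hlen, c, hc⟩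
    rw [← hW ν η 1 one_pos, NonlocalTransport.length, lintegral_congr_ae hc] at hlen
    simp only [lintegral_const, Measure.restrict_apply_univ, Real.volume_Ioo, sub_zero,
      ENNReal.ofReal_one, mul_one] at hlen
    rw [← hlen, NonlocalTransport.action]
    have h : ∀ᵐ t ∂(volume.restrict (Ioo (0 : ℝ) 1)), NonlocalTransport.energy K p t = c ^ 2 := by
      filter_upwards [hc] with t ht
      rw [← ht, NonlocalTransport.speed, NonlocalTransport.rpow_half_sq]
    rw [lintegral_congr_ae h]
    simp
  · rw [← hW ν η T hT, b.W_eq, ← b.length_eq_toFlow hT hp] at hmin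
    rw [b.W_eq] at hfin ⊢
    obtain ⟨q, hq, h1, S, hS, hSm, hS0, hST, hSq⟩ :=
      NonlocalTransport.FlowSet.exists_reparam_minimizer hK hKpos hT (b.toFlow_mem hT hp) hfin hmin
    refine ⟨_, b.ofFlow_mem one_pos hq, by rw [h1, b.action_ofFlow hq], S, hSm.monotoneOn _,
      hS.continuousOn, hS0, hST, fun t ht ↦ ?_⟩
    rw [← b.toFlow_fst ht, ← hSq t]
    rfl
  · rw [b.W_eq] at hfin hmin
    rw [← b.action_eq_toFlow hp] at hmin
    have h := NonlocalTransport.FlowSet.flowDist_eq hK (b.toFlow_mem one_pos hp) hfin hmin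
      hs hst ht
    rw [b.W_eq, b.W_eq, ← h, b.toFlow_fst ⟨hs, hst.trans ht⟩, b.toFlow_fst ⟨hs.trans hst, ht⟩]
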